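/- Let $p$ be a prime and $n\ge 1$. For a group $G$, a submonoid $\Delta\subset G$ and a subgroup $\Gamma\subset\Delta$ such that every $\Gamma A\Gamma$ ($A\in\Delta$) is a finite union of left and of right cosets of $\Gamma$, the Hecke ring $R(\Gamma,\Delta)$ is the free abelian group on $\Gamma\backslash\Delta/\Gamma$ with product $(\Gamma A\Gamma)(\Gamma B\Gamma)=\sum_C m_C\,(\Gamma C\Gamma)$, $m_C=|\{\alpha\Gamma\in\Gamma A\Gamma/\Gamma : \alpha^{-1}C\in\Gamma B\Gamma\}|$. Let $\Delta=GSp_{2n}(\mathbb Q_p)\cap M_{2n}(\mathbb Z_p)$, $\Gamma=GSp_{2n}(\mathbb Z_p)$, let $\mu(A)$ be the multiplier of $A$, put $R_n=R(\Gamma,\Delta)$, $T(A)=\Gamma A\Gamma$, $T(p^k)=\sum T(A)$ over the double cosets $\Gamma A\Gamma\subset\Delta$ with $v_p(\mu(A))=k$, and $P_n(X)=\sum_{k\ge0}T(p^k)X^k$. Let $\tilde\Delta=\Delta\times\mathbb Z_p^{2n}$ with product $(A,a)(B,b)=(AB,\,Ab+\mu(B)a)$, $\tilde\Gamma=\Gamma\times\mathbb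 Z_p^{2n}$, $\tilde R=R(\tilde\Gamma,\tilde\Delta)$ (the pair lies in the group $GSp_{2n}(\mathbb Q_p)\times\mathbb Q_p^{2n}$ with the same product), $\tilde T(A,a)=\tilde\Gamma(A,a)\tilde\Gamma$. For $A\in\Delta$ let $\tilde T(A)$ be the sum of the distinct double cosets $\tilde\Gamma(A,a)\tilde\Gamma$, $a\in\mathbb Z_p^{2n}$; let $\tilde T(p^k)$ be the sum of all $\tilde\Gamma(A,a)\tilde\Gamma$ with $v_p(\mu(A))=k$ and $\tilde P_n(X)=\sum_{k\ge0}\tilde T(p^k)X^k$. Let $L=\mathcal H^{(n)}$ be the Heisenberg Lie algebra over $\mathbb Z$ of dimension $2n+1$ (the matrices $\begin{pmatrix}0&a&c\\0&O_n&b\\0&0&0\end{pmatrix}$ of size $n+2$ over $\mathbb Z$) and $L_p=L\otimes\mathbb Z_p$. Let $\Gamma_{L_p}\subset\Delta_{L_p}$ consist of the automorphisms $\alpha$ of the Lie algebra $L\otimes\mathbb Q_p$, acting on the right, with $L_p^\alpha=L_p$, respectively $L_p^\alpha\subset L_p$. Put $R_{L_p}=R(\Gamma_{L_p},\Delta_{L_p})$,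 let $T_{L_p}(\alpha)=\Gamma_{L_p}\alpha\Gamma_{L_p}$, let $T_{L_p}(p^k)$ be the sum of all $T_{L_p}(\alpha)$ with $|L_p/L_p^\alpha|=p^k$, and $P_{L_p}(X)=\sum_{k\ge0}T_{L_p}(p^k)X^k$. All these pairs are double finite, all the sums above are finite, and there are ring homomorphisms $s:R_n\to\tilde R$, $\theta:\tilde R\to\tilde R$, $\phi:\tilde R\to R_n$ and a ring isomorphism $\iota:R_{L_p}\to\tilde R$ such that: (a) $s$ is injective and $s(T(A))=\tilde T(A,0)$ for all $A\in\Delta$; (b) $\tilde T(pE,0)$, with $E$ the identity matrix, is a left nonzero divisor of $\tilde R$ (that is, $\tilde T(pE,0)x=0$ implies $x=0$), and $\tilde T(A,a)\,\tilde T(pE,0)=\tilde T(pE,0)\,\tilde T(A,a)^{\theta}$ for all $(A,a)\in\tilde\Delta$; (c) for every $(A,a)\in\tilde\Delta$ one has $\tilde T(A,a)^{\theta^m}=s(\tilde T(A,a)^{\phi})$ for all sufficiently large $m$; (d) every $\alpha\in\Delta_{L_p}$ has, in the standard basis of $L$ and acting on coordinate row vectors, a matrix of the form $\begin{pmatrix}A&a\\0&\mu(A)\end{pmatrix}$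 with $(A,a)\in\tilde\Delta$, and then $\iota(T_{L_p}(\alpha))=\tilde T(A,a)$. They satisfy $\phi\circ s=\mathrm{id}_{R_n}$, $\phi\circ\theta=\phi$, and $\tilde T(A)^{\phi}=p^{\,n\,v_p(\mu(A))}\,T(A)$ for all $A\in\Delta$. Consequently $\tilde P_n^{\phi}(X)=P_n(p^nX)$; moreover $P_{L_p}^{\iota}(X)=\tilde P_n(X^{n+1})$, and hence, identifying $R_{L_p}$ with $\tilde R$ through $\iota$, $P_{\mathcal H^{(n)}_p}^{\phi}(X)=P_n(p^nX^{n+1})$. (Homomorphisms are applied to power series coefficientwise.) -/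

import Mathlib

set_option linter.unusedSectionVars false
set_option linter.unusedSimpArgs false

/-! ### The Hecke ring of a Hecke pair -/

namespace HeckeRing

variable {G : Type*} [Group G] {Δ : Submonoid G} {H : Subgroup G}

/-- A representative in `Δ` of a double coset. -/
noncomputable def rep (c : HeckeCoset Δ H H) : Δ :=
  Quotient.out (s := HeckeCoset.setoid Δ H H) c

/-- The double coset `H A H`, as a subset of `G`. -/
def cosetSet (c : HeckeCoset Δ H H) : Set G :=
  DoubleCoset.doubleCoset (rep c : G) H H

/-- For `a = HAH`, `b = HBH`, `c = HCH`, the structure constant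
`m_C = #{α H ∈ HAH / H | α⁻¹ C ∈ HBH}`. -/
noncomputable def structConst (a b c : HeckeCoset Δ H H) : ℕ :=
  Nat.card {x : G ⧸ H // ∃ α : G, (α : G ⧸ H) = x ∧ α ∈ cosetSet a ∧
    α⁻¹ * (rep c : G) ∈ cosetSet b}

theorem mk_rep (c : HeckeCoset Δ H H) : HeckeCoset.mk H H (rep c) = c :=
  Quotient.out_eq (s := HeckeCoset.setoid Δ H H) c

theorem mk_eq_mk {x y : Δ} : HeckeCoset.mk H H x = HeckeCoset.mk H H y ↔
    ∃ h ∈ H, ∃ k ∈ H, (y : G) = h * x * k := by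
  exact (Quotient.eq (r := HeckeCoset.setoid Δ H H)).trans DoubleCoset.rel_iff

theorem mem_cosetSet {c : HeckeCoset Δ H H} {x : G} (hx : x ∈ Δ) :
    x ∈ cosetSet c ↔ HeckeCoset.mk H H ⟨x, hx⟩ = c := by
  conv_rhs => rw [← mk_rep c, eq_comm, mk_eq_mk]
  exact DoubleCoset.mem_doubleCoset

theorem mem_of_mem_H [IsHeckeTriple Δ H H] {x : G} (hx : x ∈ H) : x ∈ Δ :=
  IsHeckeTriple.mem_of_mem_left H hx

theorem cosetSet_subset [IsHeckeTriple Δ H H] {c : HeckeCoset Δ H H} {x : G}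
    (hx : x ∈ cosetSet c) : x ∈ Δ := by
  obtain ⟨h, hh, k, hk, rfl⟩ := DoubleCoset.mem_doubleCoset.1 hx
  exact Δ.mul_mem (Δ.mul_mem (mem_of_mem_H hh) (rep c).2) (mem_of_mem_H hk)

theorem mk_mul_right [IsHeckeTriple Δ H H] {x h : G} (hx : x ∈ Δ) (hh : h ∈ H) (hxh : x * h ∈ Δ) :
    HeckeCoset.mk H H ⟨x * h, hxh⟩ = HeckeCoset.mk H H ⟨x, hx⟩ :=
  Eq.symm <| mk_eq_mk.2 ⟨1, H.one_mem, h, hh, by simp⟩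

theorem mk_mul_left [IsHeckeTriple Δ H H] {x h : G} (hx : x ∈ Δ) (hh : h ∈ H) (hxh : h * x ∈ Δ) :
    HeckeCoset.mk H H ⟨h * x, hxh⟩ = HeckeCoset.mk H H ⟨x, hx⟩ :=
  Eq.symm <| mk_eq_mk.2 ⟨h, hh, 1, H.one_mem, by simp⟩

theorem mul_right_mem_iff [IsHeckeTriple Δ H H] {x h : G} (hh : h ∈ H) : x * h ∈ Δ ↔ x ∈ Δ :=
  ⟨fun hx => by simpa using Δ.mul_mem hx (mem_of_mem_H (H.inv_mem hh)),
    fun hx => Δ.mul_mem hx (mem_of_mem_H hh)⟩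

theorem mul_left_mem_iff [IsHeckeTriple Δ H H] {x h : G} (hh : h ∈ H) : h * x ∈ Δ ↔ x ∈ Δ :=
  ⟨fun hx => by simpa using Δ.mul_mem (mem_of_mem_H (H.inv_mem hh)) hx,
    fun hx => Δ.mul_mem (mem_of_mem_H hh) hx⟩

open scoped Pointwise in
/-- A double coset is a finite union of left cosets. -/
theorem finite_leftCosets [IsHeckeTriple Δ H H] (a : HeckeCoset Δ H H) :
    {x : G ⧸ H | ∃ α : G, (α : G ⧸ H) = x ∧ α ∈ cosetSet a}.Finite := by
  set g : G := (rep a : G)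
  have hg : ((ConjAct.toConjAct g • H).relIndex H) ≠ 0 :=
    (IsHeckeTriple.mem_commensurator_right H (rep a)).1
  have hst : MulAction.stabilizer H (g : G ⧸ H) = (ConjAct.toConjAct g • H).subgroupOf H := by
    ext h
    rw [MulAction.mem_stabilizer_iff, Subgroup.mem_subgroupOf,
      Subgroup.mem_smul_pointwise_iff_exists]
    change (((h : G) * g : G) : G ⧸ H) = (g : G ⧸ H) ↔ _
    rw [eq_comm, QuotientGroup.eq]
    constructor
    · intro hh
      exact ⟨_, hh, by simp [ConjAct.smul_def, mul_assoc]⟩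
    · rintro ⟨s, hs, hsh⟩
      rw [← hsh]
      simpa [ConjAct.smul_def, mul_assoc] using hs
  have horb : (MulAction.orbit H (g : G ⧸ H)).ncard ≠ 0 := by
    rw [← MulAction.index_stabilizer, hst]; exact hg
  refine (Set.finite_of_ncard_ne_zero horb).subset ?_
  rintro _ ⟨α, rfl, hα⟩
  obtain ⟨h, hh, k, hk, rfl⟩ := DoubleCoset.mem_doubleCoset.1 hα
  refine ⟨⟨h, hh⟩, ?_⟩
  change ((h * g : G) : G ⧸ H) = _
  rw [QuotientGroup.eq]
  simpa [g, mul_assoc] using hk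

theorem finite_structConst [IsHeckeTriple Δ H H] (a b : HeckeCoset Δ H H) :
    (Function.support fun c : HeckeCoset Δ H H => (structConst a b c : ℤ)).Finite := by
  classical
  have hfin := ((finite_leftCosets a).prod (finite_leftCosets b)).image
    (fun xy : (G ⧸ H) × (G ⧸ H) => if h : xy.1.out * xy.2.out ∈ Δ then
      (HeckeCoset.mk H H ⟨_, h⟩) else a)
  have hsub : ∀ c : HeckeCoset Δ H H, structConst a b c ≠ 0 → ∃ x y : G,
      x ∈ cosetSet a ∧ y ∈ cosetSet b ∧ x * y = rep c := by
    intro c hc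
    by_contra hcon
    apply hc
    unfold structConst
    rw [Nat.card_eq_zero]
    left
    refine ⟨?_⟩
    rintro ⟨x, α, -, h1, h2⟩
    exact hcon ⟨α, _, h1, h2, by group⟩
  refine hfin.subset ?_
  intro c hc
  obtain ⟨x, y, hx, hy, hxy⟩ := hsub c (by simpa using hc)
  obtain ⟨h, hh⟩ := QuotientGroup.mk_out_eq_mul H x
  have hy' : (h : G)⁻¹ * y ∈ cosetSet b := by
    have hyΔ := cosetSet_subset hy
    have : (h : G)⁻¹ * y ∈ Δ := (mul_left_mem_iff (H.inv_mem h.2)).2 hyΔ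
    rw [mem_cosetSet this, mk_mul_left hyΔ (H.inv_mem h.2)]
    exact (mem_cosetSet hyΔ).1 hy
  obtain ⟨k, hk⟩ := QuotientGroup.mk_out_eq_mul H ((h : G)⁻¹ * y)
  refine ⟨((x : G ⧸ H), (((h : G)⁻¹ * y : G) : G ⧸ H)), ⟨⟨x, rfl, hx⟩, ⟨_, rfl, hy'⟩⟩, ?_⟩
  have e : (Quotient.out (x : G ⧸ H)) * (Quotient.out (((h : G)⁻¹ * y : G) : G ⧸ H))
      = rep c * (k : G) := by
    rw [hh, hk, ← hxy]; group
  have hmem : (rep c : G) * (k : G) ∈ Δ := (mul_right_mem_iff k.2).2 (rep c).2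
  dsimp only
  rw [dif_pos (by rw [e]; exact hmem)]
  conv_rhs => rw [← mk_rep c]
  exact Eq.symm <| mk_eq_mk.2 ⟨1, H.one_mem, k, k.2, by simp [e]⟩

/-- The product `(HAH)(HBH) = ∑ m_C (HCH)` of two double cosets. -/
noncomputable def mulBasis [IsHeckeTriple Δ H H] (a b : HeckeCoset Δ H H) :
    HeckeCoset Δ H H →₀ ℤ :=
  Finsupp.ofSupportFinite (fun c => (structConst a b c : ℤ)) (finite_structConst a b)

/-- The multiplication of the Hecke ring: the biadditive extension of `mulBasis`. -/
noncomputable instance [IsHeckeTriple Δ H H] : Mul (HeckeRing Δ H ℤ) where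
  mul f g := HeckeCosetModule.of <| Finsupp.sum (HeckeCosetModule.of.symm f) fun a m =>
    Finsupp.sum (HeckeCosetModule.of.symm g) fun b n => (m * n) • mulBasis a b

noncomputable instance [IsHeckeTriple Δ H H] : One (HeckeRing Δ H ℤ) where
  one := HeckeCosetModule.of (Finsupp.single 1 1)

/-- The element `T(A) = HAH` of the Hecke ring, for a double coset `HAH`. -/
noncomputable def ofCoset (c : HeckeCoset Δ H H) : HeckeRing Δ H ℤ :=
  HeckeCosetModule.of (Finsupp.single c 1)

/-- The element `T(A) = HAH` of the Hecke ring, for `A ∈ Δ`. -/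
noncomputable def T (A : Δ) : HeckeRing Δ H ℤ := ofCoset (HeckeCoset.mk H H A)

/-- The sum of all the double cosets in a finite set of double cosets. -/
noncomputable def sumCosets (S : Set (HeckeCoset Δ H H)) (hS : S.Finite) : HeckeRing Δ H ℤ :=
  ∑ c ∈ hS.toFinset, ofCoset c

open Classical in
/-- The `H`-biinvariant function on `G` attached to an element of the Hecke ring. -/
noncomputable def fn (f : HeckeCoset Δ H H →₀ ℤ) (x : G) : ℤ :=
  if h : x ∈ Δ then f (HeckeCoset.mk H H ⟨x, h⟩) else 0

theorem fn_add (f g : HeckeCoset Δ H H →₀ ℤ) (x : G) : fn (f + g) x = fn f x + fn g x := by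
  unfold fn; split_ifs <;> simp

theorem fn_zero (x : G) : fn (0 : HeckeCoset Δ H H →₀ ℤ) x = 0 := by
  unfold fn; split_ifs <;> simp

theorem fn_smul (m : ℤ) (f : HeckeCoset Δ H H →₀ ℤ) (x : G) : fn (m • f) x = m * fn f x := by
  unfold fn; split_ifs <;> simp

theorem fn_injective {f g : HeckeCoset Δ H H →₀ ℤ} (h : ∀ x, fn f x = fn g x) : f = g := by
  ext c
  have := h (rep c)
  unfold fn at this
  simpa [mk_rep] using this

theorem fn_mul_right [IsHeckeTriple Δ H H] (f : HeckeCoset Δ H H →₀ ℤ) {x h : G} (hh : h ∈ H) :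
    fn f (x * h) = fn f x := by
  unfold fn
  by_cases hx : x ∈ Δ
  · rw [dif_pos hx, dif_pos ((mul_right_mem_iff hh).2 hx), mk_mul_right hx hh]
  · rw [dif_neg hx, dif_neg (by rwa [mul_right_mem_iff hh])]

theorem fn_mul_left [IsHeckeTriple Δ H H] (f : HeckeCoset Δ H H →₀ ℤ) {x h : G} (hh : h ∈ H) :
    fn f (h * x) = fn f x := by
  unfold fn
  by_cases hx : x ∈ Δ
  · rw [dif_pos hx, dif_pos ((mul_left_mem_iff hh).2 hx), mk_mul_left hx hh]
  · rw [dif_neg hx, dif_neg (by rwa [mul_left_mem_iff hh])]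

open Classical in
theorem fn_single [IsHeckeTriple Δ H H] (a : HeckeCoset Δ H H) (m : ℤ) (x : G) :
    fn (Finsupp.single a m) x = if x ∈ cosetSet a then m else 0 := by
  unfold fn
  by_cases hx : x ∈ Δ
  · rw [dif_pos hx, mem_cosetSet hx, Finsupp.single_apply]
    simp only [eq_comm]
  · rw [dif_neg hx, if_neg fun h => hx (cosetSet_subset h)]

theorem fn_finite [IsHeckeTriple Δ H H] (f : HeckeCoset Δ H H →₀ ℤ) :
    (Function.support fun x : G ⧸ H => fn f x.out).Finite := by
  refine (f.support.finite_toSet.biUnion fun a _ => finite_leftCosets a).subset ?_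
  intro x hx
  have hx' : fn f x.out ≠ 0 := hx
  unfold fn at hx'
  split_ifs at hx' with h
  · simp only [Set.mem_iUnion]
    exact ⟨_, by simpa using hx', x.out, by simp, (mem_cosetSet h).2 rfl⟩
  · exact absurd rfl hx'

/-- Convolution of functions on `G`. -/
noncomputable def conv (H : Subgroup G) (φ ψ : G → ℤ) (x : G) : ℤ :=
  ∑ᶠ y : G ⧸ H, φ y.out * ψ (y.out⁻¹ * x)

theorem conv_support [IsHeckeTriple Δ H H] (f : HeckeCoset Δ H H →₀ ℤ) (ψ : G ⧸ H → ℤ) :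
    Function.HasFiniteSupport fun y : G ⧸ H => fn f y.out * ψ y :=
  (fn_finite f).subset fun y hy => by
    simp only [Function.mem_support] at hy ⊢
    exact left_ne_zero_of_mul hy

theorem mulBasis_fn [IsHeckeTriple Δ H H] (a b : HeckeCoset Δ H H) (x : G) :
    fn (mulBasis a b) x = conv H (fn (Finsupp.single a 1)) (fn (Finsupp.single b 1)) x := by
  classical
  have hconv : conv H (fn (Finsupp.single a 1)) (fn (Finsupp.single b 1)) x =
      (Nat.card {y : G ⧸ H // ∃ α : G, (α : G ⧸ H) = y ∧ α ∈ cosetSet a ∧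
        α⁻¹ * x ∈ cosetSet b} : ℤ) := by
    have hfin : {y : G ⧸ H | y.out ∈ cosetSet a ∧ y.out⁻¹ * x ∈ cosetSet b}.Finite :=
      (finite_leftCosets a).subset fun y hy => ⟨y.out, by simp, hy.1⟩
    have hset : {y : G ⧸ H | ∃ α : G, (α : G ⧸ H) = y ∧ α ∈ cosetSet a ∧
        α⁻¹ * x ∈ cosetSet b} = {y : G ⧸ H | y.out ∈ cosetSet a ∧ y.out⁻¹ * x ∈ cosetSet b} := by
      ext y
      constructor
      · rintro ⟨α, rfl, h1, h2⟩
        obtain ⟨h, hh⟩ := QuotientGroup.mk_out_eq_mul H α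
        have e1 := fn_single a 1 (α * h)
        have e2 := fn_single b 1 ((α * h)⁻¹ * x)
        rw [fn_mul_right _ h.2, fn_single, if_pos h1] at e1
        rw [mul_inv_rev, mul_assoc, fn_mul_left _ (H.inv_mem h.2), fn_single, if_pos h2] at e2
        simp only [Set.mem_ofPred_eq, hh]
        constructor
        · by_contra hc; rw [if_neg hc] at e1; exact one_ne_zero e1
        · by_contra hc
          rw [mul_inv_rev, mul_assoc] at hc
          rw [if_neg hc] at e2; exact one_ne_zero e2
      · rintro ⟨h1, h2⟩
        exact ⟨y.out, by simp, h1, h2⟩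
    unfold conv
    rw [finsum_eq_sum_of_support_subset (s := hfin.toFinset)]
    · change _ = ((Nat.card ({y : G ⧸ H | ∃ α : G, (α : G ⧸ H) = y ∧ α ∈ cosetSet a ∧
        α⁻¹ * x ∈ cosetSet b} : Set (G ⧸ H)) : ℕ) : ℤ)
      rw [hset, Nat.card_coe_set_eq, Set.ncard_eq_toFinset_card _ hfin, Finset.card_eq_sum_ones,
        Nat.cast_sum]
      refine Finset.sum_congr rfl fun y hy => ?_
      have hy' := hfin.mem_toFinset.1 hy
      rw [fn_single, fn_single, if_pos hy'.1, if_pos hy'.2]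
      simp
    · intro y hy
      simp only [Function.mem_support, fn_single] at hy
      simp only [Set.Finite.coe_toFinset, Set.mem_ofPred_eq]
      constructor
      · by_contra hc; rw [if_neg hc] at hy; simp at hy
      · by_contra hc; rw [if_neg hc] at hy; simp at hy
  by_cases hx : x ∈ Δ
  · obtain ⟨h, hh, k, hk, e⟩ := mk_eq_mk.1 (mk_rep (HeckeCoset.mk H H ⟨x, hx⟩))
    set r : G := (rep (HeckeCoset.mk H H ⟨x, hx⟩) : G) with hr
    have e' : r = h⁻¹ * x * k⁻¹ := by simp only at e; rw [e]; group
    rw [hconv]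
    unfold fn
    rw [dif_pos hx]
    change (structConst a b _ : ℤ) = _
    unfold structConst
    rw [← hr]
    congr 1
    refine Nat.card_congr
      { toFun := fun y => ⟨h • y.1, ?_⟩
        invFun := fun y => ⟨h⁻¹ • y.1, ?_⟩
        left_inv := fun y => by simp
        right_inv := fun y => by simp }
    · obtain ⟨y, α, rfl, h1, h2⟩ := y
      have hα := cosetSet_subset h1
      have hβ := cosetSet_subset h2
      refine ⟨h * α, rfl, ?_, ?_⟩
      · rw [mem_cosetSet ((mul_left_mem_iff hh).2 hα), mk_mul_left hα hh]
        exact (mem_cosetSet hα).1 h1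
      · have e2 : (h * α)⁻¹ * x = (α⁻¹ * r) * k := by rw [e']; group
        rw [e2, mem_cosetSet ((mul_right_mem_iff hk).2 hβ), mk_mul_right hβ hk]
        exact (mem_cosetSet hβ).1 h2
    · obtain ⟨y, α, rfl, h1, h2⟩ := y
      have hα := cosetSet_subset h1
      have hβ := cosetSet_subset h2
      have hh' := H.inv_mem hh
      have hk' := H.inv_mem hk
      refine ⟨h⁻¹ * α, rfl, ?_, ?_⟩
      · rw [mem_cosetSet ((mul_left_mem_iff hh').2 hα), mk_mul_left hα hh']
        exact (mem_cosetSet hα).1 h1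
      · have e2 : (h⁻¹ * α)⁻¹ * r = (α⁻¹ * x) * k⁻¹ := by rw [e']; group
        rw [e2, mem_cosetSet ((mul_right_mem_iff hk').2 hβ), mk_mul_right hβ hk']
        exact (mem_cosetSet hβ).1 h2
  · rw [hconv]
    have : IsEmpty {y : G ⧸ H // ∃ α : G, (α : G ⧸ H) = y ∧ α ∈ cosetSet a ∧
        α⁻¹ * x ∈ cosetSet b} := by
      refine ⟨?_⟩
      rintro ⟨y, α, -, h1, h2⟩
      exact hx (by simpa using Δ.mul_mem (cosetSet_subset h1) (cosetSet_subset h2))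
    rw [Nat.card_of_isEmpty]
    unfold fn
    rw [dif_neg hx]; rfl

/-- The product on finitely supported functions on double cosets. -/
noncomputable def mulFun [IsHeckeTriple Δ H H] (f g : HeckeCoset Δ H H →₀ ℤ) :
    HeckeCoset Δ H H →₀ ℤ :=
  f.sum fun a m => g.sum fun b n => (m * n) • mulBasis a b

theorem mulFun_add [IsHeckeTriple Δ H H] (f g g' : HeckeCoset Δ H H →₀ ℤ) :
    mulFun f (g + g') = mulFun f g + mulFun f g' := by
  unfold mulFun
  rw [← Finsupp.sum_add]
  refine Finsupp.sum_congr fun a _ => ?_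
  exact Finsupp.sum_add_index' (by simp) (by intros; rw [mul_add, add_smul])

theorem add_mulFun [IsHeckeTriple Δ H H] (f f' g : HeckeCoset Δ H H →₀ ℤ) :
    mulFun (f + f') g = mulFun f g + mulFun f' g := by
  unfold mulFun
  refine Finsupp.sum_add_index' (by simp) ?_
  intro a m m'
  rw [← Finsupp.sum_add]
  exact Finsupp.sum_congr fun b _ => by rw [add_mul, add_smul]

theorem mulFun_zero [IsHeckeTriple Δ H H] (f : HeckeCoset Δ H H →₀ ℤ) : mulFun f 0 = 0 := by
  simp [mulFun]

theorem zero_mulFun [IsHeckeTriple Δ H H] (f : HeckeCoset Δ H H →₀ ℤ) : mulFun 0 f = 0 := by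
  simp [mulFun]

theorem fn_mulFun [IsHeckeTriple Δ H H] (f g : HeckeCoset Δ H H →₀ ℤ) (x : G) :
    fn (mulFun f g) x = conv H (fn f) (fn g) x := by
  induction f using Finsupp.induction_linear with
  | zero => simp [zero_mulFun, conv, fn_zero]
  | add f f' hf hf' =>
    rw [add_mulFun, fn_add, hf, hf']
    unfold conv
    rw [← finsum_add_distrib (conv_support f fun y => fn g (y.out⁻¹ * x))
      (conv_support f' fun y => fn g (y.out⁻¹ * x))]
    simp [fn_add, add_mul]
  | single a m =>
    induction g using Finsupp.induction_linear with
    | zero => simp [mulFun_zero, conv, fn_zero]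
    | add g g' hg hg' =>
      rw [mulFun_add, fn_add, hg, hg']
      unfold conv
      rw [← finsum_add_distrib (conv_support _ fun y => fn g (y.out⁻¹ * x))
        (conv_support _ fun y => fn g' (y.out⁻¹ * x))]
      simp [fn_add, mul_add]
    | single b n =>
      have h1 : mulFun (Finsupp.single a m) (Finsupp.single b n) = (m * n) • mulBasis a b := by
        unfold mulFun
        rw [Finsupp.sum_single_index (by simp), Finsupp.sum_single_index (by simp)]
      have h2 : ∀ (c : HeckeCoset Δ H H) (k : ℤ) (y : G),
          fn (Finsupp.single c k) y = k * fn (Finsupp.single c 1) y := by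
        intro c k y
        rw [← fn_smul, Finsupp.smul_single, smul_eq_mul, mul_one]
      rw [h1, fn_smul, mulBasis_fn]
      unfold conv
      rw [mul_finsum _ _]
      refine finsum_congr fun y => ?_
      rw [h2 a m, h2 b n]; ring

theorem conv_assoc [IsHeckeTriple Δ H H] (f g h : HeckeCoset Δ H H →₀ ℤ) (x : G) :
    conv H (conv H (fn f) (fn g)) (fn h) x = conv H (fn f) (conv H (fn g) (fn h)) x := by
  classical
  set s := (fn_finite f).toFinset with hs
  have hsub : ∀ ψ : G ⧸ H → ℤ,
      (Function.support fun y : G ⧸ H => fn f y.out * ψ y) ⊆ (s : Set (G ⧸ H)) := by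
    intro ψ y hy
    rw [hs, Set.Finite.coe_toFinset]
    exact left_ne_zero_of_mul hy
  have e1 : ∀ z, conv H (fn f) (fn g) z = ∑ y ∈ s, fn f y.out * fn g (y.out⁻¹ * z) := fun z =>
    finsum_eq_sum_of_support_subset _ (hsub fun y => fn g (y.out⁻¹ * z))
  have key : ∀ y : G, ∑ᶠ z : G ⧸ H, fn g (y⁻¹ * z.out) * fn h (z.out⁻¹ * x) =
      conv H (fn g) (fn h) (y⁻¹ * x) ∧
      Function.HasFiniteSupport fun z : G ⧸ H => fn g (y⁻¹ * z.out) * fn h (z.out⁻¹ * x) := by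
    intro y
    have ee : ∀ w : G ⧸ H, fn g (y⁻¹ * (y • w).out) * fn h ((y • w).out⁻¹ * x) =
        fn g w.out * fn h (w.out⁻¹ * (y⁻¹ * x)) := by
      intro w
      have hw : y • w = ((y * w.out : G) : G ⧸ H) := by
        conv_lhs => rw [← QuotientGroup.out_eq' w]
        rfl
      obtain ⟨k, hk⟩ := QuotientGroup.mk_out_eq_mul H (y * w.out)
      rw [hw, hk]
      have a1 : y⁻¹ * (y * w.out * (k : G)) = w.out * k := by group
      have a2 : (y * w.out * (k : G))⁻¹ * x = (k : G)⁻¹ * (w.out⁻¹ * (y⁻¹ * x)) := by group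
      rw [a1, a2, fn_mul_right _ k.2, fn_mul_left _ (H.inv_mem k.2)]
    constructor
    · rw [← finsum_comp_equiv (MulAction.toPerm y)]
      exact finsum_congr ee
    · have hf := conv_support g fun w : G ⧸ H => fn h (w.out⁻¹ * (y⁻¹ * x))
      refine (Set.Finite.image (fun w => y • w) hf).subset ?_
      intro z hz
      refine ⟨y⁻¹ • z, ?_, by simp⟩
      have := ee (y⁻¹ • z)
      rw [smul_inv_smul] at this
      simp only [Function.mem_support] at hz ⊢
      rwa [← this]
  have l1 : conv H (conv H (fn f) (fn g)) (fn h) x =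
      ∑ᶠ z : G ⧸ H, ∑ y ∈ s, fn f y.out * (fn g (y.out⁻¹ * z.out) * fn h (z.out⁻¹ * x)) := by
    refine finsum_congr fun z => ?_
    rw [e1, Finset.sum_mul]
    exact Finset.sum_congr rfl fun y _ => by ring
  rw [l1, finsum_sum_comm]
  · have e2 : conv H (fn f) (conv H (fn g) (fn h)) x =
        ∑ y ∈ s, fn f y.out * conv H (fn g) (fn h) (y.out⁻¹ * x) :=
      finsum_eq_sum_of_support_subset _ (hsub fun y => conv H (fn g) (fn h) (y.out⁻¹ * x))
    rw [e2]
    refine Finset.sum_congr rfl fun y _ => ?_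
    rw [← (key y.out).1, mul_finsum _ _]
  · intro y _
    refine (key y.out).2.subset ?_
    intro z hz
    simp only [Function.mem_support] at hz ⊢
    exact right_ne_zero_of_mul hz

theorem mulFun_assoc [IsHeckeTriple Δ H H] (f g h : HeckeCoset Δ H H →₀ ℤ) :
    mulFun (mulFun f g) h = mulFun f (mulFun g h) := by
  refine fn_injective fun x => ?_
  have e1 : fn (mulFun f g) = conv H (fn f) (fn g) := funext fun y => fn_mulFun f g y
  have e2 : fn (mulFun g h) = conv H (fn g) (fn h) := funext fun y => fn_mulFun g h y
  rw [fn_mulFun, fn_mulFun, e1, e2, conv_assoc]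

theorem mem_cosetSet_one [IsHeckeTriple Δ H H] {x : G} :
    x ∈ cosetSet (1 : HeckeCoset Δ H H) ↔ x ∈ H := by
  constructor
  · intro hx
    have := ((mem_cosetSet (cosetSet_subset hx)).1 hx).symm
    obtain ⟨h, hh, k, hk, e⟩ := mk_eq_mk.1 this
    simp only [mul_one] at e
    rw [e]; exact H.mul_mem hh hk
  · intro hx
    rw [mem_cosetSet (mem_of_mem_H hx), HeckeCoset.one_def, eq_comm, mk_eq_mk]
    exact ⟨x, hx, 1, H.one_mem, by simp⟩

theorem one_mulFun [IsHeckeTriple Δ H H] (f : HeckeCoset Δ H H →₀ ℤ) :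
    mulFun (Finsupp.single 1 1) f = f := by
  classical
  refine fn_injective fun x => ?_
  rw [fn_mulFun]
  unfold conv
  obtain ⟨k, hk⟩ := QuotientGroup.mk_out_eq_mul H (1 : G)
  rw [finsum_eq_single _ ((1 : G) : G ⧸ H)]
  · rw [hk, one_mul, fn_single, if_pos (mem_cosetSet_one.2 k.2), one_mul,
      fn_mul_left _ (H.inv_mem k.2)]
  · intro y hy
    rw [fn_single, if_neg, zero_mul]
    rw [mem_cosetSet_one]
    intro h
    apply hy
    rw [← QuotientGroup.out_eq' y, eq_comm, QuotientGroup.eq]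
    simpa using h

theorem mulFun_one [IsHeckeTriple Δ H H] (f : HeckeCoset Δ H H →₀ ℤ) :
    mulFun f (Finsupp.single 1 1) = f := by
  classical
  refine fn_injective fun x => ?_
  rw [fn_mulFun]
  unfold conv
  obtain ⟨k, hk⟩ := QuotientGroup.mk_out_eq_mul H x
  rw [finsum_eq_single _ (x : G ⧸ H)]
  · rw [hk, fn_mul_right _ k.2, fn_single, if_pos, mul_one]
    rw [mem_cosetSet_one]
    simp
  · intro y hy
    rw [fn_single, if_neg, mul_zero]
    rw [mem_cosetSet_one]
    intro h
    apply hy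
    rw [← QuotientGroup.out_eq' y, QuotientGroup.eq]
    exact h

/-- The Hecke ring is a ring. -/
noncomputable instance [IsHeckeTriple Δ H H] : Ring (HeckeRing Δ H ℤ) :=
  { (inferInstance : AddCommGroup (HeckeRing Δ H ℤ)),
    (inferInstance : Mul (HeckeRing Δ H ℤ)),
    (inferInstance : One (HeckeRing Δ H ℤ)) with
    left_distrib := mulFun_add
    right_distrib := add_mulFun
    zero_mul := zero_mulFun
    mul_zero := mulFun_zero
    mul_assoc := mulFun_assoc
    one_mul := one_mulFun
    mul_one := mulFun_one }

end HeckeRing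

/-! ### Lattices and double finiteness -/

namespace PadicLattice

variable {p : ℕ} [Fact p.Prime]

theorem finite_padicInt_quotient (k : ℕ) :
    Finite (ℤ_[p] ⧸ Ideal.span {((p : ℤ_[p])) ^ k}) := by
  have : NeZero (p ^ k) := ⟨pow_ne_zero _ (Fact.out : p.Prime).ne_zero⟩
  rw [← PadicInt.ker_toZModPow]
  exact Finite.of_injective _ (RingHom.kerLift_injective (PadicInt.toZModPow (p := p) k))

variable {V : Type*} [AddCommGroup V] [Module ℚ_[p] V] [Module ℤ_[p] V]
  [IsScalarTower ℤ_[p] ℚ_[p] V]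

theorem smul_coe (N : ℕ) (v : V) : ((p : ℤ_[p]) ^ N) • v = ((p : ℚ_[p]) ^ N) • v := by
  rw [← one_smul ℚ_[p] v, ← smul_assoc, one_smul, Algebra.smul_def]
  simp

theorem pow_ne_zero' (N : ℕ) : ((p : ℚ_[p]) ^ N) ≠ 0 :=
  pow_ne_zero _ (by exact_mod_cast (Fact.out : p.Prime).ne_zero)

/-- The subgroups of `V` within bounded distance of a lattice are finite in number. -/
theorem finite_near (Λ : Submodule ℤ_[p] V) (hfg : Λ.FG) (N : ℕ) :
    {M : AddSubgroup V | (∀ v ∈ Λ, (p : ℚ_[p]) ^ N • v ∈ M) ∧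
      ∀ v ∈ M, (p : ℚ_[p]) ^ N • v ∈ Λ}.Finite := by
  classical
  let I : Ideal ℤ_[p] := Ideal.span {(p : ℤ_[p]) ^ (N + N)}
  have : Finite (ℤ_[p] ⧸ I) := finite_padicInt_quotient _
  have hfin : Finite (Λ ⧸ (I • (⊤ : Submodule ℤ_[p] Λ))) := by
    have : Module.Finite ℤ_[p] Λ := Module.Finite.iff_fg.2 hfg
    have h2 : Finite (Λ ⧸ (⊤ : Submodule ℤ_[p] Λ)) := inferInstance
    exact Submodule.finite_quotient_smul I Module.Finite.fg_top
  -- a subgroup is determined by the classes of the elements of the lattice that it contains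
  let F : AddSubgroup V → Set (Λ ⧸ (I • (⊤ : Submodule ℤ_[p] Λ))) := fun M =>
    {x | ∃ v : Λ, Submodule.Quotient.mk v = x ∧ ((p : ℚ_[p]) ^ N)⁻¹ • (v : V) ∈ M}
  refine Set.Finite.of_finite_image (f := F) (Set.toFinite _) ?_
  have key : ∀ M M' : AddSubgroup V, (∀ v ∈ Λ, (p : ℚ_[p]) ^ N • v ∈ M') →
      (∀ v ∈ M, (p : ℚ_[p]) ^ N • v ∈ Λ) → F M = F M' → M ≤ M' := by
    intro M M' h1 h2 h v hv
    have hx : (Submodule.Quotient.mk ⟨_, h2 v hv⟩ : Λ ⧸ (I • (⊤ : Submodule ℤ_[p] Λ))) ∈ F M :=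
      ⟨_, rfl, by simpa [smul_smul, inv_mul_cancel₀ (pow_ne_zero' (p := p) N)] using hv⟩
    rw [h] at hx
    obtain ⟨w, hw, hwM⟩ := hx
    have hw' := (Submodule.Quotient.eq _).1 hw
    rw [Submodule.ideal_span_singleton_smul, Submodule.mem_smul_pointwise_iff_exists] at hw'
    obtain ⟨u, -, hu⟩ := hw'
    have hu' : ((p : ℚ_[p]) ^ (N + N)) • (u : V) = (w : V) - (p : ℚ_[p]) ^ N • v := by
      rw [← smul_coe]
      exact congrArg Subtype.val hu
    have e : v = ((p : ℚ_[p]) ^ N)⁻¹ • (w : V) - (p : ℚ_[p]) ^ N • (u : V) := by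
      have h3 : ((p : ℚ_[p]) ^ N)⁻¹ • ((p : ℚ_[p]) ^ (N + N)) • (u : V) =
          (p : ℚ_[p]) ^ N • (u : V) := by
        rw [smul_smul, pow_add, inv_mul_cancel_left₀ (pow_ne_zero' (p := p) N)]
      rw [← h3, hu', smul_sub, smul_smul, inv_mul_cancel₀ (pow_ne_zero' (p := p) N), one_smul]
      abel
    rw [e]
    exact M'.sub_mem hwM (h1 _ u.2)
  intro M hM M' hM' h
  exact le_antisymm (key _ _ hM'.1 hM.2 h) (key _ _ hM.1 hM'.2 h.symm)

theorem exists_pow_smul_mem (Λ : Submodule ℤ_[p] V) (hfg : Λ.FG)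
    (hspan : ∀ v : V, ∃ N : ℕ, (p : ℚ_[p]) ^ N • v ∈ Λ) (e : V →ₗ[ℚ_[p]] V) :
    ∃ N : ℕ, ∀ v ∈ Λ, (p : ℚ_[p]) ^ N • e v ∈ Λ := by
  classical
  obtain ⟨s, rfl⟩ := hfg
  choose N hN using fun v => hspan (e v)
  refine ⟨s.sup N, fun v hv => ?_⟩
  induction hv using Submodule.span_induction with
  | mem x hx =>
    have h1 : N x ≤ s.sup N := Finset.le_sup (f := N) hx
    obtain ⟨d, hd⟩ := Nat.exists_eq_add_of_le h1
    rw [hd, add_comm, pow_add, mul_smul, ← smul_coe]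
    exact Submodule.smul_mem _ _ (hN x)
  | zero => simp
  | add x y _ _ hx hy => rw [map_add, smul_add]; exact Submodule.add_mem _ hx hy
  | smul a x _ hx =>
    have h1 : e (a • x) = a • e x := LinearMap.map_smul_of_tower e a x
    rw [h1, smul_comm]
    exact Submodule.smul_mem _ _ hx

variable {G : Type*} [Group G] (ρ : G →* (V ≃ₗ[ℚ_[p]] V))

/-- The image of the lattice `Λ` under `ρ g`. -/
noncomputable def translate (Λ : Submodule ℤ_[p] V) (g : G) : AddSubgroup V :=
  Λ.toAddSubgroup.comap (ρ g⁻¹ : V ≃ₗ[ℚ_[p]] V).toLinearMap.toAddMonoidHom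

theorem mem_translate {Λ : Submodule ℤ_[p] V} {g : G} {v : V} :
    v ∈ translate ρ Λ g ↔ ρ g⁻¹ v ∈ Λ := Iff.rfl

theorem apply_mul (g h : G) (v : V) : ρ (g * h) v = ρ g (ρ h v) := by rw [map_mul]; rfl

theorem apply_inv_apply (g : G) (v : V) : ρ g (ρ g⁻¹ v) = v := by
  rw [← apply_mul, mul_inv_cancel, map_one]; rfl

theorem inv_apply_apply (g : G) (v : V) : ρ g⁻¹ (ρ g v) = v := by
  rw [← apply_mul, inv_mul_cancel, map_one]; rfl

theorem mem_of_translate_eq {Λ : Submodule ℤ_[p] V} {H : Subgroup G}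
    (hH : ∀ g, g ∈ H ↔ ∀ v ∈ Λ, ρ g v ∈ Λ ∧ ρ g⁻¹ v ∈ Λ) {x y : G}
    (h : translate ρ Λ x = translate ρ Λ y) : x⁻¹ * y ∈ H := by
  rw [hH]
  intro v hv
  constructor
  · have : ρ y v ∈ translate ρ Λ y := by rw [mem_translate, inv_apply_apply]; exact hv
    rw [← h, mem_translate, ← apply_mul] at this
    exact this
  · have : ρ x v ∈ translate ρ Λ x := by rw [mem_translate, inv_apply_apply]; exact hv
    rw [h, mem_translate, ← apply_mul] at this
    rwa [mul_inv_rev, inv_inv]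

theorem relIndex_ne_zero {K H : Subgroup G} {X : Type*} (f : G → X) {S : Set X} (hS : S.Finite)
    (hmap : ∀ h ∈ H, f h ∈ S) (hinj : ∀ h ∈ H, ∀ h' ∈ H, f h = f h' → h⁻¹ * h' ∈ K) :
    K.relIndex H ≠ 0 := by
  have : Finite S := hS
  have : Finite (H ⧸ K.subgroupOf H) := by
    refine Finite.of_injective (β := S) (fun x => ⟨f x.out, hmap _ x.out.2⟩) ?_
    intro x y hxy
    have h := hinj _ x.out.2 _ y.out.2 (congrArg Subtype.val hxy)
    rw [← QuotientGroup.out_eq' x, ← QuotientGroup.out_eq' y, QuotientGroup.eq]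
    exact h
  exact Subgroup.index_ne_zero_of_finite

theorem translate_near {Λ : Submodule ℤ_[p] V} {H : Subgroup G}
    (hH : ∀ g, g ∈ H ↔ ∀ v ∈ Λ, ρ g v ∈ Λ ∧ ρ g⁻¹ v ∈ Λ) {g : G} {N : ℕ}
    (k₁ : ∀ v ∈ Λ, (p : ℚ_[p]) ^ N • ρ g v ∈ Λ) (k₂ : ∀ v ∈ Λ, (p : ℚ_[p]) ^ N • ρ g⁻¹ v ∈ Λ)
    {h : G} (hh : h ∈ H) :
    translate ρ Λ (h * g) ∈ {M : AddSubgroup V | (∀ v ∈ Λ, (p : ℚ_[p]) ^ N • v ∈ M) ∧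
      ∀ v ∈ M, (p : ℚ_[p]) ^ N • v ∈ Λ} := by
  rw [hH] at hh
  constructor
  · intro v hv
    rw [mem_translate, mul_inv_rev, apply_mul, map_smul, map_smul]
    exact k₂ _ (hh v hv).2
  · intro v hv
    rw [mem_translate] at hv
    have := (hh _ (k₁ _ hv)).1
    rwa [map_smul, ← apply_mul, apply_inv_apply] at this

open scoped Pointwise in
/-- The stabilizer of a lattice is commensurable with all of its conjugates. -/
theorem mem_commensurator (Λ : Submodule ℤ_[p] V) (hfg : Λ.FG)
    (hspan : ∀ v : V, ∃ N : ℕ, (p : ℚ_[p]) ^ N • v ∈ Λ) {H : Subgroup G}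
    (hH : ∀ g, g ∈ H ↔ ∀ v ∈ Λ, ρ g v ∈ Λ ∧ ρ g⁻¹ v ∈ Λ) (g : G) :
    g ∈ Subgroup.Commensurable.commensurator H := by
  obtain ⟨N₁, h₁⟩ := exists_pow_smul_mem Λ hfg hspan (ρ g).toLinearMap
  obtain ⟨N₂, h₂⟩ := exists_pow_smul_mem Λ hfg hspan (ρ g⁻¹).toLinearMap
  set N := N₁ + N₂
  have k₁ : ∀ v ∈ Λ, (p : ℚ_[p]) ^ N • ρ g v ∈ Λ := fun v hv => by
    rw [show N = N₂ + N₁ from add_comm _ _, pow_add, mul_smul, ← smul_coe]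
    exact Submodule.smul_mem _ _ (h₁ v hv)
  have k₂ : ∀ v ∈ Λ, (p : ℚ_[p]) ^ N • ρ g⁻¹ v ∈ Λ := fun v hv => by
    rw [show N = N₁ + N₂ from rfl, pow_add, mul_smul, ← smul_coe]
    exact Submodule.smul_mem _ _ (h₂ v hv)
  have hfin := finite_near Λ hfg N
  have hconj : ∀ x, x ∈ ConjAct.toConjAct g • H ↔ g⁻¹ * x * g ∈ H := by
    intro x
    rw [Subgroup.mem_pointwise_smul_iff_inv_smul_mem, ← ConjAct.toConjAct_inv, ConjAct.smul_def]
    simp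
  rw [Subgroup.Commensurable.commensurator_mem_iff]
  constructor
  · refine relIndex_ne_zero (fun h => translate ρ Λ (h * g)) hfin
      (fun h hh => translate_near ρ hH k₁ k₂ hh) ?_
    intro h _ h' _ e
    rw [hconj]
    simpa [mul_assoc] using mem_of_translate_eq ρ hH e
  · refine relIndex_ne_zero (fun x => translate ρ Λ (g⁻¹ * x)) hfin ?_ ?_
    · intro x hx
      rw [hconj] at hx
      have := translate_near ρ hH (g := g⁻¹) k₂ (by rwa [inv_inv]) hx
      rwa [mul_inv_cancel_right] at this
    · intro h _ h' _ e
      simpa [mul_assoc] using mem_of_translate_eq ρ hH e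

/-- Finiteness of sets of double cosets within bounded distance of a lattice. -/
theorem finite_cosets (Λ : Submodule ℤ_[p] V) (hfg : Λ.FG) {H : Subgroup G} {Δ : Submonoid G}
    (hH : ∀ g, g ∈ H ↔ ∀ v ∈ Λ, ρ g v ∈ Λ ∧ ρ g⁻¹ v ∈ Λ) (N : ℕ) (S : Set (HeckeCoset Δ H H))
    (hS : ∀ c ∈ S, ∃ g : Δ, HeckeCoset.mk H H g = c ∧
      ∀ v ∈ Λ, (p : ℚ_[p]) ^ N • ρ g v ∈ Λ ∧ (p : ℚ_[p]) ^ N • ρ (g : G)⁻¹ v ∈ Λ) :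
    S.Finite := by
  classical
  choose! r hr hb using hS
  refine Set.Finite.of_finite_image (f := fun c => translate ρ Λ (r c : G))
    ((finite_near Λ hfg N).subset ?_) ?_
  · rintro _ ⟨c, hc, rfl⟩
    have := translate_near ρ hH (fun v hv => (hb c hc v hv).1) (fun v hv => (hb c hc v hv).2)
      H.one_mem
    rwa [one_mul] at this
  · intro c hc c' hc' e
    rw [← hr c hc, ← hr c' hc']
    exact HeckeRing.mk_eq_mk.2 ⟨1, H.one_mem, _, mem_of_translate_eq ρ hH e, by simp⟩

end PadicLattice

/-! ### The group `GSp_{2n}` and its Hecke ring -/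

theorem norm_sum_le_one {p : ℕ} [Fact p.Prime] {ι : Type*} (s : Finset ι) (f : ι → ℚ_[p])
    (h : ∀ i ∈ s, ‖f i‖ ≤ 1) : ‖∑ i ∈ s, f i‖ ≤ 1 :=
  sum_mem (S := PadicInt.subring p) h

theorem norm_mul_le_one {p : ℕ} [Fact p.Prime] {ι κ μ : Type*} [Fintype κ]
    {A : Matrix ι κ ℚ_[p]} {B : Matrix κ μ ℚ_[p]} (hA : ∀ i j, ‖A i j‖ ≤ 1)
    (hB : ∀ i j, ‖B i j‖ ≤ 1) (i : ι) (j : μ) : ‖(A * B) i j‖ ≤ 1 := by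
  rw [Matrix.mul_apply]
  refine norm_sum_le_one _ _ fun k _ => ?_
  rw [norm_mul]
  exact mul_le_one₀ (hA i k) (norm_nonneg _) (hB k j)

theorem norm_mulVec_le_one {p : ℕ} [Fact p.Prime] {ι κ : Type*} [Fintype κ]
    {A : Matrix ι κ ℚ_[p]} {v : κ → ℚ_[p]} (hA : ∀ i j, ‖A i j‖ ≤ 1)
    (hv : ∀ i, ‖v i‖ ≤ 1) (i : ι) : ‖(A.mulVec v) i‖ ≤ 1 := by
  refine norm_sum_le_one _ _ fun k _ => ?_
  rw [norm_mul]
  exact mul_le_one₀ (hA i k) (norm_nonneg _) (hv k)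

open Matrix in
theorem gsp_mul {n : ℕ} {K : Type*} [Field K] {A B : Matrix (Fin n ⊕ Fin n) (Fin n ⊕ Fin n) K}
    {μ ν : K} (hA : A * J (Fin n) K * Aᵀ = μ • J (Fin n) K)
    (hB : B * J (Fin n) K * Bᵀ = ν • J (Fin n) K) :
    (A * B) * J (Fin n) K * (A * B)ᵀ = (μ * ν) • J (Fin n) K := by
  calc _ = A * (B * J (Fin n) K * Bᵀ) * Aᵀ := by simp [Matrix.mul_assoc]
    _ = _ := by rw [hB, Matrix.mul_smul, Matrix.smul_mul, hA, smul_smul, mul_comm]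

open Matrix in
/-- The general symplectic group `GSp_{2n}(K)`: the invertible matrices `A` of size `2n` with
`A J Aᵀ = μ J` for some `μ ∈ Kˣ`. -/
def GSp (n : ℕ) (K : Type*) [Field K] : Subgroup (GL (Fin n ⊕ Fin n) K) where
  carrier := {A | ∃ μ : Kˣ, (A : Matrix _ _ K) * J (Fin n) K * (A : Matrix _ _ K)ᵀ =
    (μ : K) • J (Fin n) K}
  one_mem' := ⟨1, by simp⟩
  mul_mem' := by
    rintro A B ⟨μ, hA⟩ ⟨ν, hB⟩
    exact ⟨μ * ν, gsp_mul hA hB⟩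
  inv_mem' := by
    rintro A ⟨μ, hA⟩
    refine ⟨μ⁻¹, ?_⟩
    set A' : Matrix (Fin n ⊕ Fin n) (Fin n ⊕ Fin n) K :=
      ((A⁻¹ : GL (Fin n ⊕ Fin n) K) : Matrix (Fin n ⊕ Fin n) (Fin n ⊕ Fin n) K)
    set A₀ : Matrix (Fin n ⊕ Fin n) (Fin n ⊕ Fin n) K := (A : Matrix (Fin n ⊕ Fin n) (Fin n ⊕ Fin n) K)
    have h1 : A' * A₀ = 1 := Units.inv_mul A
    have h2 : A₀ᵀ * A'ᵀ = 1 := by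
      rw [← Matrix.transpose_mul, h1, Matrix.transpose_one]
    have h3 : J (Fin n) K = (μ⁻¹ : K) • (A₀ * J (Fin n) K * A₀ᵀ) := by
      rw [hA, smul_smul, inv_mul_cancel₀ μ.ne_zero, one_smul]
    have h4 : A' * (A₀ * J (Fin n) K * A₀ᵀ) * A'ᵀ = J (Fin n) K := by
      calc _ = (A' * A₀) * J (Fin n) K * (A₀ᵀ * A'ᵀ) := by simp only [Matrix.mul_assoc]
        _ = _ := by rw [h1, h2, Matrix.one_mul, Matrix.mul_one]
    calc _ = A' * ((μ⁻¹ : K) • (A₀ * J (Fin n) K * A₀ᵀ)) * A'ᵀ := by rw [← h3]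
      _ = _ := by rw [Matrix.mul_smul, Matrix.smul_mul, h4, Units.val_inv_eq_inv_val]

namespace GSp

open Matrix

section Field

variable {n : ℕ} [NeZero n] {K : Type*} [Field K]

theorem exists_multiplier (A : GSp n K) : ∃ μ : Kˣ, (A.1 : Matrix _ _ K) * J (Fin n) K *
    (A.1 : Matrix _ _ K)ᵀ = (μ : K) • J (Fin n) K := A.2

theorem multiplier_unique {M : Matrix (Fin n ⊕ Fin n) (Fin n ⊕ Fin n) K} {μ ν : Kˣ}
    (h : M = (μ : K) • J (Fin n) K) (h' : M = (ν : K) • J (Fin n) K) : μ = ν := by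
  have e := congrFun (congrFun (h.symm.trans h') (Sum.inr 0)) (Sum.inl 0)
  simpa [J, Units.ext_iff] using e

/-- The multiplier `μ(A)` of `A ∈ GSp_{2n}(K)`, the unique `μ` with `A J Aᵀ = μ J`. -/
noncomputable def multiplier : GSp n K →* Kˣ where
  toFun A := (exists_multiplier A).choose
  map_one' := multiplier_unique (exists_multiplier (1 : GSp n K)).choose_spec (by simp)
  map_mul' A B := multiplier_unique (exists_multiplier (A * B)).choose_spec
    (gsp_mul (exists_multiplier A).choose_spec (exists_multiplier B).choose_spec)

theorem multiplier_spec (A : GSp n K) : (A.1 : Matrix _ _ K) * J (Fin n) K *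
    (A.1 : Matrix _ _ K)ᵀ = (multiplier A : K) • J (Fin n) K :=
  (exists_multiplier A).choose_spec

/-- The scalar matrix `c E`. -/
def scalar (c : Kˣ) : GSp n K :=
  ⟨GeneralLinearGroup.scalar _ c, c * c, by
    ext i j
    simp [GeneralLinearGroup.scalar, Matrix.scalar_apply, Matrix.mul_apply, Matrix.diagonal_apply]
    ring⟩

end Field

variable (n : ℕ) (p : ℕ) [Fact p.Prime]

/-- `GSp_{2n}(ℚ_p) ∩ M_{2n}(ℤ_p)`. -/
def Delta : Submonoid (GSp n ℚ_[p]) where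
  carrier := {A | ∀ i j, ‖A.1 i j‖ ≤ 1}
  one_mem' := by
    intro i j
    by_cases h : i = j <;> simp [h]
  mul_mem' := by
    intro A B hA hB i j
    exact norm_mul_le_one hA hB i j

/-- `GSp_{2n}(ℤ_p)`: the elements `A` of `GSp_{2n}(ℚ_p)` such that `A` and `A⁻¹` have entries
in `ℤ_p`. -/
def Gamma : Subgroup (GSp n ℚ_[p]) where
  carrier := {A | A ∈ Delta n p ∧ A⁻¹ ∈ Delta n p}
  one_mem' := ⟨(Delta n p).one_mem, by simp [(Delta n p).one_mem]⟩
  mul_mem' hA hB := ⟨(Delta n p).mul_mem hA.1 hB.1, by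
    rw [_root_.mul_inv_rev]; exact (Delta n p).mul_mem hB.2 hA.2⟩
  inv_mem' hA := ⟨hA.2, by simpa using hA.1⟩

end GSp

namespace PadicLattice

variable {p : ℕ} [Fact p.Prime] (ι : Type*) [Fintype ι]

variable (p) in
/-- The lattice `ℤ_p^ι` in `ℚ_p^ι`. -/
def std : Submodule ℤ_[p] (ι → ℚ_[p]) where
  carrier := {v | ∀ i, ‖v i‖ ≤ 1}
  zero_mem' := by simp
  add_mem' := by
    intro v w hv hw i
    exact (PadicInt.subring p).add_mem (hv i) (hw i)
  smul_mem' := by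
    intro a v hv i
    have : (a • v) i = (a : ℚ_[p]) * v i := by
      rw [Pi.smul_apply, Algebra.smul_def]; rfl
    rw [this, norm_mul]
    exact mul_le_one₀ a.2 (norm_nonneg _) (hv i)

theorem std_fg : (std p ι).FG := by
  have h : std p ι = LinearMap.range ((Algebra.linearMap ℤ_[p] ℚ_[p]).compLeft ι) := by
    ext v
    constructor
    · intro hv
      exact ⟨fun i => ⟨v i, hv i⟩, rfl⟩
    · rintro ⟨w, rfl⟩ i
      exact (w i).2
  rw [h, LinearMap.range_eq_map]
  exact Submodule.FG.map _ Module.Finite.fg_top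

theorem std_spans (v : ι → ℚ_[p]) : ∃ N : ℕ, (p : ℚ_[p]) ^ N • v ∈ std p ι := by
  have hp : (1 : ℝ) < p := by exact_mod_cast (Fact.out : p.Prime).one_lt
  obtain ⟨N, hN⟩ := pow_unbounded_of_one_lt ‖v‖ hp
  refine ⟨N, fun i => ?_⟩
  have h1 : ‖v i‖ ≤ (p : ℝ) ^ N := (norm_le_pi_norm v i).trans hN.le
  rw [Pi.smul_apply, smul_eq_mul, norm_mul, norm_pow, Padic.norm_p, inv_pow]
  rw [inv_mul_le_iff₀ (by positivity), mul_one]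
  exact h1

variable {ι}
variable [DecidableEq ι]

theorem mulVec_std (M : Matrix ι ι ℚ_[p]) :
    (∀ v ∈ std p ι, M.mulVec v ∈ std p ι) ↔ ∀ i j, ‖M i j‖ ≤ 1 := by
  constructor
  · intro h i j
    have := h (Pi.single j 1) (fun k => by by_cases hk : k = j <;> simp [hk]) i
    simpa using this
  · intro h v hv i
    exact norm_mulVec_le_one h hv i

/-- The natural representation of `GL(ι, ℚ_p)` on `ℚ_p^ι`. -/
noncomputable def glRep : GL ι ℚ_[p] →* ((ι → ℚ_[p]) ≃ₗ[ℚ_[p]] (ι → ℚ_[p])) :=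
  (LinearMap.GeneralLinearGroup.generalLinearEquiv _ _).toMonoidHom.comp
    Matrix.GeneralLinearGroup.toLin.toMonoidHom

theorem glRep_apply (g : GL ι ℚ_[p]) (v : ι → ℚ_[p]) :
    glRep g v = (g : Matrix ι ι ℚ_[p]).mulVec v := rfl

theorem stab_iff {G : Type*} [Group G] (f : G →* GL ι ℚ_[p]) (g : G) :
    (∀ v ∈ std p ι, (glRep.comp f) g v ∈ std p ι ∧ (glRep.comp f) g⁻¹ v ∈ std p ι) ↔
    (∀ i j, ‖f g i j‖ ≤ 1) ∧ ∀ i j, ‖f g⁻¹ i j‖ ≤ 1 := by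
  rw [← mulVec_std, ← mulVec_std]
  exact ⟨fun h => ⟨fun v hv => (h v hv).1, fun v hv => (h v hv).2⟩,
    fun h v hv => ⟨h.1 v hv, h.2 v hv⟩⟩

theorem smul_glRep_mem {f : GL ι ℚ_[p]} {c : ℚ_[p]} (h : ∀ i j, ‖c * f i j‖ ≤ 1)
    {v : ι → ℚ_[p]} (hv : v ∈ std p ι) : c • glRep f v ∈ std p ι := by
  rw [glRep_apply, ← Matrix.smul_mulVec]
  exact (mulVec_std (c • (f : Matrix ι ι ℚ_[p]))).2 (fun i j => h i j) v hv

end PadicLattice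

namespace GSp

open Matrix

variable (n : ℕ) (p : ℕ) [Fact p.Prime]

theorem mem_Gamma_iff (A : GSp n ℚ_[p]) : A ∈ Gamma n p ↔
    ∀ v ∈ PadicLattice.std p (Fin n ⊕ Fin n),
      (PadicLattice.glRep.comp (GSp n ℚ_[p]).subtype) A v ∈ PadicLattice.std p _ ∧
      (PadicLattice.glRep.comp (GSp n ℚ_[p]).subtype) A⁻¹ v ∈ PadicLattice.std p _ := by
  rw [PadicLattice.stab_iff]; rfl

/-- The pair `(GSp_{2n}(ℤ_p), GSp_{2n}(ℚ_p) ∩ M_{2n}(ℤ_p))` is double finite. -/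
instance : IsHeckeTriple (Delta n p) (Gamma n p) (Gamma n p) :=
  IsHeckeTriple.of_diagonal (fun _ hA => hA.1) fun A _ =>
    PadicLattice.mem_commensurator _ _ (PadicLattice.std_fg _) (PadicLattice.std_spans _)
      (mem_Gamma_iff n p) A

/-- The Hecke ring `R_n` of `GSp_{2n}` at `p`. -/
abbrev R : Type := HeckeRing (Delta n p) (Gamma n p) ℤ

variable {n p} [NeZero n]

variable (n p) in
/-- The scalar matrix `pE`, an element of `Δ`. -/
noncomputable def scalarP : Delta n p :=
  ⟨scalar (Units.mk0 (p : ℚ_[p]) (by exact_mod_cast (Fact.out : p.Prime).ne_zero)), by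
    intro i j
    have hp : ‖(p : ℚ_[p])‖ ≤ 1 := Padic.norm_p_lt_one.le
    change ‖Matrix.scalar (Fin n ⊕ Fin n) (p : ℚ_[p]) i j‖ ≤ 1
    rw [Matrix.scalar_apply, Matrix.diagonal_apply]
    split_ifs
    · exact hp
    · simp⟩

theorem norm_multiplier_le {A : GSp n ℚ_[p]} (hA : A ∈ Delta n p) :
    ‖(multiplier A : ℚ_[p])‖ ≤ 1 := by
  have h := congrFun (congrFun (multiplier_spec A) (Sum.inr 0)) (Sum.inl 0)
  have h2 : (((multiplier A : ℚ_[p]) • J (Fin n) ℚ_[p]) (Sum.inr 0) (Sum.inl 0)) =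
      (multiplier A : ℚ_[p]) := by simp [J]
  rw [← h2, ← h]
  refine norm_mul_le_one (norm_mul_le_one hA ?_) (fun i j => hA j i) _ _
  rintro (i | i) (j | j) <;> by_cases hij : i = j <;> simp [J, hij]

theorem inv_eq (A : GSp n ℚ_[p]) : ((A⁻¹ : GSp n ℚ_[p]).1 : Matrix _ _ ℚ_[p]) =
    (multiplier A : ℚ_[p])⁻¹ • -(J (Fin n) ℚ_[p] * (A.1 : Matrix _ _ ℚ_[p])ᵀ *
      J (Fin n) ℚ_[p]) := by
  have h := multiplier_spec A
  have h1 : (A.1 : Matrix (Fin n ⊕ Fin n) (Fin n ⊕ Fin n) ℚ_[p]) *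
      ((multiplier A : ℚ_[p])⁻¹ • -(J (Fin n) ℚ_[p] * (A.1 : Matrix _ _ ℚ_[p])ᵀ *
      J (Fin n) ℚ_[p])) = 1 := by
    rw [Matrix.mul_smul, Matrix.mul_neg, ← Matrix.mul_assoc, ← Matrix.mul_assoc, h,
      Matrix.smul_mul, Matrix.J_squared, smul_neg, smul_neg, smul_neg, neg_neg, smul_smul,
      inv_mul_cancel₀ (multiplier A).ne_zero, one_smul]
  have h2 : ((A⁻¹ : GSp n ℚ_[p]).1 : Matrix (Fin n ⊕ Fin n) (Fin n ⊕ Fin n) ℚ_[p]) *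
    (A.1 : Matrix (Fin n ⊕ Fin n) (Fin n ⊕ Fin n) ℚ_[p]) = 1 := Units.inv_mul A.1
  exact left_inv_eq_right_inv h2 h1

theorem norm_pow_mul_inv {k : ℕ} {A : GSp n ℚ_[p]} (hk : (multiplier A : ℚ_[p]).valuation = k) :
    ‖(p : ℚ_[p]) ^ k * (multiplier A : ℚ_[p])⁻¹‖ = 1 := by
  have hp : (p : ℝ) ≠ 0 := by exact_mod_cast (Fact.out : p.Prime).ne_zero
  rw [norm_mul, norm_inv, Padic.norm_eq_zpow_neg_valuation (multiplier A).ne_zero, hk, norm_pow,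
    Padic.norm_p, _root_.inv_pow, _root_.zpow_neg, inv_inv, zpow_natCast]
  exact inv_mul_cancel₀ (pow_ne_zero _ hp)

theorem norm_pow_mul_inv_apply {k : ℕ} {A : GSp n ℚ_[p]} (hA : A ∈ Delta n p)
    (hk : (multiplier A : ℚ_[p]).valuation = k) (i j : Fin n ⊕ Fin n) :
    ‖(p : ℚ_[p]) ^ k * (A⁻¹ : GSp n ℚ_[p]).1 i j‖ ≤ 1 := by
  have hJ : ∀ i j, ‖J (Fin n) ℚ_[p] i j‖ ≤ 1 := by
    rintro (i | i) (j | j) <;> by_cases hij : i = j <;> simp [J, hij]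
  rw [inv_eq, Matrix.smul_apply, smul_eq_mul, ← mul_assoc, norm_mul, norm_pow_mul_inv hk, one_mul,
    Matrix.neg_apply, norm_neg]
  exact norm_mul_le_one (norm_mul_le_one hJ fun i j => hA j i) hJ i j

theorem norm_pow_mul_apply (k : ℕ) {x : ℚ_[p]} (hx : ‖x‖ ≤ 1) : ‖(p : ℚ_[p]) ^ k * x‖ ≤ 1 := by
  rw [norm_mul, norm_pow, Padic.norm_p]
  refine mul_le_one₀ (pow_le_one₀ (by positivity) ?_) (norm_nonneg _) hx
  exact inv_le_one_of_one_le₀ (by exact_mod_cast (Fact.out : p.Prime).one_lt.le)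

variable (n p) in
/-- The double cosets `Γ A Γ` in `Γ \ Δ / Γ` with `v_p(μ(A)) = k`. -/
def cosetsOfVal (k : ℕ) : Set (HeckeCoset (Delta n p) (Gamma n p) (Gamma n p)) :=
  {c | ∃ A : Delta n p, c = HeckeCoset.mk _ _ A ∧
    (multiplier (A : GSp n ℚ_[p]) : ℚ_[p]).valuation = k}

theorem cosetsOfVal_finite (k : ℕ) : (cosetsOfVal n p k).Finite := by
  refine PadicLattice.finite_cosets _ _ (PadicLattice.std_fg _) (mem_Gamma_iff n p) k _ ?_
  rintro c ⟨A, rfl, hk⟩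
  refine ⟨A, rfl, fun v hv => ⟨?_, ?_⟩⟩
  · exact PadicLattice.smul_glRep_mem (fun i j => norm_pow_mul_apply k (A.2 i j)) hv
  · exact PadicLattice.smul_glRep_mem (fun i j => norm_pow_mul_inv_apply A.2 hk i j) hv

variable (n p) in
/-- The Hecke operator `T(p^k)`, the sum of all `Γ A Γ` with `v_p(μ(A)) = k`. -/
noncomputable def Tpow (k : ℕ) : R n p :=
  HeckeRing.sumCosets (cosetsOfVal n p k) (cosetsOfVal_finite k)

variable (n p) in
/-- The Hecke series `P_n(X) = ∑ T(p^k) X^k` of `GSp_{2n}`. -/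
noncomputable def heckeSeries : PowerSeries (R n p) := PowerSeries.mk (Tpow n p)

end GSp

/-! ### The Hecke ring of the extension of `GSp_{2n}` by `ℚ_p^{2n}` -/

/-- The group of pairs `(A, a)` with `A ∈ GSp_{2n}(ℚ_p)`, `a ∈ ℚ_p^{2n}` a column vector, and
`(A, a) (B, b) = (A B, A b + a B)`, where `B` acts on column vectors on the right by
`a B = μ(B) a`. -/
@[ext]
structure GSpExt (n : ℕ) (p : ℕ) [Fact p.Prime] where
  /-- The first component. -/
  fst : GSp n ℚ_[p]
  /-- The second component. -/
  snd : Fin n ⊕ Fin n → ℚ_[p]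

namespace GSpExt

open Matrix GSp

variable {n : ℕ} [NeZero n] {p : ℕ} [Fact p.Prime]

noncomputable instance : Mul (GSpExt n p) where
  mul x y := ⟨x.fst * y.fst, (x.fst.1 : Matrix _ _ ℚ_[p]) *ᵥ y.snd +
    (multiplier y.fst : ℚ_[p]) • x.snd⟩

noncomputable instance : One (GSpExt n p) where
  one := ⟨1, 0⟩

/-- `(A, a)⁻¹ = (A⁻¹, -A⁻¹ a A⁻¹)`. -/
noncomputable instance : Inv (GSpExt n p) where
  inv x := ⟨x.fst⁻¹, -((multiplier x.fst⁻¹ : ℚ_[p]) •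
    (((x.fst⁻¹ : GSp n ℚ_[p]).1 : Matrix _ _ ℚ_[p]) *ᵥ x.snd))⟩

theorem mul_fst (x y : GSpExt n p) : (x * y).fst = x.fst * y.fst := rfl
theorem mul_snd (x y : GSpExt n p) : (x * y).snd = (x.fst.1 : Matrix _ _ ℚ_[p]) *ᵥ y.snd +
    (multiplier y.fst : ℚ_[p]) • x.snd := rfl
theorem one_fst : (1 : GSpExt n p).fst = 1 := rfl
theorem one_snd : (1 : GSpExt n p).snd = 0 := rfl
theorem inv_fst (x : GSpExt n p) : x⁻¹.fst = x.fst⁻¹ := rfl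
theorem inv_snd (x : GSpExt n p) : x⁻¹.snd = -((multiplier x.fst⁻¹ : ℚ_[p]) •
    (((x.fst⁻¹ : GSp n ℚ_[p]).1 : Matrix _ _ ℚ_[p]) *ᵥ x.snd)) := rfl

noncomputable instance : Group (GSpExt n p) where
  mul_assoc x y z := by
    refine GSpExt.ext (mul_assoc _ _ _) ?_
    simp only [mul_snd, mul_fst, Matrix.mulVec_add, Matrix.mulVec_smul, Matrix.mulVec_mulVec,
      smul_add, smul_smul, map_mul, Units.val_mul, Subgroup.coe_mul, add_assoc]
    rw [mul_comm (multiplier z.fst : ℚ_[p])]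
  one_mul x := by
    refine GSpExt.ext (one_mul _) ?_
    simp [mul_snd, one_fst, one_snd]
  mul_one x := by
    refine GSpExt.ext (mul_one _) ?_
    simp [mul_snd, one_fst, one_snd]
  inv_mul_cancel x := by
    refine GSpExt.ext (inv_mul_cancel _) ?_
    rw [mul_snd, inv_snd, inv_fst, one_snd, map_inv, smul_neg, smul_smul, Units.mul_inv, one_smul,
      add_neg_cancel]

/-- The matrix `(A a; 0 μ(A))` of size `2n + 1` attached to `(A, a)`. -/
noncomputable def toMatrix (x : GSpExt n p) :
    Matrix ((Fin n ⊕ Fin n) ⊕ Unit) ((Fin n ⊕ Fin n) ⊕ Unit) ℚ_[p] :=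
  fromBlocks (x.fst.1 : Matrix _ _ ℚ_[p]) (replicateCol Unit x.snd) 0
    (Matrix.of fun _ _ => (multiplier x.fst : ℚ_[p]))

theorem toMatrix_mul (x y : GSpExt n p) : toMatrix (x * y) = toMatrix x * toMatrix y := by
  unfold toMatrix
  rw [fromBlocks_multiply]
  congr 1
  · simp [mul_fst]
  · ext i j
    simp [mul_snd, Matrix.mul_apply, mulVec, dotProduct, mul_comm]
  · simp
  · ext i j
    simp [mul_fst, Matrix.mul_apply]

theorem toMatrix_one : toMatrix (1 : GSpExt n p) = 1 := by
  ext (i | i) (j | j) <;> simp [toMatrix, one_fst, one_snd, Matrix.one_apply]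

/-- The embedding of the group of pairs into `GL_{2n+1}(ℚ_p)`. -/
noncomputable def toGL : GSpExt n p →* GL ((Fin n ⊕ Fin n) ⊕ Unit) ℚ_[p] :=
  MonoidHom.toHomUnits
    { toFun := toMatrix
      map_one' := toMatrix_one
      map_mul' := toMatrix_mul }

theorem toGL_apply (x : GSpExt n p) : (toGL x : Matrix _ _ ℚ_[p]) = toMatrix x := rfl

variable (n p)

/-- The monoid `Δ̃`: the pairs `(A, a)` with `A ∈ GSp_{2n}(ℚ_p) ∩ M_{2n}(ℤ_p)` and
`a ∈ ℤ_p^{2n}`. -/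
def Delta : Submonoid (GSpExt n p) where
  carrier := {x | x.fst ∈ GSp.Delta n p ∧ ∀ i, ‖x.snd i‖ ≤ 1}
  one_mem' := ⟨(GSp.Delta n p).one_mem, by simp [one_snd]⟩
  mul_mem' := by
    intro x y hx hy
    refine ⟨(GSp.Delta n p).mul_mem hx.1 hy.1, fun i => ?_⟩
    refine (PadicInt.subring p).add_mem (norm_mulVec_le_one hx.1 hy.2 i) ?_
    exact (PadicInt.subring p).mul_mem (norm_multiplier_le hy.1) (hx.2 i)

/-- The group `Γ̃`: the pairs `(X, x)` with `X ∈ GSp_{2n}(ℤ_p)` and `x ∈ ℤ_p^{2n}`. -/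
def Gamma : Subgroup (GSpExt n p) where
  carrier := {x | x.fst ∈ GSp.Gamma n p ∧ ∀ i, ‖x.snd i‖ ≤ 1}
  one_mem' := ⟨(GSp.Gamma n p).one_mem, by simp [one_snd]⟩
  mul_mem' hx hy := ⟨(GSp.Gamma n p).mul_mem hx.1 hy.1,
    ((Delta n p).mul_mem ⟨hx.1.1, hx.2⟩ ⟨hy.1.1, hy.2⟩).2⟩
  inv_mem' := by
    intro x hx
    refine ⟨(GSp.Gamma n p).inv_mem hx.1, fun i => ?_⟩
    rw [inv_snd, Pi.neg_apply, norm_neg]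
    exact (PadicInt.subring p).mul_mem (norm_multiplier_le hx.1.2)
      (norm_mulVec_le_one hx.1.2 hx.2 i)

theorem mem_Delta_iff (x : GSpExt n p) : x ∈ Delta n p ↔ ∀ i j, ‖toMatrix x i j‖ ≤ 1 := by
  constructor
  · rintro h (i | i) (j | j)
    · exact h.1 i j
    · exact h.2 i
    · change ‖(0 : ℚ_[p])‖ ≤ 1
      simp
    · exact norm_multiplier_le h.1
  · intro h
    exact ⟨fun i j => h (Sum.inl i) (Sum.inl j), fun i => h (Sum.inl i) (Sum.inr ())⟩

theorem mem_Gamma_iff (x : GSpExt n p) : x ∈ Gamma n p ↔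
    ∀ v ∈ PadicLattice.std p ((Fin n ⊕ Fin n) ⊕ Unit),
      (PadicLattice.glRep.comp toGL) x v ∈ PadicLattice.std p _ ∧
      (PadicLattice.glRep.comp toGL) x⁻¹ v ∈ PadicLattice.std p _ := by
  rw [PadicLattice.stab_iff]
  have e : ∀ y : GSpExt n p, (∀ i j, ‖toGL y i j‖ ≤ 1) ↔ y ∈ Delta n p := fun y =>
    (mem_Delta_iff n p y).symm
  rw [e, e]
  constructor
  · intro h
    exact ⟨⟨h.1.1, h.2⟩, ⟨((Gamma n p).inv_mem h).1.1, ((Gamma n p).inv_mem h).2⟩⟩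
  · intro h
    exact ⟨⟨h.1.1, h.2.1⟩, h.1.2⟩

/-- The pair `(Γ̃, Δ̃)` is double finite. -/
instance : IsHeckeTriple (Delta n p) (Gamma n p) (Gamma n p) :=
  IsHeckeTriple.of_diagonal (fun _ hx => ⟨hx.1.1, hx.2⟩) fun x _ =>
    PadicLattice.mem_commensurator _ _ (PadicLattice.std_fg _) (PadicLattice.std_spans _)
      (mem_Gamma_iff n p) x

/-- The Hecke ring `R̃` of the pair `(Γ̃, Δ̃)`. -/
abbrev R : Type := HeckeRing (Delta n p) (Gamma n p) ℤ

/-- The double cosets `Γ̃ (A, a) Γ̃` in `Γ̃ \ Δ̃ / Γ̃` with `v_p(μ(A)) = k`. -/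
def cosetsOfVal (k : ℕ) : Set (HeckeCoset (Delta n p) (Gamma n p) (Gamma n p)) :=
  {c | ∃ x : Delta n p, c = HeckeCoset.mk _ _ x ∧
    (multiplier (x : GSpExt n p).fst : ℚ_[p]).valuation = k}

variable {n p}

theorem cosetsOfVal_finite (k : ℕ) : (cosetsOfVal n p k).Finite := by
  refine PadicLattice.finite_cosets _ _ (PadicLattice.std_fg _) (mem_Gamma_iff n p) (k + k) _ ?_
  rintro c ⟨x, rfl, hk⟩
  refine ⟨x, rfl, fun v hv => ⟨?_, ?_⟩⟩
  · exact PadicLattice.smul_glRep_mem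
      (fun i j => norm_pow_mul_apply _ ((mem_Delta_iff n p x).1 x.2 i j)) hv
  · have hinv := fun i j => norm_pow_mul_inv_apply x.2.1 hk i j
    have hμ := (norm_pow_mul_inv hk).le
    refine PadicLattice.smul_glRep_mem ?_ hv
    rintro (i | i) (j | j)
    · rw [pow_add, mul_assoc]
      exact norm_pow_mul_apply k (hinv i j)
    · change ‖(p : ℚ_[p]) ^ (k + k) * ((x : GSpExt n p)⁻¹.snd i)‖ ≤ 1
      rw [inv_snd, map_inv, Pi.neg_apply, mul_neg, norm_neg, Pi.smul_apply, smul_eq_mul,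
        Units.val_inv_eq_inv_val]
      have e : ∀ m w : ℚ_[p], (p : ℚ_[p]) ^ (k + k) * (m * w) =
        ((p : ℚ_[p]) ^ k * m) * ((p : ℚ_[p]) ^ k * w) := fun m w => by rw [pow_add]; ring
      rw [e]
      refine (PadicInt.subring p).mul_mem hμ ?_
      rw [← smul_eq_mul, ← Pi.smul_apply, ← Matrix.smul_mulVec]
      exact norm_mulVec_le_one (fun i j => hinv i j) x.2.2 i
    · change ‖(p : ℚ_[p]) ^ (k + k) * 0‖ ≤ 1
      simp
    · change ‖(p : ℚ_[p]) ^ (k + k) * ((multiplier ((x : GSpExt n p).fst)⁻¹ : ℚ_[p]ˣ) : ℚ_[p])‖ ≤ 1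
      rw [map_inv, Units.val_inv_eq_inv_val, pow_add, mul_assoc]
      exact norm_pow_mul_apply k hμ

variable (n p) in
/-- `T̃(p^k)`, the sum of all `Γ̃ (A, a) Γ̃` with `v_p(μ(A)) = k`. -/
noncomputable def Tpow (k : ℕ) : R n p :=
  HeckeRing.sumCosets (cosetsOfVal n p k) (cosetsOfVal_finite k)

variable (n p) in
/-- The formal power series `P̃_n(X) = ∑ T̃(p^k) X^k`. -/
noncomputable def heckeSeries : PowerSeries (R n p) := PowerSeries.mk (Tpow n p)

/-- The element `(A, 0)` of `Δ̃`, for `A ∈ Δ`. -/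
noncomputable def ofDelta (A : GSp.Delta n p) : Delta n p := ⟨⟨A, 0⟩, A.2, by simp⟩

variable (n p) in
/-- The element `(pE, 0)` of `Δ̃`. -/
noncomputable def C₀ : Delta n p := ofDelta (GSp.scalarP n p)

/-- The double cosets `Γ̃ (A, a) Γ̃` with `a ∈ ℤ_p^{2n}`, for a given `A ∈ Δ`. -/
def cosetsOver (A : GSp.Delta n p) : Set (HeckeCoset (Delta n p) (Gamma n p) (Gamma n p)) :=
  {c | ∃ x : Delta n p, (x : GSpExt n p).fst = A ∧ c = HeckeCoset.mk _ _ x}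

theorem valuation_nonneg (A : GSp.Delta n p) :
    0 ≤ (multiplier (A : GSp n ℚ_[p]) : ℚ_[p]).valuation :=
  (Padic.norm_le_one_iff_val_nonneg _).1 (norm_multiplier_le A.2)

theorem cosetsOver_finite (A : GSp.Delta n p) : (cosetsOver A).Finite := by
  obtain ⟨k, hk⟩ := Int.eq_ofNat_of_zero_le (valuation_nonneg A)
  refine (cosetsOfVal_finite (n := n) (p := p) k).subset ?_
  rintro c ⟨x, hx, rfl⟩
  exact ⟨x, rfl, by rw [hx]; exact hk⟩

/-- `T̃(A)`, the sum of all the double cosets `Γ̃ (A, a) Γ̃` with `a ∈ ℤ_p^{2n}`. -/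
noncomputable def TFiber (A : GSp.Delta n p) : R n p :=
  HeckeRing.sumCosets (cosetsOver A) (cosetsOver_finite A)

end GSpExt

/-! ### The local Hecke ring and the local Hecke series of a Lie algebra over `ℤ` -/

namespace LocalHecke

open scoped TensorProduct

variable (p : ℕ) [Fact p.Prime] (L : Type*) [LieRing L]

/-- The lattice `L ⊗ ℤ_p` in `L ⊗ ℚ_p`. -/
noncomputable def lattice : Submodule ℤ_[p] (ℚ_[p] ⊗[ℤ] L) :=
  Submodule.span ℤ_[p] (Set.range fun l : L => (1 : ℚ_[p]) ⊗ₜ[ℤ] l)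

/-- The group of automorphisms of the Lie algebra `L ⊗ ℚ_p` over `ℚ_p`. -/
def lieAut : Subgroup ((ℚ_[p] ⊗[ℤ] L) ≃ₗ[ℚ_[p]] (ℚ_[p] ⊗[ℤ] L)) where
  carrier := {α | ∀ x y, α ⁅x, y⁆ = ⁅α x, α y⁆}
  one_mem' := fun _ _ => rfl
  mul_mem' := by
    intro α β hα hβ x y
    change α (β ⁅x, y⁆) = ⁅α (β x), α (β y)⁆
    rw [hβ, hα]
  inv_mem' := by
    intro α hα x y
    apply α.injective
    change α (α.symm ⁅x, y⁆) = α ⁅α.symm x, α.symm y⁆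
    rw [hα]
    simp

/-- The group `G_{L_p}` of automorphisms of `L ⊗ ℚ_p`. Automorphisms act on the right, so that the
product `α β` is `α` followed by `β`; this is the multiplicative opposite of `lieAut`. -/
abbrev G : Type _ := (lieAut p L)ᵐᵒᵖ

variable {p L} in
/-- The action of `α ∈ G_{L_p}` on `L ⊗ ℚ_p`. -/
def act (α : G p L) : (ℚ_[p] ⊗[ℤ] L) ≃ₗ[ℚ_[p]] (ℚ_[p] ⊗[ℤ] L) := α.unop.1

/-- The monoid `Δ_{L_p}` of the automorphisms of `L ⊗ ℚ_p` that restrict to endomorphisms of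
`L ⊗ ℤ_p`. -/
def Delta : Submonoid (G p L) where
  carrier := {α | ∀ v ∈ lattice p L, act α v ∈ lattice p L}
  one_mem' := fun _ hv => hv
  mul_mem' := fun hα hβ v hv => hβ _ (hα v hv)

/-- The group `Γ_{L_p}` of the automorphisms of `L ⊗ ℚ_p` that restrict to automorphisms of
`L ⊗ ℤ_p`. -/
def Gamma : Subgroup (G p L) where
  carrier := {α | α ∈ Delta p L ∧ α⁻¹ ∈ Delta p L}
  one_mem' := ⟨(Delta p L).one_mem, by simp [(Delta p L).one_mem]⟩
  mul_mem' hA hB := ⟨(Delta p L).mul_mem hA.1 hB.1, by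
    rw [mul_inv_rev]; exact (Delta p L).mul_mem hB.2 hA.2⟩
  inv_mem' hA := ⟨hA.2, by simpa using hA.1⟩

/-- The left representation of `G_{L_p}` by inverses. -/
noncomputable def leftRep : G p L →* ((ℚ_[p] ⊗[ℤ] L) ≃ₗ[ℚ_[p]] (ℚ_[p] ⊗[ℤ] L)) where
  toFun α := (act α)⁻¹
  map_one' := by simp [act]
  map_mul' α β := by simp [act]

theorem mem_Gamma_iff (α : G p L) : α ∈ Gamma p L ↔ ∀ v ∈ lattice p L,
    leftRep p L α v ∈ lattice p L ∧ leftRep p L α⁻¹ v ∈ lattice p L := by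
  have e : act α = leftRep p L α⁻¹ := by simp [leftRep, act]
  have e' : act α⁻¹ = leftRep p L α := by simp [leftRep, act]
  change (∀ v ∈ lattice p L, act α v ∈ lattice p L) ∧
    (∀ v ∈ lattice p L, act α⁻¹ v ∈ lattice p L) ↔ _
  rw [e, e']
  exact ⟨fun h v hv => ⟨h.2 v hv, h.1 v hv⟩, fun h => ⟨fun v hv => (h v hv).2,
    fun v hv => (h v hv).1⟩⟩

theorem lattice_fg [Module.Finite ℤ L] : (lattice p L).FG := by
  obtain ⟨s, hs⟩ := (Module.Finite.fg_top : (⊤ : Submodule ℤ L).FG)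
  classical
  refine ⟨s.image fun l => (1 : ℚ_[p]) ⊗ₜ[ℤ] l, le_antisymm ?_ ?_⟩
  · refine Submodule.span_mono ?_
    intro x hx
    obtain ⟨l, -, rfl⟩ := Finset.mem_image.1 (Finset.mem_coe.1 hx)
    exact ⟨l, rfl⟩
  · refine Submodule.span_le.2 ?_
    rintro _ ⟨l, rfl⟩
    have hl : l ∈ Submodule.span ℤ (s : Set L) := by rw [hs]; trivial
    change (1 : ℚ_[p]) ⊗ₜ[ℤ] l ∈ _
    induction hl using Submodule.span_induction with
    | mem x hx => exact Submodule.subset_span (Finset.mem_coe.2 (Finset.mem_image_of_mem _ hx))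
    | zero => simp
    | add x y _ _ hx hy => rw [TensorProduct.tmul_add]; exact Submodule.add_mem _ hx hy
    | smul a x _ hx =>
      rw [TensorProduct.tmul_smul]
      exact zsmul_mem hx a

theorem lattice_spans (v : ℚ_[p] ⊗[ℤ] L) : ∃ N : ℕ, (p : ℚ_[p]) ^ N • v ∈ lattice p L := by
  induction v using TensorProduct.induction_on with
  | zero => exact ⟨0, by simp⟩
  | tmul x l =>
    obtain ⟨N, hN⟩ := PadicLattice.std_spans (p := p) Unit (fun _ => x)
    refine ⟨N, ?_⟩
    obtain ⟨a, ha⟩ : ∃ a : ℤ_[p], (a : ℚ_[p]) = (p : ℚ_[p]) ^ N * x := ⟨⟨_, hN ()⟩, rfl⟩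
    have h : (p : ℚ_[p]) ^ N • (x ⊗ₜ[ℤ] l) =
        a • ((1 : ℚ_[p]) ⊗ₜ[ℤ] l) := by
      have e : a • (1 : ℚ_[p]) = (p : ℚ_[p]) ^ N * x := by
        rw [Algebra.smul_def, mul_one]; exact ha
      rw [TensorProduct.smul_tmul', TensorProduct.smul_tmul', e, smul_eq_mul]
    rw [h]
    exact Submodule.smul_mem _ _ (Submodule.subset_span ⟨l, rfl⟩)
  | add x y hx hy =>
    obtain ⟨N, hN⟩ := hx
    obtain ⟨M, hM⟩ := hy
    refine ⟨N + M, ?_⟩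
    rw [smul_add]
    refine Submodule.add_mem _ ?_ ?_
    · rw [add_comm, pow_add, mul_smul, ← PadicLattice.smul_coe]
      exact Submodule.smul_mem _ _ hN
    · rw [pow_add, mul_smul, ← PadicLattice.smul_coe]
      exact Submodule.smul_mem _ _ hM

/-- The pair `(Γ_{L_p}, Δ_{L_p})` is double finite. -/
instance [Module.Finite ℤ L] : IsHeckeTriple (Delta p L) (Gamma p L) (Gamma p L) :=
  IsHeckeTriple.of_diagonal (fun _ h => h.1) fun α _ =>
    PadicLattice.mem_commensurator _ _ (lattice_fg p L) (lattice_spans p L)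
      (mem_Gamma_iff p L) α

/-- The local Hecke ring `R_{L_p}`. -/
abbrev R : Type _ := HeckeRing (Delta p L) (Gamma p L) ℤ

/-- The index `|L_p / L_p^α|`. -/
noncomputable def latticeIndex (α : G p L) : ℕ :=
  ((lattice p L).toAddSubgroup.map (act α).toLinearMap.toAddMonoidHom).relIndex
    (lattice p L).toAddSubgroup

/-- The double cosets of the `α ∈ Δ_{L_p}` with `|L_p / L_p^α| = p^k`. -/
def cosetsOfIndex (k : ℕ) : Set (HeckeCoset (Delta p L) (Gamma p L) (Gamma p L)) :=
  {c | ∃ α : Delta p L, c = HeckeCoset.mk _ _ α ∧ latticeIndex p L α = p ^ k}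

theorem cosetsOfIndex_finite [Module.Finite ℤ L] (k : ℕ) : (cosetsOfIndex p L k).Finite := by
  refine PadicLattice.finite_cosets (leftRep p L) _ (lattice_fg p L) (mem_Gamma_iff p L) k _ ?_
  rintro c ⟨α, rfl, hα⟩
  refine ⟨α, rfl, fun v hv => ⟨?_, ?_⟩⟩
  · have h := AddSubgroup.nsmul_index_mem
      (((lattice p L).toAddSubgroup.map (act (α : G p L)).toLinearMap.toAddMonoidHom).addSubgroupOf
      (lattice p L).toAddSubgroup) ⟨v, hv⟩
    change latticeIndex p L α • _ ∈ _ at h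
    rw [hα] at h
    obtain ⟨w, hw, hwv⟩ := h
    have e : (p : ℚ_[p]) ^ k • leftRep p L α v = w := by
      rw [← map_smul]
      have : (p : ℚ_[p]) ^ k • v = act (α : G p L) w := by
        refine Eq.trans ?_ hwv.symm
        change (p : ℚ_[p]) ^ k • v = p ^ k • v
        rw [← Nat.cast_smul_eq_nsmul ℚ_[p]]
        simp
      rw [this]
      exact (act (α : G p L)).symm_apply_apply w
    rw [e]
    exact hw
  · have e : leftRep p L (α : G p L)⁻¹ v = act (α : G p L) v := by simp [leftRep, act]
    rw [e, ← PadicLattice.smul_coe]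
    exact Submodule.smul_mem _ _ (α.2 v hv)

/-- `T_{L_p}(p^k)`, the sum of all the double cosets of `α ∈ Δ_{L_p}` with
`|L_p / L_p^α| = p^k`. -/
noncomputable def Tpow [Module.Finite ℤ L] (k : ℕ) : R p L :=
  HeckeRing.sumCosets (cosetsOfIndex p L k) (cosetsOfIndex_finite p L k)

/-- The local Hecke series `P_{L_p}(X) = ∑ T_{L_p}(p^k) X^k` of a Lie algebra `L` that is free of
finite rank over `ℤ`. -/
noncomputable def heckeSeries [Module.Free ℤ L] [Module.Finite ℤ L] : PowerSeries (R p L) :=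
  PowerSeries.mk (Tpow p L)

end LocalHecke

/-! ### The Heisenberg Lie algebra -/

namespace Heisenberg

attribute [local instance] LieRing.ofAssociativeRing

/-- The square matrix `(0 a c; 0 0 b; 0 0 0)` of size `n + 2`, in the coordinates
`a` (first copy of `Fin n`), `b` (second copy of `Fin n`) and `c`. -/
def matrix (n : ℕ) : ((Fin n ⊕ Fin n) ⊕ Unit → ℤ) →ₗ[ℤ]
    Matrix (Unit ⊕ Fin n ⊕ Unit) (Unit ⊕ Fin n ⊕ Unit) ℤ where
  toFun f := Matrix.of fun
    | Sum.inl _, Sum.inr (Sum.inl j) => f (Sum.inl (Sum.inl j))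
    | Sum.inr (Sum.inl i), Sum.inr (Sum.inr _) => f (Sum.inl (Sum.inr i))
    | Sum.inl _, Sum.inr (Sum.inr _) => f (Sum.inr ())
    | _, _ => 0
  map_add' f g := by
    ext (_ | _ | _) (_ | _ | _) <;> simp
  map_smul' c f := by
    ext (_ | _ | _) (_ | _ | _) <;> simp

theorem matrix_injective (n : ℕ) : Function.Injective (matrix n) := by
  intro f g h
  funext x
  rcases x with (j | i) | u
  · exact congrFun (congrFun h (Sum.inl ())) (Sum.inr (Sum.inl j))
  · exact congrFun (congrFun h (Sum.inr (Sum.inl i))) (Sum.inr (Sum.inr ()))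
  · exact congrFun (congrFun h (Sum.inl ())) (Sum.inr (Sum.inr ()))

/-- The Heisenberg Lie algebra of dimension `2n + 1` over `ℤ`, a Lie algebra of square matrices of
size `n + 2` under the commutator. -/
def algebra (n : ℕ) :
    LieSubalgebra ℤ (Matrix (Unit ⊕ Fin n ⊕ Unit) (Unit ⊕ Fin n ⊕ Unit) ℤ) :=
  { LinearMap.range (matrix n) with
    lie_mem' := by
      rintro _ _ ⟨f, rfl⟩ ⟨g, rfl⟩
      refine ⟨Sum.elim 0 fun _ => ∑ i, (f (Sum.inl (Sum.inl i)) * g (Sum.inl (Sum.inr i)) -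
        g (Sum.inl (Sum.inl i)) * f (Sum.inl (Sum.inr i))), ?_⟩
      rw [Ring.lie_def]
      ext (_ | _ | _) (_ | _ | _) <;> simp [matrix, Matrix.mul_apply] }

/-- The standard coordinates `(a, b, c)` of the Heisenberg Lie algebra. -/
noncomputable def coords (n : ℕ) : algebra n ≃ₗ[ℤ] ((Fin n ⊕ Fin n) ⊕ Unit → ℤ) :=
  (LinearEquiv.ofInjective (matrix n) (matrix_injective n)).symm

/-- The standard basis of the Heisenberg Lie algebra. -/
noncomputable def basis (n : ℕ) : Module.Basis ((Fin n ⊕ Fin n) ⊕ Unit) ℤ (algebra n) :=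
  Module.Basis.ofEquivFun (coords n)

instance (n : ℕ) : Module.Finite ℤ (algebra n) := Module.Finite.of_basis (basis n)

instance (n : ℕ) : Module.Free ℤ (algebra n) := Module.Free.of_basis (basis n)

open scoped TensorProduct in
/-- The matrix `M` of an automorphism `α` of `𝓗 ⊗ ℚ_p` in the standard basis, with `α` acting on
coordinate row vectors by `x ↦ x M`. -/
noncomputable def rowMatrix {n p : ℕ} [Fact p.Prime] (α : LocalHecke.G p (algebra n)) :
    Matrix ((Fin n ⊕ Fin n) ⊕ Unit) ((Fin n ⊕ Fin n) ⊕ Unit) ℚ_[p] :=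
  (LinearMap.toMatrix ((basis n).baseChange ℚ_[p]) ((basis n).baseChange ℚ_[p])
    (LocalHecke.act α).toLinearMap).transpose

end Heisenberg

/-! ### Substitution of a monomial into a power series -/

/-- The power series `f(c X^m)`, for an integer `c` and `m ≥ 1`. -/
noncomputable def PowerSeries.substMonomial {A : Type*} [Ring A] (f : PowerSeries A) (c : ℤ)
    (m : ℕ) : PowerSeries A :=
  PowerSeries.mk fun j => if m ∣ j then c ^ (j / m) • PowerSeries.coeff (j / m) f else 0

/-! An element of the Hecke ring of `(H, Δ)` is the same thing as a finitely supported integer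
function on `G ⧸ H` that is invariant under left translation by `H` and vanishes off `Δ`
(`toCosets`, `toCosets_ofCosets`). In this model the product `f * g` is the sum of the translates of
`g` by the left cosets in `f`, with their coefficients (`toCosets_mul`).

A group homomorphism `π` that respects the two pairs induces a map of left cosets, and summing over
its fibres commutes with translation. The only obstruction to a ring homomorphism is that the result
must again be left invariant; this holds when every `h π(g) H₂` equals some `π(h' g) H₂` with `h' ∈
H₁`. That is the condition `IsHeckeHom`, and `HeckeRing.map` is the resulting functorial
pushforward.

All the maps of the theorem come from such pushforwards: `s` from `A ↦ (A, 0)`, `θ` from `(A, a) ↦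
(A, p a)`, `φ` from `(A, a) ↦ A`, and `ι` as the inverse of the one along `GSpExt n p ≃* Aut(𝓗 ⊗
ℚ_p)`. The lifting condition and the convergence of `θ^m` both rest on the integrality of `μ(A) A⁻¹
= -J Aᵀ J`: the cosets of `(A, p^m a)` and `(A, 0)` agree as soon as `p^m A⁻¹ a` is integral, so `m
≥ v_p(μ(A))` suffices. The relation with `T̃(pE, 0)` holds because conjugation by `(pE, 0)` is `(A,
a) ↦ (A, p a)`, which also makes this double coset a single left coset.

The power of `p` is a fibre count. Seen on left cosets, `T̃(A)` is the pullback of the indicator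
function of `Γ A Γ`, and the left cosets over `C Γ` correspond to `ℤ_p^{2n} / C ℤ_p^{2n}`, of order
`p^{v(det C)} = p^{n v(μ(C))}` (`ncard_fiber`, `phiHom_eq_smul`).

For the Heisenberg algebra the bracket is a symplectic form with values in the centre, so an
automorphism has a matrix `(A a; 0 μ(A))` with `A J Aᵀ = μ(A) J`. Its determinant has valuation `(n
+ 1) v(μ(A))`, which accounts for the substitution `X ↦ X^{n+1}`. -/

namespace HeckeRing

/-! ### Hecke rings as invariant functions on left cosets -/

section Embedding

variable {G : Type*} [Group G] {Δ : Submonoid G} {H : Subgroup G}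

/-- The left cosets contained in `Δ`. -/
def cosetsIn (Δ : Submonoid G) (H : Subgroup G) : Set (G ⧸ H) :=
  {y | ∃ g ∈ Δ, (g : G ⧸ H) = y}

theorem mk_mem_cosetsIn [IsHeckeTriple Δ H H] {g : G} :
    (g : G ⧸ H) ∈ cosetsIn Δ H ↔ g ∈ Δ := by
  refine ⟨?_, fun h => ⟨g, h, rfl⟩⟩
  rintro ⟨g', hg', e⟩
  rw [QuotientGroup.eq] at e
  simpa using (mul_right_mem_iff (Δ := Δ) e).2 hg'

/-- The function on left cosets attached to an element of the Hecke ring. -/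
noncomputable def toCosets [IsHeckeTriple Δ H H] : HeckeRing Δ H ℤ →+ (G ⧸ H →₀ ℤ) where
  toFun f := Finsupp.ofSupportFinite (fun y => fn (HeckeCosetModule.of.symm f) y.out) (fn_finite _)
  map_zero' := by ext y; exact fn_zero _
  map_add' f g := by ext y; exact fn_add _ _ _

theorem fn_out [IsHeckeTriple Δ H H] (f : HeckeCoset Δ H H →₀ ℤ) (x : G) :
    fn f (x : G ⧸ H).out = fn f x := by
  obtain ⟨k, hk⟩ := QuotientGroup.mk_out_eq_mul H x
  rw [hk, fn_mul_right _ k.2]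

theorem toCosets_mk [IsHeckeTriple Δ H H] (f : HeckeRing Δ H ℤ) (x : G) :
    toCosets f (x : G ⧸ H) = fn (HeckeCosetModule.of.symm f) x := fn_out _ _

theorem toCosets_injective [IsHeckeTriple Δ H H] :
    Function.Injective (toCosets : HeckeRing Δ H ℤ →+ _) := by
  intro f g h
  refine fn_injective (f := HeckeCosetModule.of.symm f) (g := HeckeCosetModule.of.symm g)
    fun x => ?_
  rw [← toCosets_mk, ← toCosets_mk, h]

theorem toCosets_smul [IsHeckeTriple Δ H H] (f : HeckeRing Δ H ℤ) {h : G} (hh : h ∈ H)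
    (y : G ⧸ H) : toCosets f (h • y) = toCosets f y := by
  induction y using QuotientGroup.induction_on with
  | H x =>
    change toCosets f ((h * x : G) : G ⧸ H) = _
    rw [toCosets_mk, toCosets_mk, fn_mul_left _ hh]

theorem mem_cosetsIn_of_toCosets_ne_zero [IsHeckeTriple Δ H H] {f : HeckeRing Δ H ℤ} {y : G ⧸ H}
    (h : toCosets f y ≠ 0) : y ∈ cosetsIn Δ H := by
  induction y using QuotientGroup.induction_on with
  | H x =>
    rw [mk_mem_cosetsIn]
    by_contra hx
    rw [toCosets_mk, fn, dif_neg hx] at h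
    exact h rfl

theorem coe_rep_injective :
    Function.Injective fun c : HeckeCoset Δ H H => ((rep c : G) : G ⧸ H) := by
  intro c c' h
  rw [← mk_rep c, ← mk_rep c', mk_eq_mk]
  exact ⟨1, H.one_mem, _, QuotientGroup.eq.1 h, by simp⟩

/-- The element of the Hecke ring with given values on representatives of the double cosets. -/
noncomputable def ofCosets : (G ⧸ H →₀ ℤ) →+ HeckeRing Δ H ℤ :=
  Finsupp.comapDomain.addMonoidHom coe_rep_injective

/-- The two hypotheses characterise the image of `toCosets`. Although `ofCosets` samples `F` at only
one representative of each double coset, left invariance recovers the other values. -/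
theorem toCosets_ofCosets [IsHeckeTriple Δ H H] {F : G ⧸ H →₀ ℤ}
    (h₁ : ∀ h ∈ H, ∀ y, F (h • y) = F y) (h₂ : ∀ y ∉ cosetsIn Δ H, F y = 0) :
    toCosets (ofCosets F : HeckeRing Δ H ℤ) = F := by
  ext y
  induction y using QuotientGroup.induction_on with
  | H x =>
    rw [toCosets_mk]
    by_cases hx : x ∈ Δ
    · rw [fn, dif_pos hx]
      obtain ⟨h, hh, k, hk, e⟩ := mk_eq_mk.1 (mk_rep (HeckeCoset.mk H H ⟨x, hx⟩))
      change F ((rep (HeckeCoset.mk H H ⟨x, hx⟩) : G) : G ⧸ H) = _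
      rw [← h₁ h hh]
      congr 1
      refine QuotientGroup.eq.2 ?_
      have e' : (h * (rep (HeckeCoset.mk H H ⟨x, hx⟩) : G))⁻¹ * x = k := by
        rw [inv_mul_eq_iff_eq_mul]; exact e
      exact e' ▸ hk
    · rw [fn, dif_neg hx, h₂ _ (mt mk_mem_cosetsIn.1 hx)]

theorem toCosets_ofCoset [IsHeckeTriple Δ H H] [DecidableEq (HeckeCoset Δ H H)]
    (c : HeckeCoset Δ H H) {x : G} (hx : x ∈ Δ) :
    toCosets (ofCoset c) (x : G ⧸ H) = if HeckeCoset.mk H H ⟨x, hx⟩ = c then 1 else 0 := by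
  classical
  rw [toCosets_mk]
  change fn (Finsupp.single c 1) x = _
  rw [fn_single]
  simp only [mem_cosetSet hx]

theorem toCosets_sumCosets [IsHeckeTriple Δ H H] {S : Set (HeckeCoset Δ H H)} (hS : S.Finite)
    [DecidablePred (· ∈ S)] {x : G} (hx : x ∈ Δ) :
    toCosets (sumCosets S hS) (x : G ⧸ H) = if HeckeCoset.mk H H ⟨x, hx⟩ ∈ S then 1 else 0 := by
  classical
  rw [sumCosets, map_sum, Finsupp.finsetSum_apply]
  simp only [toCosets_ofCoset _ hx]
  rw [Finset.sum_ite_eq]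
  simp

theorem toCosets_one [IsHeckeTriple Δ H H] :
    toCosets (1 : HeckeRing Δ H ℤ) = Finsupp.single ((1 : G) : G ⧸ H) 1 := by
  classical
  ext y
  induction y using QuotientGroup.induction_on with
  | H x =>
    rw [toCosets_mk]
    change fn (Finsupp.single 1 1) x = _
    rw [fn_single]
    simp only [Finsupp.single_apply, QuotientGroup.eq, mem_cosetSet_one, inv_one, one_mul]

/-- The translate of a function on left cosets. -/
noncomputable def shift (g : G) : (G ⧸ H →₀ ℤ) →+ (G ⧸ H →₀ ℤ) :=
  Finsupp.mapDomain.addMonoidHom (g • ·)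

theorem shift_single (g x : G) (m : ℤ) :
    shift g (Finsupp.single (x : G ⧸ H) m) = Finsupp.single ((g * x : G) : G ⧸ H) m :=
  Finsupp.mapDomain_single

theorem shift_apply (g : G) (F : G ⧸ H →₀ ℤ) (y : G ⧸ H) : shift g F y = F (g⁻¹ • y) := by
  conv_lhs => rw [← smul_inv_smul g y]
  exact Finsupp.mapDomain_apply (MulAction.injective g) _ _

/-- The translate of a left invariant function depends only on the coset `g H`, so the choice of
`y.out` in the product formula is immaterial. -/
theorem shift_mul_of_invariant {F : G ⧸ H →₀ ℤ} (hF : ∀ h ∈ H, ∀ y, F (h • y) = F y) (g : G)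
    {h : G} (hh : h ∈ H) : shift (g * h) F = shift g F := by
  ext y
  rw [shift_apply, shift_apply, mul_inv_rev, mul_smul, hF _ (H.inv_mem hh)]

theorem shift_out_of_invariant {F : G ⧸ H →₀ ℤ} (hF : ∀ h ∈ H, ∀ y, F (h • y) = F y) (g : G) :
    shift (g : G ⧸ H).out F = shift g F := by
  obtain ⟨k, hk⟩ := QuotientGroup.mk_out_eq_mul H g
  rw [hk, shift_mul_of_invariant hF _ k.2]

/-- The product of the Hecke ring in terms of left cosets. -/
theorem toCosets_mul [IsHeckeTriple Δ H H] (f g : HeckeRing Δ H ℤ) :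
    toCosets (f * g) = (toCosets f).sum fun y m => m • shift y.out (toCosets g) := by
  ext x
  induction x using QuotientGroup.induction_on with
  | H x =>
    rw [toCosets_mk]
    refine (fn_mulFun _ _ x).trans ?_
    rw [Finsupp.sum_apply, Finsupp.sum, conv]
    rw [finsum_eq_sum_of_support_subset (s := (toCosets f).support)]
    · refine Finset.sum_congr rfl fun y _ => ?_
      rw [Finsupp.smul_apply, shift_apply, smul_eq_mul]
      change _ = _ * toCosets g ((y.out⁻¹ * x : G) : G ⧸ H)
      rw [toCosets_mk]
      rfl
    · intro y hy
      exact Finsupp.mem_support_iff.2 (left_ne_zero_of_mul hy)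

/-- Multiplication by a double coset that is a single left coset. -/
theorem toCosets_mul_of_single [IsHeckeTriple Δ H H] {f g : HeckeRing Δ H ℤ} {x : G}
    (hf : toCosets f = Finsupp.single (x : G ⧸ H) 1) :
    toCosets (f * g) = shift x (toCosets g) := by
  rw [toCosets_mul, hf, Finsupp.sum_single_index (by simp), one_smul,
    shift_out_of_invariant fun h hh => toCosets_smul g hh]

/-- The hypothesis says `H A ⊆ A H`, so the double coset of `A` collapses to the single left coset
`A H`. -/
theorem toCosets_T_eq_single [IsHeckeTriple Δ H H] {A : Δ}
    (hA : ∀ h ∈ H, (A : G)⁻¹ * h * A ∈ H) :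
    toCosets (T A : HeckeRing Δ H ℤ) = Finsupp.single ((A : G) : G ⧸ H) 1 := by
  classical
  ext y
  induction y using QuotientGroup.induction_on with
  | H x =>
    simp only [Finsupp.single_apply, QuotientGroup.eq]
    by_cases hx : x ∈ Δ
    · rw [T, toCosets_ofCoset _ hx]
      refine if_congr ?_ rfl rfl
      rw [eq_comm, mk_eq_mk]
      constructor
      · rintro ⟨h, hh, k, hk, rfl⟩
        have := H.mul_mem (hA h hh) hk
        simpa [mul_assoc] using this
      · intro h
        exact ⟨1, H.one_mem, _, h, by simp⟩
    · rw [if_neg]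
      · by_contra h
        exact hx (mk_mem_cosetsIn.1 (mem_cosetsIn_of_toCosets_ne_zero h))
      · intro h
        exact hx (by simpa using (mul_right_mem_iff (Δ := Δ) h).2 A.2)

end Embedding

/-! ### Pushforward of Hecke rings along group homomorphisms -/

section Pushforward

variable {G₁ G₂ G₃ : Type*} [Group G₁] [Group G₂] [Group G₃]
  {Δ₁ : Submonoid G₁} {H₁ : Subgroup G₁} {Δ₂ : Submonoid G₂} {H₂ : Subgroup G₂}
  {Δ₃ : Submonoid G₃} {H₃ : Subgroup G₃}

/-- The homomorphisms along which elements of Hecke rings can be pushed forward: `H₂ π(g) H₂` is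
the union of the left cosets `π(h g) H₂`, `h ∈ H₁`. -/
structure IsHeckeHom (Δ₁ : Submonoid G₁) (H₁ : Subgroup G₁) (Δ₂ : Submonoid G₂) (H₂ : Subgroup G₂)
    (π : G₁ →* G₂) : Prop where
  map_subgroup : H₁ ≤ H₂.comap π
  map_submonoid : ∀ g ∈ Δ₁, π g ∈ Δ₂
  exists_lift : ∀ g ∈ Δ₁, ∀ h ∈ H₂, ∃ h' ∈ H₁, (π g)⁻¹ * (π h')⁻¹ * h * π g ∈ H₂

theorem IsHeckeHom.comp {π : G₁ →* G₂} {ρ : G₂ →* G₃} (hρ : IsHeckeHom Δ₂ H₂ Δ₃ H₃ ρ)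
    (hπ : IsHeckeHom Δ₁ H₁ Δ₂ H₂ π) : IsHeckeHom Δ₁ H₁ Δ₃ H₃ (ρ.comp π) where
  map_subgroup := fun _ hx => hρ.map_subgroup (hπ.map_subgroup hx)
  map_submonoid g hg := hρ.map_submonoid _ (hπ.map_submonoid g hg)
  exists_lift g hg h hh := by
    obtain ⟨h', hh', e'⟩ := hρ.exists_lift _ (hπ.map_submonoid g hg) h hh
    obtain ⟨h'', hh'', e''⟩ := hπ.exists_lift g hg h' hh'
    refine ⟨h'', hh'', ?_⟩
    -- The lifts are taken one homomorphism at a time; in the product of the two memberships the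
    -- factors coming from `h'` cancel.
    have := H₃.mul_mem (hρ.map_subgroup e'') e'
    simpa [mul_assoc] using this

/-- The map induced by `π` on left cosets. -/
def cosetMap {π : G₁ →* G₂} (hπ : IsHeckeHom Δ₁ H₁ Δ₂ H₂ π) : G₁ ⧸ H₁ → G₂ ⧸ H₂ :=
  Quotient.map' π fun x y h => by
    rw [QuotientGroup.leftRel_apply] at h ⊢
    simpa using hπ.map_subgroup h

theorem cosetMap_mk {π : G₁ →* G₂} (hπ : IsHeckeHom Δ₁ H₁ Δ₂ H₂ π) (x : G₁) :
    cosetMap hπ (x : G₁ ⧸ H₁) = (π x : G₂ ⧸ H₂) := rfl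

theorem cosetMap_smul {π : G₁ →* G₂} (hπ : IsHeckeHom Δ₁ H₁ Δ₂ H₂ π) (g : G₁) (y : G₁ ⧸ H₁) :
    cosetMap hπ (g • y) = π g • cosetMap hπ y := by
  induction y using QuotientGroup.induction_on with
  | H x =>
    change ((π (g * x) : G₂) : G₂ ⧸ H₂) = ((π g * π x : G₂) : G₂ ⧸ H₂)
    rw [map_mul]

theorem mapDomain_shift {π : G₁ →* G₂} (hπ : IsHeckeHom Δ₁ H₁ Δ₂ H₂ π) (g : G₁)
    (F : G₁ ⧸ H₁ →₀ ℤ) :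
    (shift g F).mapDomain (cosetMap hπ) = shift (π g) (F.mapDomain (cosetMap hπ)) := by
  change (F.mapDomain (g • ·)).mapDomain _ = (F.mapDomain _).mapDomain _
  rw [← Finsupp.mapDomain_comp, ← Finsupp.mapDomain_comp]
  congr 1
  funext y
  exact cosetMap_smul hπ g y

variable [IsHeckeTriple Δ₁ H₁ H₁] [IsHeckeTriple Δ₂ H₂ H₂] [IsHeckeTriple Δ₃ H₃ H₃]

theorem mapDomain_eq_zero {π : G₁ →* G₂} (hπ : IsHeckeHom Δ₁ H₁ Δ₂ H₂ π) (f : HeckeRing Δ₁ H₁ ℤ)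
    {y : G₂ ⧸ H₂} (hy : ¬ ∃ g ∈ Δ₁, ((π g : G₂) : G₂ ⧸ H₂) = y) :
    (toCosets f).mapDomain (cosetMap hπ) y = 0 := by
  classical
  by_contra h
  obtain ⟨x, hx, rfl⟩ := Finset.mem_image.1
    (Finsupp.mapDomain_support (Finsupp.mem_support_iff.2 h))
  obtain ⟨g, hg, rfl⟩ := mem_cosetsIn_of_toCosets_ne_zero (Finsupp.mem_support_iff.1 hx)
  exact hy ⟨g, hg, rfl⟩

/-- On the image of `Δ₁`, `exists_lift` replaces translation by `h` with translation by some `π h'`.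
The latter commutes with summation over fibres, and `toCosets f` is already invariant under `h'`. -/
theorem mapDomain_invariant {π : G₁ →* G₂} (hπ : IsHeckeHom Δ₁ H₁ Δ₂ H₂ π)
    (f : HeckeRing Δ₁ H₁ ℤ) {h : G₂} (hh : h ∈ H₂) (y : G₂ ⧸ H₂) :
    (toCosets f).mapDomain (cosetMap hπ) (h • y) = (toCosets f).mapDomain (cosetMap hπ) y := by
  have key : ∀ g ∈ Δ₁, ∀ h ∈ H₂, ∃ h' ∈ H₁,
      h • ((π g : G₂) : G₂ ⧸ H₂) = ((π (h' * g) : G₂) : G₂ ⧸ H₂) := by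
    intro g hg h hh
    obtain ⟨h', hh', e⟩ := hπ.exists_lift g hg h hh
    refine ⟨h', hh', Eq.symm (QuotientGroup.eq.2 ?_)⟩
    simpa [mul_assoc] using e
  by_cases hy : ∃ g ∈ Δ₁, ((π g : G₂) : G₂ ⧸ H₂) = y
  · obtain ⟨g, hg, rfl⟩ := hy
    obtain ⟨h', hh', e⟩ := key g hg h hh
    have e' : ((π (h' * g) : G₂) : G₂ ⧸ H₂) = π h' • ((π g : G₂) : G₂ ⧸ H₂) := by
      rw [map_mul]; rfl
    have e₀ : shift h'⁻¹ (toCosets f) = toCosets f := by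
      ext z
      rw [shift_apply, inv_inv, toCosets_smul f hh']
    rw [e, e']
    conv_rhs => rw [← e₀, mapDomain_shift, shift_apply, map_inv, inv_inv]
  -- Off the image both sides vanish: lifting `h⁻¹` shows that `h • y` cannot be in the image unless
  -- `y` is.
  · rw [mapDomain_eq_zero hπ f hy, mapDomain_eq_zero hπ f]
    rintro ⟨g, hg, e⟩
    obtain ⟨h', hh', e'⟩ := key g hg h⁻¹ (H₂.inv_mem hh)
    refine hy ⟨h' * g, Δ₁.mul_mem (mem_of_mem_H hh') hg, ?_⟩
    rw [← e', e, inv_smul_smul]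

theorem toCosets_ofCosets_mapDomain {π : G₁ →* G₂} (hπ : IsHeckeHom Δ₁ H₁ Δ₂ H₂ π)
    (f : HeckeRing Δ₁ H₁ ℤ) :
    toCosets (ofCosets ((toCosets f).mapDomain (cosetMap hπ)) : HeckeRing Δ₂ H₂ ℤ) =
      (toCosets f).mapDomain (cosetMap hπ) := by
  refine toCosets_ofCosets (fun h hh y => mapDomain_invariant hπ f hh y) fun y hy => ?_
  refine mapDomain_eq_zero hπ f ?_
  rintro ⟨g, hg, rfl⟩
  exact hy ⟨_, hπ.map_submonoid g hg, rfl⟩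

/-- The product is a sum of translates, and translates go to translates. The representative `π
y.out` need not be the chosen representative of its coset, but the invariance of the pushed-forward
function makes them interchangeable. -/
theorem mapDomain_toCosets_mul {π : G₁ →* G₂} (hπ : IsHeckeHom Δ₁ H₁ Δ₂ H₂ π)
    (f g : HeckeRing Δ₁ H₁ ℤ) :
    (toCosets (f * g)).mapDomain (cosetMap hπ) =
      ((toCosets f).mapDomain (cosetMap hπ)).sum fun y m =>
        m • shift y.out ((toCosets g).mapDomain (cosetMap hπ)) := by
  rw [toCosets_mul, Finsupp.sum_mapDomain_index (by simp) (by intros; rw [add_smul]),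
    Finsupp.mapDomain_sum]
  refine Finsupp.sum_congr fun y _ => ?_
  rw [Finsupp.mapDomain_smul, mapDomain_shift]
  congr 1
  rw [← shift_out_of_invariant (fun h hh => mapDomain_invariant hπ g hh), ← cosetMap_mk hπ,
    QuotientGroup.out_eq']

/-- The pushforward of Hecke rings along a group homomorphism. -/
noncomputable def map {π : G₁ →* G₂} (hπ : IsHeckeHom Δ₁ H₁ Δ₂ H₂ π) :
    HeckeRing Δ₁ H₁ ℤ →+* HeckeRing Δ₂ H₂ ℤ where
  toFun f := ofCosets ((toCosets f).mapDomain (cosetMap hπ))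
  map_zero' := by simp
  map_add' f g := by rw [map_add, Finsupp.mapDomain_add, map_add]
  map_one' := by
    refine toCosets_injective ?_
    rw [toCosets_ofCosets_mapDomain, toCosets_one, toCosets_one, Finsupp.mapDomain_single,
      cosetMap_mk, map_one]
  map_mul' f g := by
    refine toCosets_injective ?_
    rw [toCosets_ofCosets_mapDomain, mapDomain_toCosets_mul, toCosets_mul,
      toCosets_ofCosets_mapDomain, toCosets_ofCosets_mapDomain]

theorem toCosets_map {π : G₁ →* G₂} (hπ : IsHeckeHom Δ₁ H₁ Δ₂ H₂ π) (f : HeckeRing Δ₁ H₁ ℤ) :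
    toCosets (map hπ f) = (toCosets f).mapDomain (cosetMap hπ) :=
  toCosets_ofCosets_mapDomain hπ f

theorem map_map {π : G₁ →* G₂} {ρ : G₂ →* G₃} (hπ : IsHeckeHom Δ₁ H₁ Δ₂ H₂ π)
    (hρ : IsHeckeHom Δ₂ H₂ Δ₃ H₃ ρ) (f : HeckeRing Δ₁ H₁ ℤ) :
    map hρ (map hπ f) = map (hρ.comp hπ) f := by
  refine toCosets_injective ?_
  rw [toCosets_map, toCosets_map, toCosets_map, ← Finsupp.mapDomain_comp]
  congr 1
  funext y
  induction y using QuotientGroup.induction_on with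
  | H x => rfl

/-- Two homomorphisms need only agree modulo `H₂` on the left cosets occurring in the given `f`.
This is what allows a power of `θ` to equal `s ∘ φ` on one double coset without being equal to it
globally. -/
theorem map_congr {π ρ : G₁ →* G₂} (hπ : IsHeckeHom Δ₁ H₁ Δ₂ H₂ π)
    (hρ : IsHeckeHom Δ₁ H₁ Δ₂ H₂ ρ) (f : HeckeRing Δ₁ H₁ ℤ)
    (h : ∀ x : G₁, toCosets f (x : G₁ ⧸ H₁) ≠ 0 → ((π x : G₂) : G₂ ⧸ H₂) = (ρ x : G₂)) :
    map hπ f = map hρ f := by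
  refine toCosets_injective ?_
  rw [toCosets_map, toCosets_map]
  refine Finsupp.mapDomain_congr fun y hy => ?_
  induction y using QuotientGroup.induction_on with
  | H x => exact h x (Finsupp.mem_support_iff.1 hy)

theorem map_eq_self {π : G₁ →* G₁} (hπ : IsHeckeHom Δ₁ H₁ Δ₁ H₁ π) (h : ∀ x, π x = x)
    (f : HeckeRing Δ₁ H₁ ℤ) : map hπ f = f := by
  refine toCosets_injective ?_
  rw [toCosets_map]
  conv_rhs => rw [← Finsupp.mapDomain_id (v := toCosets f)]
  refine Finsupp.mapDomain_congr fun y _ => ?_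
  induction y using QuotientGroup.induction_on with
  | H x => rw [cosetMap_mk, h]; rfl

theorem mk_eq_mk_of_map {π : G₁ →* G₂} (hπ : IsHeckeHom Δ₁ H₁ Δ₂ H₂ π) {A B : Δ₁}
    (h : HeckeCoset.mk H₁ H₁ A = HeckeCoset.mk H₁ H₁ B) :
    HeckeCoset.mk H₂ H₂ (⟨π A, hπ.map_submonoid A A.2⟩ : Δ₂) =
      HeckeCoset.mk H₂ H₂ ⟨π B, hπ.map_submonoid B B.2⟩ := by
  obtain ⟨h, hh, k, hk, e⟩ := mk_eq_mk.1 h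
  exact mk_eq_mk.2 ⟨π h, hπ.map_subgroup hh, π k, hπ.map_subgroup hk, by simp [e]⟩

/-- In general the pushforward of a double coset acquires multiplicities. A left inverse makes the
map of left cosets injective, so all multiplicities are one; no left coset of the target double
coset is missed, by `exists_lift`. -/
theorem map_T_of_leftInverse {π : G₁ →* G₂} {ρ : G₂ →* G₁} (hπ : IsHeckeHom Δ₁ H₁ Δ₂ H₂ π)
    (hρ : IsHeckeHom Δ₂ H₂ Δ₁ H₁ ρ) (h : ∀ x, ρ (π x) = x) (A : Δ₁) :
    map hπ (T A) = T ⟨π A, hπ.map_submonoid A A.2⟩ := by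
  classical
  have hinj : Function.Injective (cosetMap hπ) := by
    refine Function.LeftInverse.injective (g := cosetMap hρ) fun y => ?_
    induction y using QuotientGroup.induction_on with
    | H x => rw [cosetMap_mk, cosetMap_mk, h]
  refine toCosets_injective ?_
  rw [toCosets_map]
  ext y
  by_cases hy : y ∈ Set.range (cosetMap hπ)
  · obtain ⟨y, rfl⟩ := hy
    rw [Finsupp.mapDomain_apply hinj]
    induction y using QuotientGroup.induction_on with
    | H x =>
      rw [cosetMap_mk]
      by_cases hx : x ∈ Δ₁
      · rw [T, T, toCosets_ofCoset _ hx, toCosets_ofCoset _ (hπ.map_submonoid x hx)]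
        refine if_congr ⟨mk_eq_mk_of_map hπ, fun e => ?_⟩ rfl rfl
        simpa [h] using mk_eq_mk_of_map hρ e
      · rw [Finsupp.notMem_support_iff.1 (mt (fun h => mem_cosetsIn_of_toCosets_ne_zero
          (Finsupp.mem_support_iff.1 h)) (mt mk_mem_cosetsIn.1 hx)), eq_comm]
        refine Finsupp.notMem_support_iff.1 (mt (fun h => mem_cosetsIn_of_toCosets_ne_zero
          (Finsupp.mem_support_iff.1 h)) (mt mk_mem_cosetsIn.1 fun hx' => hx ?_))
        simpa [h] using hρ.map_submonoid _ hx'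
  · rw [Finsupp.mapDomain_of_notMem_range _ _ hy, eq_comm]
    by_contra hne
    induction y using QuotientGroup.induction_on with
    | H x =>
      have hx : x ∈ Δ₂ := mk_mem_cosetsIn.1 (mem_cosetsIn_of_toCosets_ne_zero hne)
      rw [T, toCosets_ofCoset _ hx] at hne
      have hne' : HeckeCoset.mk H₂ H₂ ⟨x, hx⟩ = HeckeCoset.mk H₂ H₂ ⟨π A, hπ.map_submonoid A A.2⟩ := by
        simpa using hne
      -- A left coset of `H₂ π(A) H₂` outside the range is impossible: its left factor `k` lifts to
      -- `H₁`.
      obtain ⟨k, hk, l, hl, e⟩ := mk_eq_mk.1 hne'.symm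
      obtain ⟨k', -, e'⟩ := hπ.exists_lift A A.2 k hk
      refine hy ⟨((k' * A : G₁) : G₁ ⧸ H₁), ?_⟩
      have e : x = k * π A * l := e
      rw [cosetMap_mk, QuotientGroup.eq, e]
      simpa [mul_assoc] using H₂.mul_mem e' hl

/-- The isomorphism of Hecke rings induced by an isomorphism of Hecke pairs. -/
noncomputable def mapEquiv (e : G₁ ≃* G₂) (he : IsHeckeHom Δ₁ H₁ Δ₂ H₂ (e : G₁ →* G₂))
    (he' : IsHeckeHom Δ₂ H₂ Δ₁ H₁ (e.symm : G₂ →* G₁)) : HeckeRing Δ₁ H₁ ℤ ≃+* HeckeRing Δ₂ H₂ ℤ :=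
  RingEquiv.ofRingHom (map he) (map he')
    (RingHom.ext fun f => by
      rw [RingHom.comp_apply, map_map]
      exact map_eq_self _ (fun x => e.apply_symm_apply x) f)
    (RingHom.ext fun f => by
      rw [RingHom.comp_apply, map_map]
      exact map_eq_self _ (fun x => e.symm_apply_apply x) f)

end Pushforward

end HeckeRing

/-! ### Indices of sublattices and valuations of determinants -/

namespace PadicInt

variable {p : ℕ} [Fact p.Prime]

/-- Up to a unit `a` is a power of `p`, so the ideal is the kernel of reduction onto `ZMod (p ^
a.valuation)`. -/
theorem card_quotient_span_singleton {a : ℤ_[p]} (ha : a ≠ 0) :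
    Nat.card (ℤ_[p] ⧸ Ideal.span {a}) = p ^ a.valuation := by
  have h : Ideal.span {a} = RingHom.ker (toZModPow (p := p) a.valuation) := by
    rw [ker_toZModPow, Ideal.span_singleton_eq_span_singleton]
    refine Associated.symm ⟨unitCoeff ha, ?_⟩
    rw [mul_comm]
    exact (unitCoeff_spec ha).symm
  rw [h, Nat.card_congr (RingHom.quotientKerEquivOfSurjective
    (ZMod.ringHom_surjective (toZModPow (p := p) a.valuation))).toEquiv, Nat.card_zmod]

theorem valuation_eq_of_associated {a b : ℤ_[p]} (h : Associated a b) :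
    a.valuation = b.valuation := by
  obtain ⟨u, rfl⟩ := h
  by_cases ha : a = 0
  · simp [ha]
  · rw [valuation_mul ha u.ne_zero]
    have : (u : ℤ_[p]).valuation = 0 := by
      have h1 := norm_eq_zpow_neg_valuation u.ne_zero
      rw [isUnit_iff.1 u.isUnit] at h1
      have hp : (1 : ℝ) < p := by exact_mod_cast (Fact.out : p.Prime).one_lt
      have := (zpow_eq_one_iff_right₀ (by positivity) hp.ne').1 h1.symm
      omega
    rw [this, add_zero]

/-- The cokernel of an injective endomorphism of a free module over `ℤ_p`. -/
theorem card_quotient_range {M : Type*} [AddCommGroup M] [Module ℤ_[p] M] [Module.Free ℤ_[p] M]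
    [Module.Finite ℤ_[p] M] {f : M →ₗ[ℤ_[p]] M} (hf : Function.Injective f) :
    Nat.card (M ⧸ LinearMap.range f) = p ^ (LinearMap.det f).valuation := by
  let b := Module.Free.chooseBasis ℤ_[p] M
  let N := LinearMap.range f
  let e : M ≃ₗ[ℤ_[p]] N := LinearEquiv.ofInjective f hf
  have h : Module.finrank ℤ_[p] N = Module.finrank ℤ_[p] M := e.symm.finrank_eq
  let a := Submodule.smithNormalFormCoeffs b h
  let b' := Submodule.smithNormalFormTopBasis b h
  let ab := Submodule.smithNormalFormBotBasis b h
  have ab_eq := Submodule.smithNormalFormBotBasis_def b h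
  have ha := Submodule.smithNormalFormCoeffs_ne_zero b h
  -- The isomorphism `e'` matches the two Smith bases, so followed by the inclusion of `N` it is
  -- diagonal with entries `a i`. Since `e` and `e'` differ by an automorphism of `M`, the
  -- determinant of `f` is the product of the `a i` up to a unit.
  let e' : M ≃ₗ[ℤ_[p]] N := b'.equiv ab (Equiv.refl _)
  have hdet : LinearMap.det (N.subtype ∘ₗ (e' : M →ₗ[ℤ_[p]] N)) = ∏ i, a i := by
    rw [← LinearMap.det_toMatrix b', ← Matrix.det_diagonal]
    congr 1
    ext i j
    have hj : (N.subtype ∘ₗ (e' : M →ₗ[ℤ_[p]] N)) (b' j) = a j • b' j := by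
      rw [LinearMap.comp_apply, LinearEquiv.coe_coe, Module.Basis.equiv_apply, Equiv.refl_apply]
      exact ab_eq j
    rw [LinearMap.toMatrix_apply, hj, map_smul, Module.Basis.repr_self, Finsupp.smul_single,
      smul_eq_mul, mul_one]
    by_cases h : i = j
    · rw [h, Matrix.diagonal_apply_eq, Finsupp.single_eq_same]
    · rw [Matrix.diagonal_apply_ne _ h, Finsupp.single_eq_of_ne h]
  have hassoc : Associated (LinearMap.det f) (∏ i, a i) := by
    rw [← hdet]
    exact LinearMap.associated_det_comp_equiv N.subtype e e'
  rw [valuation_eq_of_associated hassoc, Nat.card_congr (N.quotientEquivPiSpan b h).toEquiv,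
    Nat.card_pi]
  have hv : ∀ s : Finset (Module.Free.ChooseBasisIndex ℤ_[p] M),
      (∏ i ∈ s, a i).valuation = ∑ i ∈ s, (a i).valuation := by
    intro s
    induction s using Finset.cons_induction with
    | empty => simp
    | cons i s hi ih =>
      rw [Finset.prod_cons, Finset.sum_cons, valuation_mul (ha i)
        (Finset.prod_ne_zero_iff.2 fun j _ => ha j), ih]
  rw [hv, ← Finset.prod_pow_eq_pow_sum]
  exact Finset.prod_congr rfl fun i _ => card_quotient_span_singleton (ha i)

end PadicInt

namespace PadicLattice

variable {p : ℕ} [Fact p.Prime] {ι : Type*} [Fintype ι] [DecidableEq ι]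

/-- The index in `ℤ_p^ι` of its image under an integral matrix. -/
theorem relIndex_map_mulVec {M : Matrix ι ι ℚ_[p]} (hM : ∀ i j, ‖M i j‖ ≤ 1) (hdet : M.det ≠ 0) :
    ((std p ι).toAddSubgroup.map M.mulVecLin.toAddMonoidHom).relIndex (std p ι).toAddSubgroup =
      p ^ M.det.valuation.toNat := by
  -- `M₀` is `M` read over `ℤ_p`. The index is transported along the embedding `j` of `ℤ_p^ι`, where
  -- it becomes the order of the cokernel of `M₀`.
  let M₀ : Matrix ι ι ℤ_[p] := fun i j => ⟨M i j, hM i j⟩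
  have hM₀ : M = M₀.map (PadicInt.Coe.ringHom (p := p)) := rfl
  have hdet₀ : M.det = (M₀.det : ℚ_[p]) := by
    rw [hM₀]; exact (RingHom.map_det _ _).symm
  have hne : M₀.det ≠ 0 := fun h => hdet (by rw [hdet₀, h]; rfl)
  let j : (ι → ℤ_[p]) →+ (ι → ℚ_[p]) :=
    { toFun := fun v i => v i
      map_zero' := by ext; simp
      map_add' := by intros; ext; simp }
  have hj : Function.Injective j := fun v w h => funext fun i => Subtype.ext (congrFun h i)
  have e₁ : (std p ι).toAddSubgroup = (⊤ : AddSubgroup _).map j := by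
    ext v
    constructor
    · intro hv
      exact ⟨fun i => ⟨v i, hv i⟩, trivial, rfl⟩
    · rintro ⟨w, -, rfl⟩ i
      exact (w i).2
  have hcomm : ∀ w, M.mulVec (j w) = j (M₀.mulVec w) := fun w => by
    rw [hM₀]
    exact funext fun i => (RingHom.map_mulVec (PadicInt.Coe.ringHom (p := p)) M₀ w i).symm
  have e₂ : (std p ι).toAddSubgroup.map M.mulVecLin.toAddMonoidHom =
      (LinearMap.range (Matrix.toLin' M₀)).toAddSubgroup.map j := by
    rw [e₁]
    ext v
    constructor
    · rintro ⟨_, ⟨w, -, rfl⟩, rfl⟩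
      exact ⟨M₀.mulVec w, ⟨w, rfl⟩, (hcomm w).symm⟩
    · rintro ⟨_, ⟨w, rfl⟩, rfl⟩
      exact ⟨j w, ⟨w, trivial, rfl⟩, hcomm w⟩
  rw [e₂, e₁, AddSubgroup.relIndex_map_map_of_injective _ _ hj, AddSubgroup.relIndex_top_right,
    hdet₀, PadicInt.valuation_coe, Int.toNat_natCast, ← LinearMap.det_toLin']
  refine PadicInt.card_quotient_range ?_
  exact Matrix.mulVec_injective_of_det_ne_zero hne

end PadicLattice

/-! ### Integrality and valuations of multipliers -/

namespace GSp

open Matrix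

variable {n : ℕ} [NeZero n] {p : ℕ} [Fact p.Prime]

/-- The relation `A J Aᵀ = μ(A) J` gives `μ(A) A⁻¹ = -J Aᵀ J`, which has integral entries. -/
theorem norm_multiplier_smul_inv_mulVec {A : GSp n ℚ_[p]} (hA : A ∈ Delta n p)
    {v : Fin n ⊕ Fin n → ℚ_[p]} (hv : ∀ i, ‖v i‖ ≤ 1) (i : Fin n ⊕ Fin n) :
    ‖((multiplier A : ℚ_[p]) • (A⁻¹).1.1 *ᵥ v) i‖ ≤ 1 := by
  have hJ : ∀ i j, ‖J (Fin n) ℚ_[p] i j‖ ≤ 1 := by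
    rintro (i | i) (j | j) <;> by_cases hij : i = j <;> simp [J, hij]
  rw [inv_eq, ← smul_mulVec, smul_smul, mul_inv_cancel₀ (multiplier A).ne_zero, one_smul]
  refine norm_mulVec_le_one (fun i j => ?_) hv i
  rw [neg_apply, norm_neg]
  exact norm_mul_le_one (norm_mul_le_one hJ fun i j => hA j i) hJ i j

theorem valuation_multiplier_of_mem_Gamma {X : GSp n ℚ_[p]} (hX : X ∈ Gamma n p) :
    (multiplier X : ℚ_[p]).valuation = 0 := by
  have h₁ := (Padic.norm_le_one_iff_val_nonneg _).1 (norm_multiplier_le hX.1)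
  have h₂ := (Padic.norm_le_one_iff_val_nonneg _).1 (norm_multiplier_le hX.2)
  rw [map_inv, Units.val_inv_eq_inv_val, Padic.valuation_inv] at h₂
  omega

theorem valuation_multiplier_mul (A B : GSp n ℚ_[p]) :
    (multiplier (A * B) : ℚ_[p]).valuation =
      (multiplier A : ℚ_[p]).valuation + (multiplier B : ℚ_[p]).valuation := by
  rw [map_mul, Units.val_mul, Padic.valuation_mul (multiplier A).ne_zero (multiplier B).ne_zero]

/-- Determinants in `A J Aᵀ = μ J` give `det(A)² = μ^{2n}`; at the level of valuations the factor
`2` cancels, so no sign has to be determined. -/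
theorem valuation_det (A : GSp n ℚ_[p]) :
    A.1.1.det.valuation = n * (multiplier A : ℚ_[p]).valuation := by
  have hJ : (J (Fin n) ℚ_[p]).det ≠ 0 := fun h => by
    simpa [h] using J_det_mul_J_det (Fin n) ℚ_[p]
  have hA : A.1.1.det ≠ 0 := A.1.det_ne_zero
  have h := congrArg Matrix.det (multiplier_spec A)
  rw [det_mul, det_mul, det_transpose, det_smul, mul_right_comm] at h
  have h' := congrArg Padic.valuation (mul_right_cancel₀ hJ h)
  rw [Padic.valuation_mul hA hA, Padic.valuation_pow, Fintype.card_sum, Fintype.card_fin] at h'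
  push_cast at h'
  linarith

theorem valuation_multiplier_eq_of_mk_eq {A B : Delta n p}
    (h : HeckeCoset.mk (Gamma n p) (Gamma n p) A = HeckeCoset.mk _ _ B) :
    (multiplier (A : GSp n ℚ_[p]) : ℚ_[p]).valuation =
      (multiplier (B : GSp n ℚ_[p]) : ℚ_[p]).valuation := by
  obtain ⟨X, hX, Y, hY, e⟩ := HeckeRing.mk_eq_mk.1 h
  rw [e, valuation_multiplier_mul, valuation_multiplier_mul, valuation_multiplier_of_mem_Gamma hX,
    valuation_multiplier_of_mem_Gamma hY, zero_add, add_zero]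

theorem mk_mem_cosetsOfVal {k : ℕ} (A : Delta n p) : HeckeCoset.mk _ _ A ∈ cosetsOfVal n p k ↔
    (multiplier (A : GSp n ℚ_[p]) : ℚ_[p]).valuation = k := by
  constructor
  · rintro ⟨B, e, hB⟩
    rw [valuation_multiplier_eq_of_mk_eq e, hB]
  · exact fun h => ⟨A, rfl, h⟩

end GSp

/-! ### The homomorphisms `s`, `θ`, `φ` and their relations -/

namespace GSpExt

open Matrix GSp HeckeRing

variable {n : ℕ} [NeZero n] {p : ℕ} [Fact p.Prime]

/-- The projection `(A, a) ↦ A`. -/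
noncomputable def proj : GSpExt n p →* GSp n ℚ_[p] where
  toFun := fst
  map_one' := rfl
  map_mul' _ _ := rfl

/-- The section `A ↦ (A, 0)`. -/
noncomputable def incl : GSp n ℚ_[p] →* GSpExt n p where
  toFun A := ⟨A, 0⟩
  map_one' := rfl
  map_mul' A B := GSpExt.ext rfl (by simp [mul_snd])

/-- The endomorphism `(A, a) ↦ (A, c a)`. -/
noncomputable def scale (c : ℚ_[p]) : GSpExt n p →* GSpExt n p where
  toFun x := ⟨x.fst, c • x.snd⟩
  map_one' := GSpExt.ext rfl (by simp [one_snd])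
  map_mul' x y := GSpExt.ext rfl (by simp [mul_snd, mulVec_smul, smul_comm c])

theorem scale_incl (c : ℚ_[p]) (A : GSp n ℚ_[p]) : scale c (incl A) = incl A :=
  GSpExt.ext rfl (smul_zero _)

theorem scale_scale (c d : ℚ_[p]) (x : GSpExt n p) : scale c (scale d x) = scale (c * d) x :=
  GSpExt.ext rfl (smul_smul _ _ _)

theorem incl_mem_Gamma {X : GSp n ℚ_[p]} (hX : X ∈ GSp.Gamma n p) : incl X ∈ Gamma n p :=
  ⟨hX, fun i => by simp [incl]⟩

theorem incl_mem_Delta {A : GSp n ℚ_[p]} (hA : A ∈ GSp.Delta n p) : incl A ∈ Delta n p :=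
  ⟨hA, fun i => by simp [incl]⟩

theorem mulVec_inv_mulVec (A : GSp n ℚ_[p]) (v : Fin n ⊕ Fin n → ℚ_[p]) :
    A.1.1 *ᵥ ((A⁻¹).1.1 *ᵥ v) = v := by
  rw [mulVec_mulVec]
  have : A.1.1 * (A⁻¹).1.1 = 1 := Units.mul_inv A.1
  rw [this, one_mulVec]

theorem inv_mul_of_fst_eq {x y : GSpExt n p} (h : x.fst = y.fst) : x⁻¹ * y =
    ⟨1, (x.fst⁻¹).1.1 *ᵥ (y.snd - x.snd)⟩ := by
  rw [inv_mul_eq_iff_eq_mul]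
  refine GSpExt.ext (by simp [mul_fst, h]) ?_
  rw [mul_snd, mulVec_inv_mulVec, map_one, Units.val_one, one_smul, sub_add_cancel]

/-- Left cosets with fixed first component `A` are classified by the second component modulo `A
ℤ_p^{2n}`. Both the stabilisation of `θ^m` and the fibre count use this criterion. -/
theorem mk_eq_mk_iff_of_fst_eq {x y : GSpExt n p} (h : x.fst = y.fst) :
    (x : GSpExt n p ⧸ Gamma n p) = y ↔
      ∀ i, ‖((x.fst⁻¹).1.1 *ᵥ (y.snd - x.snd)) i‖ ≤ 1 := by
  rw [QuotientGroup.eq, inv_mul_of_fst_eq h]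
  exact ⟨fun h => h.2, fun h => ⟨(GSp.Gamma n p).one_mem, h⟩⟩

/-- The lifting condition for both `incl` and `scale`: an element `(X, x)` of `Γ̃` is lifted to `(X,
0)`. The discrepancy `(1, X⁻¹ x)`, conjugated by `g = (A, a)`, becomes `(1, μ(A) A⁻¹ X⁻¹ x)`, which
is integral. -/
theorem inv_mul_incl_inv_mul_mul_mem {g h : GSpExt n p} (hg : g.fst ∈ GSp.Delta n p)
    (hh : h ∈ Gamma n p) : g⁻¹ * (incl h.fst)⁻¹ * h * g ∈ Gamma n p := by
  have e : g⁻¹ * (incl h.fst)⁻¹ * h * g = g⁻¹ * ((incl h.fst)⁻¹ * h * g) := by group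
  have e' : (incl h.fst)⁻¹ * h = ⟨1, (h.fst⁻¹).1.1 *ᵥ h.snd⟩ := by
    rw [inv_mul_of_fst_eq (x := incl h.fst) (y := h) rfl]
    simp [incl]
  rw [e, e', inv_mul_of_fst_eq (by simp [mul_fst])]
  refine ⟨(GSp.Gamma n p).one_mem, ?_⟩
  simp only [mul_snd, map_one, Units.val_one, Subgroup.coe_one, one_mulVec, add_sub_cancel_left,
    mulVec_smul]
  exact norm_multiplier_smul_inv_mulVec hg (norm_mulVec_le_one hh.1.2 hh.2)

theorem isHeckeHom_incl : IsHeckeHom (GSp.Delta n p) (GSp.Gamma n p) (Delta n p) (Gamma n p)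
    incl where
  map_subgroup _ hx := incl_mem_Gamma hx
  map_submonoid _ hA := incl_mem_Delta hA
  exists_lift _ hA h hh := ⟨h.fst, hh.1, inv_mul_incl_inv_mul_mul_mem hA hh⟩

theorem isHeckeHom_proj : IsHeckeHom (Delta n p) (Gamma n p) (GSp.Delta n p) (GSp.Gamma n p)
    proj where
  map_subgroup _ hx := hx.1
  map_submonoid _ hx := hx.1
  exists_lift g _ h hh := ⟨incl h, incl_mem_Gamma hh, by
    have : proj (incl h) = h := rfl
    simp [this]⟩

theorem isHeckeHom_scale {c : ℚ_[p]} (hc : ‖c‖ ≤ 1) :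
    IsHeckeHom (Delta n p) (Gamma n p) (Delta n p) (Gamma n p) (scale c) where
  map_subgroup x hx := ⟨hx.1, fun i => (PadicInt.subring p).mul_mem hc (hx.2 i)⟩
  map_submonoid x hx := ⟨hx.1, fun i => (PadicInt.subring p).mul_mem hc (hx.2 i)⟩
  exists_lift g hg h hh := ⟨incl h.fst, incl_mem_Gamma hh.1, by
    rw [scale_incl]
    exact inv_mul_incl_inv_mul_mul_mem (g := scale c g) hg.1 hh⟩

theorem norm_natCast_le_one : ‖(p : ℚ_[p])‖ ≤ 1 := Padic.norm_p_lt_one.le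

theorem norm_pow_le_one (m : ℕ) : ‖(p : ℚ_[p]) ^ m‖ ≤ 1 :=
  (PadicInt.subring p).pow_mem norm_natCast_le_one m

/-- The ring homomorphism `s : R_n → R̃`. -/
noncomputable def sHom : GSp.R n p →+* R n p := HeckeRing.map isHeckeHom_incl

/-- The endomorphism `θ` of `R̃`. -/
noncomputable def thetaHom : R n p →+* R n p :=
  HeckeRing.map (isHeckeHom_scale norm_natCast_le_one)

/-- The ring homomorphism `φ : R̃ → R_n`. -/
noncomputable def phiHom : R n p →+* GSp.R n p := HeckeRing.map isHeckeHom_proj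

theorem phiHom_sHom (f : GSp.R n p) : phiHom (sHom f) = f := by
  rw [phiHom, sHom, HeckeRing.map_map]
  exact map_eq_self _ (fun _ => rfl) f

theorem phiHom_thetaHom (f : R n p) : phiHom (thetaHom f) = phiHom f := by
  rw [phiHom, thetaHom, HeckeRing.map_map]
  exact map_congr _ _ f fun _ _ => rfl

theorem iterate_thetaHom (m : ℕ) (f : R n p) :
    thetaHom^[m] f = HeckeRing.map (isHeckeHom_scale (norm_pow_le_one m)) f := by
  induction m with
  | zero =>
    refine (map_eq_self _ (fun x => ?_) f).symm
    exact GSpExt.ext rfl (by simp [scale])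
  | succ m ih =>
    rw [Function.iterate_succ_apply', ih, thetaHom, HeckeRing.map_map]
    refine map_congr _ _ f fun x _ => ?_
    rw [MonoidHom.comp_apply, scale_scale, pow_succ']

theorem valuation_multiplier_fst_eq_of_mk_eq {x y : Delta n p}
    (h : HeckeCoset.mk (Gamma n p) (Gamma n p) x = HeckeCoset.mk _ _ y) :
    (multiplier (x : GSpExt n p).fst : ℚ_[p]).valuation =
      (multiplier (y : GSpExt n p).fst : ℚ_[p]).valuation := by
  obtain ⟨X, hX, Y, hY, e⟩ := mk_eq_mk.1 h
  rw [e, mul_fst, mul_fst, valuation_multiplier_mul, valuation_multiplier_mul,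
    valuation_multiplier_of_mem_Gamma hX.1, valuation_multiplier_of_mem_Gamma hY.1, zero_add,
    add_zero]

theorem valuation_multiplier_of_toCosets_ne_zero {ξ : Delta n p} {x : GSpExt n p}
    (h : toCosets (T ξ : R n p) (x : GSpExt n p ⧸ Gamma n p) ≠ 0) :
    x ∈ Delta n p ∧ (multiplier x.fst : ℚ_[p]).valuation =
      (multiplier (ξ : GSpExt n p).fst : ℚ_[p]).valuation := by
  classical
  have hx : x ∈ Delta n p := mk_mem_cosetsIn.1 (mem_cosetsIn_of_toCosets_ne_zero h)
  refine ⟨hx, ?_⟩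
  rw [T, toCosets_ofCoset _ hx] at h
  have e : HeckeCoset.mk (Gamma n p) (Gamma n p) ⟨x, hx⟩ = HeckeCoset.mk _ _ ξ := by simpa using h
  exact valuation_multiplier_fst_eq_of_mk_eq (x := ⟨x, hx⟩) (y := ξ) e

/-- On a left coset of `(A, a)`, `θ^m` and `s ∘ φ` give the cosets of `(A, p^m a)` and `(A, 0)`.
These agree once `p^m A⁻¹` is integral. The bound is uniform because the valuation of the multiplier
is constant on a double coset. -/
theorem iterate_thetaHom_T (ξ : Delta n p) : ∃ N : ℕ, ∀ m ≥ N,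
    thetaHom^[m] (T ξ) = sHom (phiHom (T ξ)) := by
  -- The threshold is `N = v_p(μ(A))` for `ξ = (A, a)`.
  obtain ⟨N, hN⟩ := Int.eq_ofNat_of_zero_le (valuation_nonneg ⟨_, ξ.2.1⟩)
  refine ⟨N, fun m hm => ?_⟩
  rw [iterate_thetaHom, sHom, phiHom, HeckeRing.map_map]
  refine map_congr _ _ _ fun x hx => Eq.symm <|
    (mk_eq_mk_iff_of_fst_eq (x := incl.comp proj x) (y := scale ((p : ℚ_[p]) ^ m) x) rfl).2 ?_
  obtain ⟨hxΔ, hv⟩ := valuation_multiplier_of_toCosets_ne_zero hx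
  obtain ⟨d, rfl⟩ := Nat.exists_eq_add_of_le' hm
  have e : ((scale ((p : ℚ_[p]) ^ (d + N)) x).snd - (incl.comp proj x).snd) =
      (p : ℚ_[p]) ^ (d + N) • x.snd := by simp [scale, incl]
  rw [e, mulVec_smul, ← smul_mulVec]
  refine norm_mulVec_le_one (fun i j => ?_) hxΔ.2
  rw [Matrix.smul_apply, smul_eq_mul, pow_add, mul_assoc]
  exact norm_pow_mul_apply d (norm_pow_mul_inv_apply hxΔ.1 (hv.trans hN) i j)

theorem sHom_T (A : GSp.Delta n p) : sHom (T A) = T (ofDelta A) :=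
  map_T_of_leftInverse isHeckeHom_incl isHeckeHom_proj (fun _ => rfl) A

theorem multiplier_scalar (c : ℚ_[p]ˣ) : multiplier (GSp.scalar c : GSp n ℚ_[p]) = c * c := by
  refine multiplier_unique (multiplier_spec (GSp.scalar c)) ?_
  ext i j
  simp [GSp.scalar, GeneralLinearGroup.scalar, Matrix.scalar_apply, Matrix.mul_apply,
    Matrix.diagonal_apply]
  ring

/-- The matrix `pE` is central with multiplier `p²`, so for `x = (A, a)` both `x · (pE, 0)` and
`(pE, 0) · (A, p a)` equal `(pA, p² a)`. -/
theorem C₀_conj (x : GSpExt n p) : (C₀ n p : GSpExt n p)⁻¹ * x * (C₀ n p : GSpExt n p) =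
    scale (p : ℚ_[p]) x := by
  have hp : (p : ℚ_[p]) ≠ 0 := by exact_mod_cast (Fact.out : p.Prime).ne_zero
  have e : (C₀ n p : GSpExt n p) = incl (GSp.scalar (Units.mk0 (p : ℚ_[p]) hp)) := rfl
  have hs : (GSp.scalar (Units.mk0 (p : ℚ_[p]) hp) : GSp n ℚ_[p]).1.1 =
    Matrix.scalar _ (p : ℚ_[p]) := rfl
  rw [mul_assoc, inv_mul_eq_iff_eq_mul, e]
  refine GSpExt.ext (Subtype.ext (Units.ext ?_)) ?_
  · change x.fst.1.1 * Matrix.scalar _ (p : ℚ_[p]) = Matrix.scalar _ (p : ℚ_[p]) * x.fst.1.1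
    exact ((Matrix.scalar_commute _ (fun r => Commute.all _ r) _).eq).symm
  · simp only [mul_snd, incl, scale, MonoidHom.coe_mk, OneHom.coe_mk, multiplier_scalar, hs]
    ext i
    simp only [mulVec_zero, smul_zero, zero_add, add_zero, Pi.add_apply, Pi.smul_apply, Pi.zero_apply,
      Matrix.scalar_apply, mulVec_diagonal, Units.val_mul, Units.val_mk0, smul_eq_mul, mul_assoc]

theorem toCosets_T_C₀ : toCosets (T (C₀ n p) : R n p) =
    Finsupp.single ((C₀ n p : GSpExt n p) : GSpExt n p ⧸ Gamma n p) 1 := by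
  refine toCosets_T_eq_single fun h hh => ?_
  rw [C₀_conj]
  exact (isHeckeHom_scale norm_natCast_le_one).map_subgroup hh

/-- Left multiplication by a single left coset is translation of functions on `G ⧸ H`, which is
injective. -/
theorem eq_zero_of_T_C₀_mul_eq_zero {x : R n p} (h : T (C₀ n p) * x = 0) : x = 0 := by
  refine toCosets_injective ?_
  have h' := congrArg toCosets h
  rw [toCosets_mul_of_single toCosets_T_C₀, map_zero] at h'
  ext y
  have := DFunLike.congr_fun h' ((C₀ n p : GSpExt n p) • y)
  rw [shift_apply, inv_smul_smul] at this
  rw [this, map_zero]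
  rfl

/-- Right multiplication by `T (C₀ n p)` sends the left coset of `y` to that of `y C₀ = C₀ (C₀⁻¹ y
C₀)`, and the conjugate is the image of `y` under the map defining `θ`. -/
theorem mul_T_C₀ (f : R n p) : f * T (C₀ n p) = T (C₀ n p) * thetaHom f := by
  refine toCosets_injective ?_
  rw [toCosets_mul_of_single toCosets_T_C₀, toCosets_mul, toCosets_T_C₀, thetaHom, toCosets_map]
  conv_rhs => rw [← Finsupp.sum_single (toCosets f), Finsupp.mapDomain_sum, Finsupp.sum, map_sum]
  refine Finset.sum_congr rfl fun y _ => ?_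
  beta_reduce
  rw [shift_single, Finsupp.smul_single, smul_eq_mul, mul_one, Finsupp.mapDomain_single]
  conv_rhs => rw [← QuotientGroup.out_eq' y, cosetMap_mk, shift_single, ← C₀_conj]
  rw [QuotientGroup.out_eq']
  congr 2
  group

end GSpExt

/-! ### Fibres of the projection and the values of `φ` -/

namespace GSpExt

open Matrix GSp HeckeRing

variable {n : ℕ} [NeZero n] {p : ℕ} [Fact p.Prime]

/-- The left cosets of `Γ̃` in `Δ̃` that lie over the left coset `C Γ`. -/
def fiber (C : GSp n ℚ_[p]) : Set (GSpExt n p ⧸ Gamma n p) :=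
  {y | y ∈ cosetsIn (Delta n p) (Gamma n p) ∧
    cosetMap isHeckeHom_proj y = (C : GSp n ℚ_[p] ⧸ GSp.Gamma n p)}

/-- Every left coset over `C Γ` has a representative `(C, b)` with `b` integral, unique modulo `C
ℤ_p^{2n}`. The index of that sublattice is `p^{v(det C)}`, and `v(det C) = n v(μ(C))`. -/
theorem ncard_fiber {C : GSp n ℚ_[p]} (hC : C ∈ GSp.Delta n p) :
    (fiber C).ncard = p ^ (n * (multiplier C : ℚ_[p]).valuation.toNat) := by
  let Λ := (PadicLattice.std p (Fin n ⊕ Fin n)).toAddSubgroup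
  let ΛC := Λ.map C.1.1.mulVecLin.toAddMonoidHom
  have hcard : ΛC.relIndex Λ = p ^ (n * (multiplier C : ℚ_[p]).valuation.toNat) := by
    rw [PadicLattice.relIndex_map_mulVec hC C.1.det_ne_zero, valuation_det]
    congr 1
    have := valuation_nonneg ⟨C, hC⟩
    zify
    rw [Int.toNat_of_nonneg this, Int.toNat_of_nonneg (by positivity)]
  rw [← hcard, ← Nat.card_coe_set_eq]
  have hq : ∀ b b' : Λ, ((⟨C, b⟩ : GSpExt n p) : GSpExt n p ⧸ Gamma n p) = (⟨C, b'⟩ : GSpExt n p) ↔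
      (QuotientAddGroup.mk b : Λ ⧸ ΛC.addSubgroupOf Λ) = QuotientAddGroup.mk b' := by
    intro b b'
    rw [mk_eq_mk_iff_of_fst_eq (x := ⟨C, b⟩) (y := ⟨C, b'⟩) rfl, QuotientAddGroup.eq, AddSubgroup.mem_addSubgroupOf]
    constructor
    · intro h
      refine ⟨_, h, ?_⟩
      refine (mulVec_inv_mulVec C _).trans ?_
      simp [sub_eq_neg_add]
    · rintro ⟨w, hw, e⟩
      have e' : (b' : Fin n ⊕ Fin n → ℚ_[p]) - b = C.1.1 *ᵥ w := by
        rw [sub_eq_neg_add]; exact e.symm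
      have h1 : (C⁻¹).1.1 * C.1.1 = 1 := Units.inv_mul C.1
      simp only [e', mulVec_mulVec, h1, one_mulVec]
      exact hw
  symm
  refine Nat.card_congr (Equiv.ofBijective (Quotient.lift
    (fun b : Λ => (⟨((⟨C, b⟩ : GSpExt n p) : GSpExt n p ⧸ Gamma n p),
      ⟨⟨C, b⟩, ⟨hC, b.2⟩, rfl⟩, rfl⟩ : fiber C))
    fun b b' h => Subtype.ext ((hq b b').2 (Quotient.sound h))) ⟨?_, ?_⟩)
  · rintro ⟨b⟩ ⟨b'⟩ h
    exact (hq b b').1 (congrArg Subtype.val h)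
  · rintro ⟨_, ⟨x, hx, rfl⟩, hxC⟩
    -- Right multiplication by `(x.fst⁻¹ C, 0) ∈ Γ̃` keeps the left coset of `x` and makes its first
    -- component exactly `C`.
    have hX : x.fst⁻¹ * C ∈ GSp.Gamma n p := QuotientGroup.eq.1 hxC
    have hx' : x * incl (x.fst⁻¹ * C) ∈ Delta n p :=
      (Delta n p).mul_mem hx (incl_mem_Delta hX.1)
    refine ⟨QuotientAddGroup.mk ⟨(x * incl (x.fst⁻¹ * C)).snd, hx'.2⟩, Subtype.ext ?_⟩
    have e : (⟨C, (x * incl (x.fst⁻¹ * C)).snd⟩ : GSpExt n p) = x * incl (x.fst⁻¹ * C) :=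
      GSpExt.ext (mul_inv_cancel_left x.fst C).symm rfl
    change ((⟨C, (x * incl (x.fst⁻¹ * C)).snd⟩ : GSpExt n p) : GSpExt n p ⧸ Gamma n p) = x
    rw [e, eq_comm, QuotientGroup.eq, inv_mul_cancel_left]
    exact incl_mem_Gamma hX

/-- The image under `φ` of an element with values pulled back from `Δ`. -/
theorem toCosets_phiHom {f : R n p} {g : GSp.R n p}
    (h : ∀ x ∈ Delta n p, toCosets f (x : GSpExt n p ⧸ Gamma n p) =
      toCosets g (x.fst : GSp n ℚ_[p] ⧸ GSp.Gamma n p))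
    {C : GSp n ℚ_[p]} (hC : C ∈ GSp.Delta n p) :
    toCosets (phiHom f) (C : GSp n ℚ_[p] ⧸ GSp.Gamma n p) =
      p ^ (n * (multiplier C : ℚ_[p]).valuation.toNat) *
        toCosets g (C : GSp n ℚ_[p] ⧸ GSp.Gamma n p) := by
  classical
  have hval : ∀ y ∈ fiber C, toCosets f y = toCosets g (C : GSp n ℚ_[p] ⧸ GSp.Gamma n p) := by
    rintro _ ⟨⟨x, hx, rfl⟩, hy⟩
    rw [h x hx, ← hy]
    rfl
  have hsum : toCosets (phiHom f) (C : GSp n ℚ_[p] ⧸ GSp.Gamma n p) =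
      ∑ y ∈ (toCosets f).support with
        cosetMap isHeckeHom_proj y = (C : GSp n ℚ_[p] ⧸ GSp.Gamma n p), toCosets f y := by
    rw [phiHom, toCosets_map, Finsupp.mapDomain, Finsupp.sum_apply, Finsupp.sum, Finset.sum_filter]
    exact Finset.sum_congr rfl fun y _ => Finsupp.single_apply
  have hsub : ((Finset.filter (fun y => cosetMap isHeckeHom_proj y =
      (C : GSp n ℚ_[p] ⧸ GSp.Gamma n p)) (toCosets f).support : Finset _) : Set _) ⊆ fiber C := by
    intro y hy
    obtain ⟨hy₁, hy₂⟩ := Finset.mem_filter.1 (Finset.mem_coe.1 hy)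
    exact ⟨mem_cosetsIn_of_toCosets_ne_zero (Finsupp.mem_support_iff.1 hy₁), hy₂⟩
  rw [hsum, Finset.sum_congr rfl fun y hy => hval y (hsub hy), Finset.sum_const, nsmul_eq_mul]
  -- The support of `f` over `C` is the whole fibre only when the common value on the fibre is
  -- nonzero; otherwise both sides are zero.
  by_cases hg : toCosets g (C : GSp n ℚ_[p] ⧸ GSp.Gamma n p) = 0
  · rw [hg, mul_zero, mul_zero]
  · rw [← Set.ncard_coe_finset, Set.Subset.antisymm hsub, ncard_fiber hC, Nat.cast_pow]
    intro y hy
    refine Finset.mem_coe.2 (Finset.mem_filter.2 ⟨Finsupp.mem_support_iff.2 ?_, hy.2⟩)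
    rwa [hval y hy]

/-- The fibre size depends on `C` only through the valuation of its multiplier. When this is
constant on the support of `g`, the weight becomes a global scalar. -/
theorem phiHom_eq_smul {f : R n p} {g : GSp.R n p} {k : ℕ}
    (h : ∀ x ∈ Delta n p, toCosets f (x : GSpExt n p ⧸ Gamma n p) =
      toCosets g (x.fst : GSp n ℚ_[p] ⧸ GSp.Gamma n p))
    (hg : ∀ C ∈ GSp.Delta n p, toCosets g (C : GSp n ℚ_[p] ⧸ GSp.Gamma n p) ≠ 0 →
      (multiplier C : ℚ_[p]).valuation.toNat = k) :
    phiHom f = p ^ (n * k) • g := by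
  refine toCosets_injective ?_
  rw [map_nsmul]
  ext y
  rw [Finsupp.smul_apply, nsmul_eq_mul]
  induction y using QuotientGroup.induction_on with
  | H C =>
    by_cases hC : C ∈ GSp.Delta n p
    · rw [toCosets_phiHom h hC]
      by_cases hgC : toCosets g (C : GSp n ℚ_[p] ⧸ GSp.Gamma n p) = 0
      · rw [hgC, mul_zero, mul_zero]
      · rw [hg C hC hgC]; push_cast; rfl
    · have h0 : ∀ r : GSp.R n p, toCosets r (C : GSp n ℚ_[p] ⧸ GSp.Gamma n p) = 0 := fun r => by
        by_contra hr
        exact hC (mk_mem_cosetsIn.1 (mem_cosetsIn_of_toCosets_ne_zero hr))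
      rw [h0, h0, mul_zero]

/-- This identifies `T̃(A)` with the pullback of the indicator function of `Γ A Γ`: if `X x.fst Y =
A` with `X, Y ∈ Γ`, then `(X, 0) x (Y, 0)` is a pair over `A` in the same double coset as `x`. -/
theorem mk_mem_cosetsOver {A : GSp.Delta n p} {x : GSpExt n p} (hx : x ∈ Delta n p) :
    HeckeCoset.mk _ _ (⟨x, hx⟩ : Delta n p) ∈ cosetsOver A ↔
      HeckeCoset.mk (GSp.Gamma n p) (GSp.Gamma n p) (⟨x.fst, hx.1⟩ : GSp.Delta n p) =
        HeckeCoset.mk _ _ A := by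
  constructor
  · rintro ⟨y, hy, e⟩
    have := mk_eq_mk_of_map isHeckeHom_proj e
    refine this.trans ?_
    congr 1
    exact Subtype.ext hy
  · intro e
    obtain ⟨X, hX, Y, hY, e⟩ := mk_eq_mk.1 e
    have h : incl X * x * incl Y ∈ Delta n p := (Delta n p).mul_mem
      ((Delta n p).mul_mem (incl_mem_Delta hX.1) hx) (incl_mem_Delta hY.1)
    exact ⟨⟨_, h⟩, e.symm, mk_eq_mk.2 ⟨_, incl_mem_Gamma hX, _, incl_mem_Gamma hY, rfl⟩⟩

theorem mk_mem_cosetsOfVal {k : ℕ} (x : Delta n p) : HeckeCoset.mk _ _ x ∈ cosetsOfVal n p k ↔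
    (multiplier (x : GSpExt n p).fst : ℚ_[p]).valuation = k := by
  constructor
  · rintro ⟨y, e, hy⟩
    rw [valuation_multiplier_fst_eq_of_mk_eq e, hy]
  · exact fun h => ⟨x, rfl, h⟩

theorem phiHom_TFiber (A : GSp.Delta n p) : phiHom (TFiber A) =
    p ^ (n * (multiplier (A : GSp n ℚ_[p]) : ℚ_[p]).valuation.toNat) • T A := by
  classical
  refine phiHom_eq_smul (fun x hx => ?_) fun C hC h => ?_
  · rw [TFiber, toCosets_sumCosets _ hx, T, toCosets_ofCoset _ hx.1]
    exact if_congr (mk_mem_cosetsOver hx) rfl rfl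
  · rw [T, toCosets_ofCoset _ hC] at h
    have e : HeckeCoset.mk (GSp.Gamma n p) (GSp.Gamma n p) ⟨C, hC⟩ = HeckeCoset.mk _ _ A := by simpa using h
    rw [GSp.valuation_multiplier_eq_of_mk_eq e]

theorem phiHom_Tpow (k : ℕ) : phiHom (Tpow n p k) = p ^ (n * k) • GSp.Tpow n p k := by
  classical
  refine phiHom_eq_smul (fun x hx => ?_) fun C hC h => ?_
  · rw [Tpow, toCosets_sumCosets _ hx, GSp.Tpow, toCosets_sumCosets _ hx.1]
    exact if_congr ((mk_mem_cosetsOfVal _).trans (GSp.mk_mem_cosetsOfVal ⟨x.fst, hx.1⟩).symm)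
      rfl rfl
  · rw [GSp.Tpow, toCosets_sumCosets _ hC] at h
    have e : HeckeCoset.mk _ _ ⟨C, hC⟩ ∈ GSp.cosetsOfVal n p k := by simpa using h
    rw [(GSp.mk_mem_cosetsOfVal _).1 e, Int.toNat_natCast]

theorem map_phiHom_heckeSeries : PowerSeries.map phiHom (heckeSeries n p) =
    (GSp.heckeSeries n p).substMonomial (p ^ n) 1 := by
  ext1 j
  rw [PowerSeries.coeff_map, heckeSeries, PowerSeries.coeff_mk, phiHom_Tpow,
    PowerSeries.substMonomial, PowerSeries.coeff_mk, if_pos (one_dvd j), Nat.div_one,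
    GSp.heckeSeries, PowerSeries.coeff_mk, ← natCast_zsmul, pow_mul]
  push_cast
  rfl

end GSpExt

/-! ### Automorphisms of the Heisenberg algebra as pairs `(A, a)` -/

namespace Heisenberg

open Matrix
open scoped TensorProduct

section Coordinates

variable {n : ℕ} {p : ℕ} [Fact p.Prime]

variable (n p) in
/-- The standard coordinates on `𝓗 ⊗ ℚ_p`. -/
noncomputable def padicCoords :
    (ℚ_[p] ⊗[ℤ] algebra n) ≃ₗ[ℚ_[p]] ((Fin n ⊕ Fin n) ⊕ Unit → ℚ_[p]) :=
  ((basis n).baseChange ℚ_[p]).equivFun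

theorem padicCoords_tmul (r : ℚ_[p]) (l : algebra n) (i : (Fin n ⊕ Fin n) ⊕ Unit) :
    padicCoords n p (r ⊗ₜ[ℤ] l) i = r * (coords n l i : ℚ_[p]) := by
  rw [padicCoords, Module.Basis.equivFun_apply, Module.Basis.baseChange_repr_tmul]
  rw [zsmul_eq_mul, mul_comm]
  rfl

theorem coords_lie (l m : algebra n) : coords n ⁅l, m⁆ = Pi.single (Sum.inr ())
    (∑ i, (coords n l (Sum.inl (Sum.inl i)) * coords n m (Sum.inl (Sum.inr i)) -
      coords n m (Sum.inl (Sum.inl i)) * coords n l (Sum.inl (Sum.inr i)))) := by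
  rw [← LinearEquiv.eq_symm_apply]
  refine Subtype.ext ?_
  obtain ⟨f, rfl⟩ := (coords n).symm.surjective l
  obtain ⟨g, rfl⟩ := (coords n).symm.surjective m
  simp only [LinearEquiv.apply_symm_apply]
  change ⁅matrix n f, matrix n g⁆ = matrix n _
  rw [Ring.lie_def]
  ext (_ | _ | _) (_ | _ | _) <;> simp [matrix, Matrix.mul_apply]

/-- The bracket takes values in the centre and is the standard symplectic form. The sign arises
because `J` has `-1` in its upper right block, whereas the bracket is `a b' - a' b`. -/
theorem padicCoords_lie (v w : ℚ_[p] ⊗[ℤ] algebra n) :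
    padicCoords n p ⁅v, w⁆ = Pi.single (Sum.inr ())
      (-((padicCoords n p v ∘ Sum.inl) ⬝ᵥ J (Fin n) ℚ_[p] *ᵥ (padicCoords n p w ∘ Sum.inl))) := by
  have hadd : ∀ x y : (Fin n ⊕ Fin n) ⊕ Unit → ℚ_[p], (x + y) ∘ Sum.inl =
    x ∘ Sum.inl + y ∘ Sum.inl := fun _ _ => rfl
  have hzero : (0 : (Fin n ⊕ Fin n) ⊕ Unit → ℚ_[p]) ∘ Sum.inl = 0 := rfl
  have hlie_add : ∀ v x y : ℚ_[p] ⊗[ℤ] algebra n, ⁅v, x + y⁆ = ⁅v, x⁆ + ⁅v, y⁆ :=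
    fun v x y =>
      lie_add (L := ℚ_[p] ⊗[ℤ] algebra n) (M := ℚ_[p] ⊗[ℤ] algebra n) v x y
  have hlie_zero : ∀ v : ℚ_[p] ⊗[ℤ] algebra n, ⁅v, (0 : ℚ_[p] ⊗[ℤ] algebra n)⁆ = 0 :=
    fun v =>
      lie_zero (L := ℚ_[p] ⊗[ℤ] algebra n) (M := ℚ_[p] ⊗[ℤ] algebra n) v
  induction v using TensorProduct.induction_on with
  | zero =>
    rw [zero_lie, map_zero, hzero, zero_dotProduct, neg_zero, Pi.single_zero]
  | add x y hx hy =>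
    rw [add_lie, map_add, hx, hy, map_add, hadd, add_dotProduct, neg_add, Pi.single_add]
  | tmul r l =>
    induction w using TensorProduct.induction_on with
    | zero =>
      rw [hlie_zero, map_zero, hzero, mulVec_zero, dotProduct_zero, neg_zero, Pi.single_zero]
    | add x y hx hy =>
      rw [hlie_add, map_add, hx, hy, map_add, hadd, mulVec_add, dotProduct_add, neg_add,
        Pi.single_add]
    | tmul q m =>
      rw [LieAlgebra.ExtendScalars.bracket_tmul]
      ext (i | i)
      · rw [padicCoords_tmul, coords_lie]
        simp
      · rw [padicCoords_tmul, coords_lie, Pi.single_eq_same, Pi.single_eq_same, Int.cast_sum,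
          Finset.mul_sum, J, fromBlocks_mulVec]
        simp only [dotProduct, Fintype.sum_sum_type, Function.comp_apply, Sum.elim_inl,
          Sum.elim_inr, zero_mulVec, neg_mulVec, one_mulVec, Pi.add_apply, Pi.neg_apply,
          Pi.zero_apply, zero_add, add_zero, padicCoords_tmul]
        rw [← Finset.sum_add_distrib, ← Finset.sum_neg_distrib]
        refine Finset.sum_congr rfl fun j _ => ?_
        push_cast
        ring

theorem mem_lattice {v : ℚ_[p] ⊗[ℤ] algebra n} : v ∈ LocalHecke.lattice p (algebra n) ↔
    padicCoords n p v ∈ PadicLattice.std p ((Fin n ⊕ Fin n) ⊕ Unit) := by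
  constructor
  · intro hv
    induction hv using Submodule.span_induction with
    | mem x hx =>
      obtain ⟨l, rfl⟩ := hx
      intro i
      rw [padicCoords_tmul, one_mul]
      exact Padic.norm_int_le_one _
    | zero => rw [map_zero]; exact Submodule.zero_mem _
    | add x y _ _ hx hy => rw [map_add]; exact Submodule.add_mem _ hx hy
    | smul a x _ hx =>
      have : padicCoords n p (a • x) = a • padicCoords n p x :=
        LinearMap.map_smul_of_tower (padicCoords n p).toLinearMap a x
      rw [this]
      exact Submodule.smul_mem _ _ hx
  · intro hv
    rw [← ((basis n).baseChange ℚ_[p]).sum_equivFun v]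
    refine Submodule.sum_mem _ fun i _ => ?_
    let a : ℤ_[p] := ⟨padicCoords n p v i, hv i⟩
    have e : ((basis n).baseChange ℚ_[p]).equivFun v i • (basis n).baseChange ℚ_[p] i =
        a • ((1 : ℚ_[p]) ⊗ₜ[ℤ] basis n i) := by
      rw [Module.Basis.baseChange_apply, TensorProduct.smul_tmul', TensorProduct.smul_tmul']
      congr 1
    rw [e]
    exact Submodule.smul_mem _ _ (Submodule.subset_span ⟨_, rfl⟩)

theorem padicCoords_act (α : LocalHecke.G p (algebra n)) (v : ℚ_[p] ⊗[ℤ] algebra n) :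
    padicCoords n p (LocalHecke.act α v) = padicCoords n p v ᵥ* rowMatrix α := by
  rw [rowMatrix, vecMul_transpose]
  exact (LinearMap.toMatrix_mulVec_repr ((basis n).baseChange ℚ_[p])
    ((basis n).baseChange ℚ_[p]) (LocalHecke.act α).toLinearMap v).symm

theorem rowMatrix_eq {α : LocalHecke.G p (algebra n)}
    {M : Matrix ((Fin n ⊕ Fin n) ⊕ Unit) ((Fin n ⊕ Fin n) ⊕ Unit) ℚ_[p]}
    (h : ∀ v, padicCoords n p (LocalHecke.act α v) = padicCoords n p v ᵥ* M) : rowMatrix α = M := by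
  ext i j
  have := h ((padicCoords n p).symm (Pi.single i 1))
  rw [padicCoords_act, LinearEquiv.apply_symm_apply] at this
  simpa using congrFun this j

theorem rowMatrix_injective :
    Function.Injective (rowMatrix : LocalHecke.G p (algebra n) → _) := by
  intro α β h
  refine MulOpposite.unop_injective (Subtype.ext (LinearEquiv.ext fun v => ?_))
  refine (padicCoords n p).injective ?_
  exact (padicCoords_act α v).trans ((congrArg _ h).trans (padicCoords_act β v).symm)

end Coordinates

variable {n : ℕ} [NeZero n] {p : ℕ} [Fact p.Prime]

theorem vecMul_toMatrix_inl (x : GSpExt n p) (f : (Fin n ⊕ Fin n) ⊕ Unit → ℚ_[p]) :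
    (f ᵥ* GSpExt.toMatrix x) ∘ Sum.inl = (f ∘ Sum.inl) ᵥ* x.fst.1.1 := by
  rw [GSpExt.toMatrix, vecMul_fromBlocks]
  ext i
  simp

/-- The action of `(A, a)` on `𝓗 ⊗ ℚ_p`. -/
noncomputable def toLinearEquiv (x : GSpExt n p) :
    (ℚ_[p] ⊗[ℤ] algebra n) ≃ₗ[ℚ_[p]] (ℚ_[p] ⊗[ℤ] algebra n) :=
  LinearEquiv.ofLinearMap
    ((padicCoords n p).symm.toLinearMap ∘ₗ (GSpExt.toMatrix x).vecMulLinear ∘ₗ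
      (padicCoords n p).toLinearMap)
    ((padicCoords n p).symm.toLinearMap ∘ₗ (GSpExt.toMatrix x⁻¹).vecMulLinear ∘ₗ
      (padicCoords n p).toLinearMap)
    (by
      refine LinearMap.ext fun v => ?_
      simp [vecMul_vecMul, ← GSpExt.toMatrix_mul, GSpExt.toMatrix_one])
    (by
      refine LinearMap.ext fun v => ?_
      simp [vecMul_vecMul, ← GSpExt.toMatrix_mul, GSpExt.toMatrix_one])

theorem padicCoords_toLinearEquiv (x : GSpExt n p) (v : ℚ_[p] ⊗[ℤ] algebra n) :
    padicCoords n p (toLinearEquiv x v) = padicCoords n p v ᵥ* GSpExt.toMatrix x :=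
  (padicCoords n p).apply_symm_apply _

theorem dotProduct_J_vecMul (A : GSp n ℚ_[p]) (u w : Fin n ⊕ Fin n → ℚ_[p]) :
    (u ᵥ* A.1.1) ⬝ᵥ J (Fin n) ℚ_[p] *ᵥ (w ᵥ* A.1.1) =
      (GSp.multiplier A : ℚ_[p]) * (u ⬝ᵥ J (Fin n) ℚ_[p] *ᵥ w) := by
  rw [← mulVec_transpose A.1.1 w, ← dotProduct_mulVec, mulVec_mulVec, mulVec_mulVec,
    GSp.multiplier_spec, smul_mulVec, dotProduct_smul, smul_eq_mul]

/-- The component `a` changes only central coordinates, which brackets ignore. The component `A`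
multiplies the symplectic form by `μ(A)`, which is also the factor by which the centre is scaled. -/
theorem toLinearEquiv_mem_lieAut (x : GSpExt n p) :
    toLinearEquiv x ∈ LocalHecke.lieAut p (algebra n) := by
  intro v w
  refine (padicCoords n p).injective ?_
  rw [padicCoords_toLinearEquiv, padicCoords_lie, padicCoords_lie, padicCoords_toLinearEquiv,
    padicCoords_toLinearEquiv, vecMul_toMatrix_inl, vecMul_toMatrix_inl, dotProduct_J_vecMul,
    GSpExt.toMatrix, vecMul_fromBlocks]
  have h : ∀ c : ℚ_[p], (Pi.single (Sum.inr ()) c : (Fin n ⊕ Fin n) ⊕ Unit → ℚ_[p]) ∘ Sum.inl =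
    0 := fun c => funext fun i => by simp
  rw [h, zero_vecMul, zero_vecMul, zero_add, zero_add]
  generalize (padicCoords n p v ∘ Sum.inl) ⬝ᵥ J (Fin n) ℚ_[p] *ᵥ (padicCoords n p w ∘ Sum.inl) = t
  ext (i | i)
  · simp
  · simp [vecMul, dotProduct, mul_comm]

/-- The homomorphism from the group of pairs `(A, a)` to the automorphisms of `𝓗 ⊗ ℚ_p`. -/
noncomputable def toAut : GSpExt n p →* LocalHecke.G p (algebra n) where
  toFun x := MulOpposite.op ⟨toLinearEquiv x, toLinearEquiv_mem_lieAut x⟩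
  map_one' := by
    refine MulOpposite.unop_injective (Subtype.ext (LinearEquiv.ext fun v => ?_))
    refine (padicCoords n p).injective ((padicCoords_toLinearEquiv 1 v).trans ?_)
    rw [GSpExt.toMatrix_one, vecMul_one]
    rfl
  -- On row vectors the matrix of `x * y` acts as `x` followed by `y`, in agreement with the product
  -- in the opposite group.
  map_mul' x y := by
    refine MulOpposite.unop_injective (Subtype.ext (LinearEquiv.ext fun v => ?_))
    refine (padicCoords n p).injective ((padicCoords_toLinearEquiv (x * y) v).trans ?_)
    rw [GSpExt.toMatrix_mul, ← vecMul_vecMul, ← padicCoords_toLinearEquiv,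
      ← padicCoords_toLinearEquiv]
    rfl

theorem rowMatrix_toAut (x : GSpExt n p) : rowMatrix (toAut x) = GSpExt.toMatrix x :=
  rowMatrix_eq fun v => padicCoords_toLinearEquiv x v

theorem toAut_injective : Function.Injective (toAut : GSpExt n p →* _) := by
  intro x y h
  have h' : GSpExt.toMatrix x = GSpExt.toMatrix y := by
    rw [← rowMatrix_toAut, ← rowMatrix_toAut, h]
  refine GSpExt.ext (Subtype.ext (Units.ext ?_)) ?_
  · ext i j
    exact congrFun (congrFun h' (Sum.inl i)) (Sum.inl j)
  · ext i
    exact congrFun (congrFun h' (Sum.inl i)) (Sum.inr ())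

/-- Brackets are central and the centre is spanned by a bracket, so the matrix of an automorphism is
block upper triangular with some corner entry `μ`. Comparing brackets of the noncentral basis
vectors gives `A J Aᵀ = μ J` for the upper left block, so the pair can be read off the matrix. -/
theorem toAut_surjective : Function.Surjective (toAut : GSpExt n p →* _) := by
  intro α
  set M := rowMatrix α with hM
  have hα : ∀ f, padicCoords n p (LocalHecke.act α ((padicCoords n p).symm f)) = f ᵥ* M := fun f => by
    rw [padicCoords_act, LinearEquiv.apply_symm_apply]
  have hlie : ∀ f g : (Fin n ⊕ Fin n) ⊕ Unit → ℚ_[p],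
      Pi.single (Sum.inr ()) (-((f ∘ Sum.inl) ⬝ᵥ J (Fin n) ℚ_[p] *ᵥ (g ∘ Sum.inl))) ᵥ* M =
      Pi.single (Sum.inr ())
        (-(((f ᵥ* M) ∘ Sum.inl) ⬝ᵥ J (Fin n) ℚ_[p] *ᵥ ((g ᵥ* M) ∘ Sum.inl))) := by
    intro f g
    have := congrArg (padicCoords n p) (α.unop.2 ((padicCoords n p).symm f)
      ((padicCoords n p).symm g))
    have e := padicCoords_act α ⁅(padicCoords n p).symm f, (padicCoords n p).symm g⁆
    rw [padicCoords_lie, LinearEquiv.apply_symm_apply, LinearEquiv.apply_symm_apply] at e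
    rw [← hM] at e
    rw [← e, ← hα, ← hα, ← padicCoords_lie]
    exact this
  have hJ : ∀ i j : Fin n ⊕ Fin n, (Pi.single i 1 : _ → ℚ_[p]) ⬝ᵥ
      J (Fin n) ℚ_[p] *ᵥ Pi.single j 1 = J (Fin n) ℚ_[p] i j := fun i j => by simp
  have hs : ∀ i : Fin n ⊕ Fin n, (Pi.single (Sum.inl i) 1 : (Fin n ⊕ Fin n) ⊕ Unit → ℚ_[p]) ∘
      Sum.inl = Pi.single i 1 := by
    intro i
    ext j
    simp [Pi.single_apply]
  have hrow : ∀ (c : ℚ_[p]) (k : (Fin n ⊕ Fin n) ⊕ Unit),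
      ((Pi.single (Sum.inr ()) c : (Fin n ⊕ Fin n) ⊕ Unit → ℚ_[p]) ᵥ* M) k =
        c * M (Sum.inr ()) k := by
    intro c k
    simp
  -- The central basis vector is the bracket of the first `a`-vector and the first `b`-vector, which
  -- exist since `n ≥ 1`. Its image is again a bracket, hence central.
  have h0 : ∀ j, M (Sum.inr ()) (Sum.inl j) = 0 := by
    intro j
    have := congrFun (hlie (Pi.single (Sum.inl (Sum.inl 0)) 1)
      (Pi.single (Sum.inl (Sum.inr 0)) 1)) (Sum.inl j)
    rw [hrow, hs, hs, hJ] at this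
    simpa [J] using this
  set μ := M (Sum.inr ()) (Sum.inr ()) with hμ
  -- If `μ` were zero, the whole last row of `M` would vanish and the automorphism would kill the
  -- central basis vector.
  have hμ0 : μ ≠ 0 := by
    intro hz
    have h1 := hα (Pi.single (Sum.inr ()) 1)
    have h2 : (Pi.single (Sum.inr ()) 1 : (Fin n ⊕ Fin n) ⊕ Unit → ℚ_[p]) ᵥ* M = 0 := by
      ext (j | j)
      · simp [h0]
      · simp [← hμ, hz]
    rw [h2, LinearEquiv.map_eq_zero_iff, LinearEquiv.map_eq_zero_iff,
      LinearEquiv.map_eq_zero_iff] at h1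
    simpa using congrFun h1 (Sum.inr ())
  have hA : M.toBlocks₁₁ * J (Fin n) ℚ_[p] * M.toBlocks₁₁ᵀ = μ • J (Fin n) ℚ_[p] := by
    ext i j
    have := congrFun (hlie (Pi.single (Sum.inl i) 1) (Pi.single (Sum.inl j) 1)) (Sum.inr ())
    rw [hrow, hs, hs, hJ, ← hμ, Pi.single_eq_same, neg_mul, neg_inj] at this
    rw [Matrix.smul_apply, smul_eq_mul, mul_comm μ, this, Matrix.mul_assoc, Matrix.mul_apply]
    simp only [dotProduct]
    refine Finset.sum_congr rfl fun k _ => ?_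
    congr 1
    · simp [toBlocks₁₁]
    · rw [Matrix.mul_apply]
      simp [mulVec, dotProduct, toBlocks₁₁]
  -- The determinants of `μ • J` and of `J` are nonzero, so `hA` forces `A` to be invertible.
  have hdet : M.toBlocks₁₁.det ≠ 0 := by
    intro hz
    have := congrArg Matrix.det hA
    rw [det_mul, det_mul, hz, zero_mul, zero_mul, det_smul, eq_comm, mul_eq_zero] at this
    rcases this with h | h
    · exact pow_ne_zero _ hμ0 h
    · simpa [h] using J_det_mul_J_det (Fin n) ℚ_[p]
  let A : GSp n ℚ_[p] := ⟨GeneralLinearGroup.mkOfDetNeZero M.toBlocks₁₁ hdet, Units.mk0 μ hμ0, hA⟩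
  have hmul : GSp.multiplier A = Units.mk0 μ hμ0 :=
    GSp.multiplier_unique (GSp.multiplier_spec A) hA
  refine ⟨⟨A, fun i => M (Sum.inl i) (Sum.inr ())⟩, rowMatrix_injective ?_⟩
  rw [rowMatrix_toAut]
  ext (i | i) (j | j)
  · rfl
  · rfl
  · exact (h0 j).symm
  · simp [GSpExt.toMatrix, hmul, hμ, hM]

/-- The group of pairs `(A, a)` is the automorphism group of `𝓗 ⊗ ℚ_p`. -/
noncomputable def autEquiv : GSpExt n p ≃* LocalHecke.G p (algebra n) :=
  MulEquiv.ofBijective toAut ⟨toAut_injective, toAut_surjective⟩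

theorem autEquiv_apply (x : GSpExt n p) : autEquiv x = toAut x := rfl

end Heisenberg

/-! ### The isomorphism of Hecke pairs and the local Hecke series -/

namespace HeckeRing

variable {G₁ G₂ : Type*} [Group G₁] [Group G₂] {Δ₁ : Submonoid G₁} {H₁ : Subgroup G₁}
  {Δ₂ : Submonoid G₂} {H₂ : Subgroup G₂}

theorem IsHeckeHom.of_mulEquiv (e : G₁ ≃* G₂) (hH : ∀ x, e x ∈ H₂ ↔ x ∈ H₁)
    (hΔ : ∀ x, e x ∈ Δ₂ ↔ x ∈ Δ₁) : IsHeckeHom Δ₁ H₁ Δ₂ H₂ (e : G₁ →* G₂) where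
  map_subgroup x hx := (hH x).2 hx
  map_submonoid x hx := (hΔ x).2 hx
  exists_lift g _ h hh := ⟨e.symm h, (hH _).1 (by simpa using hh), by simp⟩

end HeckeRing

namespace Heisenberg

open Matrix HeckeRing
open scoped TensorProduct

variable {n : ℕ} [NeZero n] {p : ℕ} [Fact p.Prime]

theorem autEquiv_mem_Delta (x : GSpExt n p) :
    autEquiv x ∈ LocalHecke.Delta p (algebra n) ↔ x ∈ GSpExt.Delta n p := by
  -- The integrality criterion concerns column vectors while automorphisms act on rows, hence the
  -- transpose.
  have h : (∀ i j, ‖GSpExt.toMatrix x i j‖ ≤ 1) ↔ ∀ i j, ‖(GSpExt.toMatrix x)ᵀ i j‖ ≤ 1 :=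
    ⟨fun h i j => h j i, fun h i j => h j i⟩
  rw [GSpExt.mem_Delta_iff, h, ← PadicLattice.mulVec_std]
  change (∀ v ∈ LocalHecke.lattice p (algebra n), LocalHecke.act (toAut x) v ∈ _) ↔ _
  simp only [mem_lattice, padicCoords_act, rowMatrix_toAut, mulVec_transpose]
  refine ⟨fun h v hv => ?_, fun h v hv => h _ hv⟩
  simpa using h ((padicCoords n p).symm v) (by simpa using hv)

theorem autEquiv_mem_Gamma (x : GSpExt n p) :
    autEquiv x ∈ LocalHecke.Gamma p (algebra n) ↔ x ∈ GSpExt.Gamma n p := by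
  change autEquiv x ∈ LocalHecke.Delta p (algebra n) ∧
    (autEquiv x)⁻¹ ∈ LocalHecke.Delta p (algebra n) ↔ _
  rw [← map_inv, autEquiv_mem_Delta, autEquiv_mem_Delta]
  constructor
  · exact fun h => ⟨⟨h.1.1, h.2.1⟩, h.1.2⟩
  · exact fun h => ⟨⟨h.1.1, h.2⟩, ⟨((GSpExt.Gamma n p).inv_mem h).1.1,
      ((GSpExt.Gamma n p).inv_mem h).2⟩⟩

theorem isHeckeHom_autEquiv : IsHeckeHom (GSpExt.Delta n p) (GSpExt.Gamma n p)
    (LocalHecke.Delta p (algebra n)) (LocalHecke.Gamma p (algebra n))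
    ((autEquiv : GSpExt n p ≃* _) : GSpExt n p →* _) :=
  .of_mulEquiv _ autEquiv_mem_Gamma autEquiv_mem_Delta

theorem isHeckeHom_autEquiv_symm : IsHeckeHom (LocalHecke.Delta p (algebra n))
    (LocalHecke.Gamma p (algebra n)) (GSpExt.Delta n p) (GSpExt.Gamma n p)
    ((autEquiv : GSpExt n p ≃* _).symm : _ →* GSpExt n p) :=
  .of_mulEquiv _ (fun x => by rw [← autEquiv_mem_Gamma, MulEquiv.apply_symm_apply])
    (fun x => by rw [← autEquiv_mem_Delta, MulEquiv.apply_symm_apply])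

/-- The isomorphism `R_{L_p} ≃ R̃` for the Heisenberg Lie algebra. -/
noncomputable def heckeEquiv : LocalHecke.R p (algebra n) ≃+* GSpExt.R n p :=
  (HeckeRing.mapEquiv autEquiv isHeckeHom_autEquiv isHeckeHom_autEquiv_symm).symm

theorem heckeEquiv_symm_T (ξ : GSpExt.Delta n p) :
    heckeEquiv.symm (T ξ) = (T ⟨autEquiv (ξ : GSpExt n p), (autEquiv_mem_Delta _).2 ξ.2⟩ :
      LocalHecke.R p (algebra n)) :=
  map_T_of_leftInverse isHeckeHom_autEquiv isHeckeHom_autEquiv_symm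
    (fun x => autEquiv.symm_apply_apply x) ξ

theorem exists_rowMatrix_eq (α : LocalHecke.Delta p (algebra n)) : ∃ ξ : GSpExt.Delta n p,
    rowMatrix (α : LocalHecke.G p (algebra n)) = GSpExt.toMatrix (ξ : GSpExt n p) ∧
      heckeEquiv (T α) = T ξ := by
  obtain ⟨α, hα⟩ := α
  obtain ⟨x, rfl⟩ := (autEquiv (n := n) (p := p)).surjective α
  refine ⟨⟨x, (autEquiv_mem_Delta x).1 hα⟩, rowMatrix_toAut x, ?_⟩
  rw [← RingEquiv.eq_symm_apply, heckeEquiv_symm_T]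

/-- In standard coordinates the index is `p` to the valuation of the determinant of `(A a; 0 μ(A))`.
This determinant is `det(A) μ(A)`, of valuation `n v(μ(A)) + v(μ(A))`. -/
theorem latticeIndex_autEquiv {x : GSpExt n p} (hx : x ∈ GSpExt.Delta n p) :
    LocalHecke.latticeIndex p (algebra n) (autEquiv x) =
      p ^ ((n + 1) * (GSp.multiplier x.fst : ℚ_[p]).valuation.toNat) := by
  let Λ := LocalHecke.lattice p (algebra n)
  let S := PadicLattice.std p ((Fin n ⊕ Fin n) ⊕ Unit)
  have hΛ : Λ.toAddSubgroup.map (padicCoords n p).toLinearMap.toAddMonoidHom =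
      S.toAddSubgroup := by
    ext f
    constructor
    · rintro ⟨v, hv, rfl⟩
      exact mem_lattice.1 hv
    · intro hf
      exact ⟨(padicCoords n p).symm f, mem_lattice.2 (by simpa using hf),
        (padicCoords n p).apply_symm_apply f⟩
  have hact : (Λ.toAddSubgroup.map (LocalHecke.act (autEquiv x)).toLinearMap.toAddMonoidHom).map
      (padicCoords n p).toLinearMap.toAddMonoidHom =
      S.toAddSubgroup.map (GSpExt.toMatrix x)ᵀ.mulVecLin.toAddMonoidHom := by
    rw [← hΛ, AddSubgroup.map_map, AddSubgroup.map_map]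
    congr 1
    ext1 v
    refine (padicCoords_act (autEquiv x) v).trans ?_
    rw [autEquiv_apply, rowMatrix_toAut, ← mulVec_transpose]
    rfl
  have hdet : ((GSpExt.toMatrix x)ᵀ).det = x.fst.1.1.det * (GSp.multiplier x.fst : ℚ_[p]) := by
    rw [det_transpose, GSpExt.toMatrix, det_fromBlocks_zero₂₁]
    simp
  have h₁ : x.fst.1.1.det ≠ 0 := x.fst.1.det_ne_zero
  have h₂ := (GSp.multiplier x.fst).ne_zero
  rw [LocalHecke.latticeIndex, ← AddSubgroup.relIndex_map_map_of_injective _ _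
    (f := (padicCoords n p).toLinearMap.toAddMonoidHom) (padicCoords n p).injective, hact, hΛ,
    PadicLattice.relIndex_map_mulVec (M := (GSpExt.toMatrix x)ᵀ)
      (fun i j => (GSpExt.mem_Delta_iff n p x).1 hx j i)
    (by rw [hdet]; exact mul_ne_zero h₁ h₂), hdet, Padic.valuation_mul h₁ h₂, GSp.valuation_det]
  congr 1
  have := GSpExt.valuation_nonneg ⟨_, hx.1⟩
  zify
  rw [Int.toNat_of_nonneg this, Int.toNat_of_nonneg (by positivity)]
  ring

theorem mk_autEquiv_mem_cosetsOfIndex {k : ℕ} {x : GSpExt n p} (hx : x ∈ GSpExt.Delta n p) :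
    HeckeCoset.mk _ _ (⟨autEquiv x, (autEquiv_mem_Delta x).2 hx⟩ :
      LocalHecke.Delta p (algebra n)) ∈ LocalHecke.cosetsOfIndex p (algebra n) k ↔
      (n + 1) * (GSp.multiplier x.fst : ℚ_[p]).valuation.toNat = k := by
  have hp := (Fact.out : p.Prime).two_le
  constructor
  · rintro ⟨⟨β, hβ⟩, e, hk⟩
    obtain ⟨y, rfl⟩ := (autEquiv (n := n) (p := p)).surjective β
    have hy := (autEquiv_mem_Delta y).1 hβ
    have e' := mk_eq_mk_of_map isHeckeHom_autEquiv_symm e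
    have e'' : HeckeCoset.mk (GSpExt.Gamma n p) (GSpExt.Gamma n p) ⟨x, hx⟩ =
        HeckeCoset.mk _ _ ⟨y, hy⟩ := by simpa using e'
    rw [GSpExt.valuation_multiplier_fst_eq_of_mk_eq (x := ⟨x, hx⟩) (y := ⟨y, hy⟩) e'']
    rw [latticeIndex_autEquiv hy] at hk
    exact Nat.pow_right_injective hp hk
  · rintro rfl
    exact ⟨_, rfl, latticeIndex_autEquiv hx⟩

/-- `heckeEquiv` is the inverse of the pushforward along `autEquiv`. That pushforward merely
relabels left cosets, so its inverse is pullback of functions. -/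
theorem toCosets_heckeEquiv (f : LocalHecke.R p (algebra n)) (x : GSpExt n p) :
    toCosets (heckeEquiv f) (x : GSpExt n p ⧸ GSpExt.Gamma n p) =
      toCosets f (autEquiv x : LocalHecke.G p (algebra n) ⧸ LocalHecke.Gamma p (algebra n)) := by
  have hinj : Function.Injective (cosetMap (isHeckeHom_autEquiv (n := n) (p := p))) := by
    refine Function.LeftInverse.injective (g := cosetMap isHeckeHom_autEquiv_symm) fun y => ?_
    induction y using QuotientGroup.induction_on with
    | H x =>
      rw [cosetMap_mk, cosetMap_mk]
      exact congrArg _ (autEquiv.symm_apply_apply x)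
  obtain ⟨g, rfl⟩ := heckeEquiv.symm.surjective f
  rw [RingEquiv.apply_symm_apply]
  change _ = toCosets (HeckeRing.map isHeckeHom_autEquiv g) _
  rw [toCosets_map]
  exact (Finsupp.mapDomain_apply hinj _ (x : GSpExt n p ⧸ GSpExt.Gamma n p)).symm

/-- Only exponents divisible by `n + 1` occur in the indices, and exponent `(n + 1) v` singles out
exactly the double cosets with multiplier of valuation `v`. -/
theorem heckeEquiv_Tpow (k : ℕ) : heckeEquiv (LocalHecke.Tpow p (algebra n) k) =
    if n + 1 ∣ k then GSpExt.Tpow n p (k / (n + 1)) else 0 := by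
  classical
  refine toCosets_injective ?_
  ext y
  induction y using QuotientGroup.induction_on with
  | H x =>
    by_cases hx : x ∈ GSpExt.Delta n p
    · rw [toCosets_heckeEquiv, LocalHecke.Tpow,
        toCosets_sumCosets _ ((autEquiv_mem_Delta x).2 hx)]
      simp only [mk_autEquiv_mem_cosetsOfIndex hx]
      split_ifs with h₁ h₂ h₂
      · subst h₁
        rw [GSpExt.Tpow, toCosets_sumCosets _ hx, if_pos]
        rw [GSpExt.mk_mem_cosetsOfVal, Nat.mul_div_cancel_left _ n.succ_pos]
        exact (Int.toNat_of_nonneg (GSpExt.valuation_nonneg ⟨_, hx.1⟩)).symm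
      · exact absurd ⟨_, h₁.symm⟩ h₂
      · rw [GSpExt.Tpow, toCosets_sumCosets _ hx, if_neg]
        rw [GSpExt.mk_mem_cosetsOfVal]
        intro h
        apply h₁
        change (GSp.multiplier x.fst : ℚ_[p]).valuation = _ at h
        rw [h, Int.toNat_natCast, Nat.mul_div_cancel' h₂]
      · rw [map_zero]; rfl
    · have h0 : ∀ r : GSpExt.R n p, toCosets r (x : GSpExt n p ⧸ GSpExt.Gamma n p) = 0 :=
        fun r => by
          by_contra hr
          exact hx (mk_mem_cosetsIn.1 (mem_cosetsIn_of_toCosets_ne_zero hr))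
      rw [h0, h0]

theorem map_heckeEquiv_heckeSeries :
    PowerSeries.map ((heckeEquiv : LocalHecke.R p (algebra n) ≃+* GSpExt.R n p) :
      LocalHecke.R p (algebra n) →+* GSpExt.R n p)
      (LocalHecke.heckeSeries p (algebra n)) =
      (GSpExt.heckeSeries n p).substMonomial 1 (n + 1) := by
  ext1 k
  rw [PowerSeries.coeff_map, LocalHecke.heckeSeries, PowerSeries.coeff_mk,
    PowerSeries.substMonomial, PowerSeries.coeff_mk, one_pow, one_smul, GSpExt.heckeSeries,
    PowerSeries.coeff_mk]
  exact heckeEquiv_Tpow k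

end Heisenberg

/-! ### The four maps and the identities of Hecke series -/

theorem mainTheorem3 (n : ℕ) [NeZero n] (p : ℕ) [Fact p.Prime] :
    ∃ (s : GSp.R n p →+* GSpExt.R n p) (θ : GSpExt.R n p →+* GSpExt.R n p)
      (φ : GSpExt.R n p →+* GSp.R n p)
      (ι : LocalHecke.R p (Heisenberg.algebra n) ≃+* GSpExt.R n p),
      -- `s` is the injection `T(A) ↦ T̃(A, 0)`
      (∀ A : GSp.Delta n p, s (HeckeRing.T A) = HeckeRing.T (GSpExt.ofDelta A)) ∧
      Function.Injective s ∧
      -- `θ` is the endomorphism with `T̃(A, a) T̃(pE, 0) = T̃(pE, 0) T̃(A, a)^θ`,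
      -- where `T̃(pE, 0)` is a left nonzero divisor
      (∀ x : GSpExt.R n p, HeckeRing.T (GSpExt.C₀ n p) * x = 0 → x = 0) ∧
      (∀ ξ : GSpExt.Delta n p, HeckeRing.T ξ * HeckeRing.T (GSpExt.C₀ n p) =
        HeckeRing.T (GSpExt.C₀ n p) * θ (HeckeRing.T ξ)) ∧
      -- `φ` is `s⁻¹` composed with the limit of the iterates of `θ`
      (∀ ξ : GSpExt.Delta n p, ∃ N : ℕ, ∀ m ≥ N,
        (⇑θ)^[m] (HeckeRing.T ξ) = s (φ (HeckeRing.T ξ))) ∧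
      -- `ι` is the identification of the local Hecke ring of the Heisenberg Lie algebra with `R̃`
      (∀ α : LocalHecke.Delta p (Heisenberg.algebra n), ∃ ξ : GSpExt.Delta n p,
        Heisenberg.rowMatrix (α : LocalHecke.G p (Heisenberg.algebra n)) =
          GSpExt.toMatrix (ξ : GSpExt n p) ∧
        ι (HeckeRing.T α) = HeckeRing.T ξ) ∧
      -- the properties of `s`, `θ` and `φ`
      φ.comp s = RingHom.id (GSp.R n p) ∧
      φ.comp θ = φ ∧
      (∀ A : GSp.Delta n p, φ (GSpExt.TFiber A) =
        p ^ (n * (GSp.multiplier (A : GSp n ℚ_[p]) : ℚ_[p]).valuation.toNat) • HeckeRing.T A) ∧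
      -- the Hecke series
      PowerSeries.map φ (GSpExt.heckeSeries n p) =
        (GSp.heckeSeries n p).substMonomial (p ^ n) 1 ∧
      PowerSeries.map (ι : LocalHecke.R p (Heisenberg.algebra n) →+* GSpExt.R n p)
          (LocalHecke.heckeSeries p (Heisenberg.algebra n)) =
        (GSpExt.heckeSeries n p).substMonomial 1 (n + 1) ∧
      PowerSeries.map (φ.comp (ι : LocalHecke.R p (Heisenberg.algebra n) →+* GSpExt.R n p))
          (LocalHecke.heckeSeries p (Heisenberg.algebra n)) =
        (GSp.heckeSeries n p).substMonomial (p ^ n) (n + 1) := by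
  refine ⟨GSpExt.sHom, GSpExt.thetaHom, GSpExt.phiHom, Heisenberg.heckeEquiv, GSpExt.sHom_T,
    Function.LeftInverse.injective GSpExt.phiHom_sHom,
    fun _ => GSpExt.eq_zero_of_T_C₀_mul_eq_zero, fun _ => GSpExt.mul_T_C₀ _,
    GSpExt.iterate_thetaHom_T, Heisenberg.exists_rowMatrix_eq, RingHom.ext GSpExt.phiHom_sHom,
    RingHom.ext GSpExt.phiHom_thetaHom, GSpExt.phiHom_TFiber, GSpExt.map_phiHom_heckeSeries,
    Heisenberg.map_heckeEquiv_heckeSeries, ?_⟩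
  rw [PowerSeries.map_comp, RingHom.comp_apply, Heisenberg.map_heckeEquiv_heckeSeries]
  ext1 k
  -- In degree `k` the substitution `X ↦ X^{n+1}` leaves only the coefficient of index `k / (n +
  -- 1)`, to which the identity for `φ` applied to `P̃_n` is specialised.
  have h := congrArg (PowerSeries.coeff (k / (n + 1))) (GSpExt.map_phiHom_heckeSeries (n := n)
    (p := p))
  rw [PowerSeries.coeff_map, PowerSeries.substMonomial, PowerSeries.coeff_mk,
    if_pos (one_dvd _), Nat.div_one] at h
  rw [PowerSeries.coeff_map, PowerSeries.substMonomial, PowerSeries.substMonomial,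
    PowerSeries.coeff_mk, PowerSeries.coeff_mk, one_pow, one_smul, apply_ite GSpExt.phiHom, h,
    map_zero]
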